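/- For a convex polytope $P\subset\mathbb R^3$ and $x\in\mathbb R^3$ let $\omega_P(x)=\mathrm{vol}(B_\varepsilon(x)\cap P)/\mathrm{vol}(B_\varepsilon(x))$ for all sufficiently small $\varepsilon>0$, where $B_\varepsilon(x)$ is the ball of radius $\varepsilon$ centered at $x$. Define the discrete volume $\chi(P)=\sum_{x\in P\cap\mathbb Z^3}\omega_P(x)$ and the volume defect $\delta(P)=\chi(P)-\mathrm{vol}(P)$. A Kagan function is a function $f:\mathbb R\to\mathbb R$ with $f(a+b)=f(a)+f(b)$ for all $a,b\in\mathbb R$ and $f(\pi)=0$; for such $f$ let $D_f(P)=\sum_{e}\ell(e)\,f(\alpha_e)$, where $e$ runs over the edges of $P$, $\ell(e)$ is the length of $e$, and $\alpha_e$ is the dihedral angle of $P$ at $e$. Let $$\begin{aligned} T_1&=\mathrm{conv}\{(0,0,0),(1,1,0),(1,0,1),(0,1,1)\},\\ T_2&=\mathrm{conv}\{(0,0,0),(2,2,-1),(2,-1,2),(1,-2,-2)\},\\ T_3&=\mathrm{conv}\{(0,0,0),(2,2,-1),(3,0,-3),(5,-1,-1)\}, \end{aligned}$$ and let $P=5T_1+12T_2+19T_3$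 (Minkowski sum of dilates). Then $\delta(P)=0$. Moreover, $D_f(P)=-24\sqrt2\,f(\arccos\tfrac13)$ for every Kagan function $f$, and $D_f(P)\neq0$ for some Kagan function $f$. -/

import Mathlib

open MeasureTheory Filter Topology
open scoped Pointwise

noncomputable section

/-- The integer lattice `ℤ^d` as a subset of Euclidean space. -/
def integerLattice (d : ℕ) : Set (EuclideanSpace ℝ (Fin d)) :=
  {x | ∀ i, ∃ n : ℤ, x i = n}

/-- The solid angle of `P` at `x`: the proportion of a small ball centred at `x` that lies in `P`.
For a convex polytope `P` this proportion is constant for all sufficiently small radii, so that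
its limit as the radius tends to `0` is that common value. -/
def solidAngle {d : ℕ} (P : Set (EuclideanSpace ℝ (Fin d))) (x : EuclideanSpace ℝ (Fin d)) : ℝ :=
  limUnder (𝓝[>] (0 : ℝ)) fun ε =>
    volume.real (Metric.ball x ε ∩ P) / volume.real (Metric.ball x ε)

/-- The (regularised) discrete volume `χ(P)`: the sum of the solid angles of `P` over all
integer points of `P` (a finite sum, as polytopes are bounded). -/
def discreteVolume {d : ℕ} (P : Set (EuclideanSpace ℝ (Fin d))) : ℝ :=
  ∑ᶠ x ∈ P ∩ integerLattice d, solidAngle P x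

/-- The volume defect `δ(P) = χ(P) - vol(P)`. -/
def volumeDefect {d : ℕ} (P : Set (EuclideanSpace ℝ (Fin d))) : ℝ :=
  discreteVolume P - volume.real P

/-- The edges of a convex polytope: its one-dimensional (exposed) faces. -/
def polytopeEdges (P : Set (EuclideanSpace ℝ (Fin 3))) : Set (Set (EuclideanSpace ℝ (Fin 3))) :=
  {e | IsExposed ℝ P e ∧ Module.finrank ℝ (vectorSpan ℝ e) = 1}

/-- The dihedral angle of a convex polytope `P` at its edge `e`, measured in the planes
perpendicular to `e`: the section of `P` by such a plane through a point `p` in the relative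
interior of `e` is a convex polygon with a vertex at `p`, and its interior angle at `p` is the
largest angle `∠ y p z` between points `y`, `z` of the section. (The sections through the two
endpoints of `e` contribute no larger angle.) -/
def dihedralAngle (P e : Set (EuclideanSpace ℝ (Fin 3))) : ℝ :=
  sSup {θ | ∃ p ∈ e, ∃ y ∈ P, ∃ z ∈ P, y ≠ p ∧ z ≠ p ∧
    y - p ∈ (vectorSpan ℝ e)ᗮ ∧ z - p ∈ (vectorSpan ℝ e)ᗮ ∧ θ = EuclideanGeometry.angle y p z}

/-- A Kagan function: an additive function `f : ℝ → ℝ` with `f(π) = 0`. -/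
def IsKagan (f : ℝ → ℝ) : Prop :=
  (∀ a b : ℝ, f (a + b) = f a + f b) ∧ f Real.pi = 0

/-- The Dehn invariant `D_f(P)`: the sum over all edges `e` of `P` of the length of `e` times
`f` of the dihedral angle at `e` (a finite sum for a polytope `P`). -/
def dehnInvariant (f : ℝ → ℝ) (P : Set (EuclideanSpace ℝ (Fin 3))) : ℝ :=
  ∑ᶠ e ∈ polytopeEdges P, Metric.diam e * f (dihedralAngle P e)

/-- The regular lattice tetrahedron with edge length `√2`. -/
def tetrahedronT₁ : Set (EuclideanSpace ℝ (Fin 3)) :=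
  convexHull ℝ {!₂[0, 0, 0], !₂[1, 1, 0], !₂[1, 0, 1], !₂[0, 1, 1]}

/-- The standard tetrahedron with three pairwise orthogonal edges of length `3` at the origin. -/
def tetrahedronT₂ : Set (EuclideanSpace ℝ (Fin 3)) :=
  convexHull ℝ {!₂[0, 0, 0], !₂[2, 2, -1], !₂[2, -1, 2], !₂[1, -2, -2]}

/-- The orthoscheme (path simplex) formed by three pairwise orthogonal edges of length `3`. -/
def tetrahedronT₃ : Set (EuclideanSpace ℝ (Fin 3)) :=
  convexHull ℝ {!₂[0, 0, 0], !₂[2, 2, -1], !₂[3, 0, -3], !₂[5, -1, -1]}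

/-- The Minkowski sum `P = 5 T₁ + 12 T₂ + 19 T₃`. -/
def polytopeP : Set (EuclideanSpace ℝ (Fin 3)) :=
  (5 : ℝ) • tetrahedronT₁ + (12 : ℝ) • tetrahedronT₂ + (19 : ℝ) • tetrahedronT₃

end

/-!
Both invariants of `P` are combinations of those of the tetrahedra, with coefficients `5, 12, 19`.

The arc of outer normals of an edge of a summand is cut by the facet normals of `P` into the normal
arcs of the edges of `P` to which this edge contributes, so an additive `f` gives
`D_f(P) = 5 D_f(T₁) + 12 D_f(T₂) + 19 D_f(T₃)`. Here `D_f(T₃) = 0`, because the dihedral angles of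
`T₃` are rational multiples of `π`, and the dihedral angle `arccos (1 / √3)` of `T₂` at its base is
half the supplement of the angle `arccos (1 / 3)` of `T₁`. The latter is not a rational multiple of
`π`, so some Kagan function does not vanish at it.

The volume defect is additive under dissections and invariant under lattice translations and
point reflections. It vanishes for lattice parallelepipeds, whose translates tile space, and for
triangular lattice prisms, two of which form a parallelepiped. A mixed subdivision of `P` cuts it
into translates of `5 T₁`, `12 T₂` and `19 T₃` and mixed cells of these two kinds, and subdividing
`(n + 1) T = T + n T` likewise gives `δ(n T) = n δ(T)`. Thus `δ(P) = 5 δ(T₁) + 12 δ(T₂) + 19 δ(T₃)`,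
and the defects of the tetrahedra follow from the solid angles at their lattice points.
-/

/-! ### Minkowski sums and their faces -/

section Argmax

variable {α R S : Type*} [Fintype α] [LinearOrder R] [LinearOrder S] {φ ψ : α → R} {a : α}

/-- The set of points at which a function on a finite type is largest. -/
def argmax (φ : α → R) : Finset α := {a | ∀ b, φ b ≤ φ a}

theorem mem_argmax : a ∈ argmax φ ↔ ∀ b, φ b ≤ φ a := by simp [argmax]

theorem argmax_nonempty [Nonempty α] (φ : α → R) : (argmax φ).Nonempty := by
  obtain ⟨a, ha⟩ := Finite.exists_max φ
  exact ⟨a, mem_argmax.2 ha⟩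

theorem mem_argmax_of_eq {b : α} (hb : b ∈ argmax φ) (h : φ a = φ b) : a ∈ argmax φ :=
  mem_argmax.2 fun c => (mem_argmax.1 hb c).trans_eq h.symm

theorem argmax_comp_of_strictMono {g : R → S} (hg : StrictMono g) (φ : α → R) :
    argmax (g ∘ φ) = argmax φ := by
  ext a
  simp only [mem_argmax, Function.comp_apply, hg.le_iff_le]

theorem argmax_add [DecidableEq α] [AddCommGroup R] [IsOrderedAddMonoid R]
    (h : (argmax φ ∩ argmax ψ).Nonempty) : argmax (φ + ψ) = argmax φ ∩ argmax ψ := by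
  obtain ⟨c, hc⟩ := h
  rw [Finset.mem_inter, mem_argmax, mem_argmax] at hc
  ext a
  simp only [Finset.mem_inter, mem_argmax, Pi.add_apply]
  refine ⟨fun ha => ?_, fun ha b => add_le_add (ha.1 b) (ha.2 b)⟩
  obtain ⟨h1, h2⟩ := (add_eq_add_iff_eq_and_eq (hc.1 a) (hc.2 a)).1
    ((add_le_add (hc.1 a) (hc.2 a)).antisymm (ha c))
  exact ⟨fun b => h1 ▸ hc.1 b, fun b => h2 ▸ hc.2 b⟩

end Argmax

section MinkowskiSum

variable {ι α E : Type*} [Fintype α]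

/-- Nonnegative coefficients supported in `M` whose `i`-th row sums to `lam i`: these parametrise
the Minkowski sum of the polytopes `lam i • conv (t i '' M i)`. -/
structure IsWeight (lam : ι → ℝ) (M : ι → Finset α) (c : ι → α → ℝ) : Prop where
  nonneg : ∀ i a, 0 ≤ c i a
  eq_zero : ∀ i, ∀ a ∉ M i, c i a = 0
  sum_eq : ∀ i, ∑ a, c i a = lam i

theorem convex_isWeight {lam : ι → ℝ} {M : ι → Finset α} : Convex ℝ {c | IsWeight lam M c} := by
  intro c hc c' hc' p q hp hq hpq
  refine ⟨fun i a => ?_, fun i a ha => ?_, fun i => ?_⟩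
  · exact add_nonneg (mul_nonneg hp (hc.nonneg i a)) (mul_nonneg hq (hc'.nonneg i a))
  · simp [hc.eq_zero i a ha, hc'.eq_zero i a ha]
  · simp only [Pi.add_apply, Pi.smul_apply, Finset.sum_add_distrib, ← Finset.smul_sum, hc.sum_eq,
      hc'.sum_eq, ← add_smul, hpq, one_smul]

variable [Fintype ι] [AddCommGroup E] [Module ℝ E] {t : ι → α → E} {lam : ι → ℝ}
  {M : ι → Finset α} {c : ι → α → ℝ}

/-- The linear combination of the points `t i a` with coefficients `c i a`. -/
def weightedPoint (t : ι → α → E) (c : ι → α → ℝ) : E := ∑ i, ∑ a, c i a • t i a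

/-- The Minkowski sum of the polytopes `lam i • conv (t i '' M i)`. -/
def minkowskiSum (t : ι → α → E) (lam : ι → ℝ) (M : ι → Finset α) : Set E :=
  weightedPoint t '' {c | IsWeight lam M c}

theorem map_weightedPoint {F : Type*} [AddCommGroup F] [Module ℝ F] (l : E →ₗ[ℝ] F)
    (t : ι → α → E) (c : ι → α → ℝ) :
    l (weightedPoint t c) = weightedPoint (fun i a => l (t i a)) c := by
  simp [weightedPoint]

namespace IsWeight

theorem weightedPoint_congr {s : ι → α → E} (hc : IsWeight lam M c)
    (h : ∀ i, ∀ a ∈ M i, t i a = s i a) : weightedPoint t c = weightedPoint s c := by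
  refine Finset.sum_congr rfl fun i _ => Finset.sum_congr rfl fun a _ => ?_
  by_cases ha : a ∈ M i
  · rw [h i a ha]
  · rw [hc.eq_zero i a ha, zero_smul, zero_smul]

theorem weightedPoint_eq {p : ι → E} (hc : IsWeight lam M c) (h : ∀ i, ∀ a ∈ M i, t i a = p i) :
    weightedPoint t c = ∑ i, lam i • p i := by
  rw [hc.weightedPoint_congr h, weightedPoint]
  simp only [← Finset.sum_smul, hc.sum_eq]

theorem weightedPoint_le {φ : ι → α → ℝ} {h : ι → ℝ} (hc : IsWeight lam M c)
    (hφ : ∀ i, ∀ a ∈ M i, φ i a ≤ h i) : weightedPoint φ c ≤ ∑ i, lam i * h i := by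
  refine Finset.sum_le_sum fun i _ => ?_
  rw [← hc.sum_eq i, Finset.sum_mul]
  refine Finset.sum_le_sum fun a _ => ?_
  by_cases ha : a ∈ M i
  · exact mul_le_mul_of_nonneg_left (hφ i a ha) (hc.nonneg i a)
  · simp [hc.eq_zero i a ha]

theorem eq_zero_of_weightedPoint_eq {φ : ι → α → ℝ} {h : ι → ℝ} (hc : IsWeight lam M c)
    (hφ : ∀ i, ∀ a ∈ M i, φ i a ≤ h i) (heq : weightedPoint φ c = ∑ i, lam i * h i) {i : ι}
    {a : α} (ha : φ i a ≠ h i) : c i a = 0 := by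
  have hnonneg : ∀ i a, 0 ≤ c i a * (h i - φ i a) := fun i a => by
    by_cases ha : a ∈ M i
    · exact mul_nonneg (hc.nonneg i a) (sub_nonneg.2 (hφ i a ha))
    · simp [hc.eq_zero i a ha]
  have hsum : ∑ i, ∑ a, c i a * (h i - φ i a) = 0 := by
    simp only [mul_sub, Finset.sum_sub_distrib, ← Finset.sum_mul, hc.sum_eq, ← heq,
      weightedPoint, smul_eq_mul, sub_self]
  have hrow := (Finset.sum_eq_zero_iff_of_nonneg
    fun i _ => Finset.sum_nonneg fun a _ => hnonneg i a).1 hsum i (Finset.mem_univ _)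
  have hterm := (Finset.sum_eq_zero_iff_of_nonneg fun a _ => hnonneg i a).1 hrow a
    (Finset.mem_univ _)
  exact (mul_eq_zero.1 hterm).resolve_right (sub_ne_zero.2 ha.symm)

end IsWeight

theorem sum_smul_mem_minkowskiSum (hlam : ∀ i, 0 ≤ lam i) {g : ι → α} (hg : ∀ i, g i ∈ M i) :
    ∑ i, lam i • t i (g i) ∈ minkowskiSum t lam M := by
  classical
  refine ⟨fun i => Pi.single (g i) (lam i), ⟨fun i a => ?_, fun i a ha => ?_, fun i => ?_⟩, ?_⟩
  · have h : 0 ≤ (Pi.single (g i) (lam i) : α → ℝ) := Pi.single_nonneg.2 (hlam i)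
    exact h a
  · exact Pi.single_eq_of_ne (fun h : a = g i => ha (h ▸ hg i)) _
  · simp
  · simp [weightedPoint, Pi.single_apply, ite_smul]

theorem minkowskiSum_mono {M' : ι → Finset α} (h : ∀ i, M i ⊆ M' i) :
    minkowskiSum t lam M ⊆ minkowskiSum t lam M' :=
  Set.image_mono fun _ hc =>
    { hc with eq_zero := fun i a ha => hc.eq_zero i a fun h' => ha (h i h') }

theorem convex_minkowskiSum : Convex ℝ (minkowskiSum t lam M) :=
  convex_isWeight.is_linear_image ⟨fun c c' => by
    simp only [weightedPoint, Pi.add_apply, add_smul, Finset.sum_add_distrib], fun r c => by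
    simp only [weightedPoint, Pi.smul_apply, smul_eq_mul, mul_smul, Finset.smul_sum]⟩

theorem mem_minkowskiSum_face_iff {M' : ι → Finset α} (l : E →ₗ[ℝ] ℝ) {h : ι → ℝ}
    (hM : ∀ i, M' i ⊆ M i) (hle : ∀ i, ∀ a ∈ M i, l (t i a) ≤ h i)
    (hiff : ∀ i, ∀ a ∈ M i, a ∈ M' i ↔ l (t i a) = h i) {x : E} :
    x ∈ minkowskiSum t lam M' ↔ x ∈ minkowskiSum t lam M ∧ l x = ∑ i, lam i * h i := by
  constructor
  · intro hx
    refine ⟨minkowskiSum_mono hM hx, ?_⟩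
    obtain ⟨c, hc, rfl⟩ := hx
    rw [map_weightedPoint]
    exact hc.weightedPoint_eq fun i a ha => (hiff i a (hM i ha)).1 ha
  · rintro ⟨⟨c, hc, rfl⟩, hl⟩
    rw [map_weightedPoint] at hl
    refine ⟨c, { hc with eq_zero := fun i a ha => ?_ }, rfl⟩
    by_cases haM : a ∈ M i
    · exact hc.eq_zero_of_weightedPoint_eq hle hl fun h' => ha ((hiff i a haM).2 h')
    · exact hc.eq_zero i a haM

theorem le_of_mem_minkowskiSum (l : E →ₗ[ℝ] ℝ) {h : ι → ℝ}
    (hle : ∀ i, ∀ a ∈ M i, l (t i a) ≤ h i) {x : E} (hx : x ∈ minkowskiSum t lam M) :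
    l x ≤ ∑ i, lam i * h i := by
  obtain ⟨c, hc, rfl⟩ := hx
  rw [map_weightedPoint]
  exact hc.weightedPoint_le hle

theorem minkowskiSum_eq_sum (hlam : ∀ i, 0 < lam i) :
    minkowskiSum t lam M = ∑ i, lam i • convexHull ℝ (t i '' M i) := by
  apply Set.Subset.antisymm
  · rintro _ ⟨c, hc, rfl⟩
    refine (Set.mem_fintype_sum _ _).2 ⟨fun i => ∑ a, c i a • t i a, fun i => ?_, rfl⟩
    have hsupp : ∀ a ∉ M i, c i a = 0 := hc.eq_zero i
    refine ⟨∑ a ∈ M i, (c i a / lam i) • t i a, ?_, ?_⟩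
    · refine (convex_convexHull ℝ _).sum_mem (fun a _ => div_nonneg (hc.nonneg i a) (hlam i).le) ?_
        fun a ha => subset_convexHull ℝ _ ⟨a, ha, rfl⟩
      rw [← Finset.sum_div, Finset.sum_subset (Finset.subset_univ _) fun a _ ha => hsupp a ha,
        hc.sum_eq, div_self (hlam i).ne']
    · simp only [Finset.smul_sum, smul_smul, mul_div_cancel₀ _ (hlam i).ne']
      exact Finset.sum_subset (Finset.subset_univ _) fun a _ ha => by rw [hsupp a ha, zero_smul]
  · simp only [← convexHull_smul, ← convexHull_sum]
    refine convexHull_min ?_ convex_minkowskiSum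
    intro x hx
    obtain ⟨g, hg, rfl⟩ := (Set.mem_fintype_sum _ _).1 hx
    choose y hy hyg using hg
    choose a ha hay using hy
    simp only [← hyg, ← hay]
    exact sum_smul_mem_minkowskiSum (fun i => (hlam i).le) ha

theorem minkowskiSum_subsingleton (hM : ∀ i, (M i : Set α).Subsingleton) :
    (minkowskiSum t lam M).Subsingleton := by
  rintro _ ⟨c, hc, rfl⟩ _ ⟨c', hc', rfl⟩
  suffices c = c' by rw [this]
  have hval : ∀ c, IsWeight lam M c → ∀ i, ∀ a ∈ M i, c i a = lam i := fun c hc i a ha => by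
    rw [← hc.sum_eq i, eq_comm]
    exact Fintype.sum_eq_single a fun b hb => hc.eq_zero i b fun h => hb (hM i h ha)
  ext i a
  by_cases ha : a ∈ M i
  · rw [hval c hc i a ha, hval c' hc' i a ha]
  · rw [hc.eq_zero i a ha, hc'.eq_zero i a ha]

theorem sub_mem_vectorSpan_minkowskiSum (hlam : ∀ i, 0 < lam i) (hM : ∀ i, (M i).Nonempty) {i : ι}
    {a b : α} (ha : a ∈ M i) (hb : b ∈ M i) :
    t i b - t i a ∈ vectorSpan ℝ (minkowskiSum t lam M) := by
  classical
  choose g hg using hM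
  have hmem : ∀ c ∈ M i, ∑ j, lam j • t j (Function.update g i c j) ∈ minkowskiSum t lam M :=
    fun c hc => sum_smul_mem_minkowskiSum (fun j => (hlam j).le) fun j => by
      obtain rfl | hj := eq_or_ne j i
      · simpa using hc
      · simpa [Function.update_of_ne hj] using hg j
  have h := vsub_mem_vectorSpan ℝ (hmem b hb) (hmem a ha)
  rw [vsub_eq_sub, ← Finset.sum_sub_distrib, Finset.sum_eq_single_of_mem i (Finset.mem_univ _)
    fun j _ hj => by simp [Function.update_of_ne hj], ← smul_sub,
    Submodule.smul_mem_iff _ (hlam i).ne'] at h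
  simpa using h

theorem minkowskiSum_eq_segment {p q : ι → α} {ρ : ι → ℝ} {d : E} (hlam : ∀ i, 0 < lam i)
    (hρ : ∀ i, 0 ≤ ρ i) (hM : ∀ i, ∀ a, a ∈ M i ↔ a = p i ∨ a = q i)
    (hq : ∀ i, t i (q i) = t i (p i) + ρ i • d) :
    minkowskiSum t lam M = segment ℝ (∑ i, lam i • t i (p i)) (∑ i, lam i • t i (q i)) := by
  classical
  refine Set.Subset.antisymm ?_ (convex_minkowskiSum.segment_subset
    (sum_smul_mem_minkowskiSum (fun i => (hlam i).le) fun i => (hM i _).2 (.inl rfl))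
    (sum_smul_mem_minkowskiSum (fun i => (hlam i).le) fun i => (hM i _).2 (.inr rfl)))
  rintro _ ⟨c, hc, rfl⟩
  let σ : ι → α → ℝ := fun i a => if a = p i then 0 else ρ i
  have hσ0 : ∀ i a, 0 ≤ σ i a := fun i a => by simp only [σ]; split_ifs; exacts [le_rfl, hρ i]
  have hσρ : ∀ i a, σ i a ≤ ρ i := fun i a => by simp only [σ]; split_ifs; exacts [hρ i, le_rfl]
  have ht : ∀ i, ∀ a ∈ M i, t i a = t i (p i) + σ i a • d := fun i a ha => by
    by_cases hap : a = p i
    · simp [σ, hap]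
    · obtain rfl := ((hM i a).1 ha).resolve_left hap
      simp [σ, hap, hq]
  have hpoint : weightedPoint t c = ∑ i, lam i • t i (p i) + weightedPoint σ c • d := by
    rw [hc.weightedPoint_congr ht]
    simp only [weightedPoint, smul_add, Finset.sum_add_distrib, ← Finset.sum_smul, hc.sum_eq,
      smul_smul, smul_eq_mul]
  have hend : ∑ i, lam i • t i (q i) = ∑ i, lam i • t i (p i) + (∑ i, lam i * ρ i) • d := by
    simp only [hq, smul_add, Finset.sum_add_distrib, smul_smul, ← Finset.sum_smul]
  have hle : weightedPoint σ c ≤ ∑ i, lam i * ρ i := hc.weightedPoint_le fun i a _ => hσρ i a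
  have hnonneg : 0 ≤ weightedPoint σ c :=
    Finset.sum_nonneg fun i _ => Finset.sum_nonneg fun a _ => mul_nonneg (hc.nonneg i a) (hσ0 i a)
  rw [hpoint, hend, segment_eq_image']
  refine ⟨weightedPoint σ c / ∑ i, lam i * ρ i,
    ⟨div_nonneg hnonneg (hnonneg.trans hle), div_le_one_of_le₀ hle (hnonneg.trans hle)⟩, ?_⟩
  simp only [add_sub_cancel_left, smul_smul]
  rw [div_mul_cancel_of_imp fun h => le_antisymm (h ▸ hle) hnonneg]

end MinkowskiSum

section MaximalFace

variable {ι α E : Type*} [Fintype α] [NormedAddCommGroup E] [InnerProductSpace ℝ E]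
  {t : ι → α → E} {lam : ι → ℝ}

/-- The indices of the points of each family `t i` at which the functional `⟪u, ·⟫` is largest.
They span the face of `∑ lam i • conv (t i)` with outer normal `u`. -/
noncomputable def maximizers (t : ι → α → E) (u : E) (i : ι) : Finset α :=
  argmax fun a => inner ℝ u (t i a)

theorem maximizers_smul (t : ι → α → E) {r : ℝ} (hr : 0 < r) (u : E) :
    maximizers t (r • u) = maximizers t u := by
  funext i
  simp only [maximizers, real_inner_smul_left]
  exact argmax_comp_of_strictMono (strictMono_mul_left_of_pos hr) fun a => inner ℝ u (t i a)

theorem maximizers_add [DecidableEq α] {u v : E}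
    (h : ∀ i, (maximizers t u i ∩ maximizers t v i).Nonempty) :
    maximizers t (u + v) = fun i => maximizers t u i ∩ maximizers t v i := by
  funext i
  simp only [maximizers, inner_add_left]
  exact argmax_add (h i)

variable [Nonempty α]

theorem maximizers_nonempty (t : ι → α → E) (u : E) (i : ι) : (maximizers t u i).Nonempty :=
  argmax_nonempty _

variable [Fintype ι]

theorem mem_minkowskiSum_maximizers (hlam : ∀ i, 0 ≤ lam i) {u x : E} :
    x ∈ minkowskiSum t lam (maximizers t u) ↔ x ∈ minkowskiSum t lam (fun _ => Finset.univ) ∧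
      ∀ y ∈ minkowskiSum t lam (fun _ => Finset.univ), inner ℝ u y ≤ inner ℝ u x := by
  let l : E →ₗ[ℝ] ℝ := innerₗ E u
  choose g hg using maximizers_nonempty t u
  have hle : ∀ i, ∀ a ∈ Finset.univ, l (t i a) ≤ l (t i (g i)) := fun i a _ =>
    mem_argmax.1 (hg i) a
  have hface := fun x => mem_minkowskiSum_face_iff (x := x) (lam := lam) l
    (M' := maximizers t u) (fun i => Finset.subset_univ _) hle
    fun i a _ => ⟨fun ha => (hle i a (Finset.mem_univ _)).antisymm (mem_argmax.1 ha _),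
      fun ha => mem_argmax_of_eq (hg i) ha⟩
  have hmax := (hface _).1 (sum_smul_mem_minkowskiSum hlam hg)
  rw [hface]
  refine and_congr_right fun hx => ⟨fun h y hy => ?_, fun h => ?_⟩
  · exact (le_of_mem_minkowskiSum l hle hy).trans_eq h.symm
  · exact (le_of_mem_minkowskiSum l hle hx).antisymm (hmax.2 ▸ h _ hmax.1)

theorem isExposed_minkowskiSum_maximizers (hlam : ∀ i, 0 ≤ lam i) (u : E) :
    IsExposed ℝ (minkowskiSum t lam fun _ => Finset.univ) (minkowskiSum t lam (maximizers t u)) :=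
  fun _ => ⟨innerSL ℝ u, by ext x; simp [mem_minkowskiSum_maximizers hlam]⟩

theorem exists_eq_minkowskiSum_maximizers_of_isExposed [CompleteSpace E] (hlam : ∀ i, 0 ≤ lam i)
    {e : Set E} (he : IsExposed ℝ (minkowskiSum t lam fun _ => Finset.univ) e)
    (hne : e.Nonempty) : ∃ u, e = minkowskiSum t lam (maximizers t u) := by
  obtain ⟨l, rfl⟩ := he hne
  refine ⟨(InnerProductSpace.toDual ℝ E).symm l, ?_⟩
  ext x
  simp [mem_minkowskiSum_maximizers hlam]

theorem maximizers_subset_of_minkowskiSum_subset (hlam : ∀ i, 0 < lam i) {u v : E}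
    (h : minkowskiSum t lam (maximizers t u) ⊆ minkowskiSum t lam (maximizers t v)) (i : ι) :
    maximizers t u i ⊆ maximizers t v i := by
  classical
  intro a ha
  choose g hg using maximizers_nonempty t u
  choose g' hg' using maximizers_nonempty t v
  have hmem : ∀ j, Function.update g i a j ∈ maximizers t u j := fun j => by
    obtain rfl | hj := eq_or_ne j i
    · simpa using ha
    · simpa [Function.update_of_ne hj] using hg j
  have hlam' : ∀ i, 0 ≤ lam i := fun i => (hlam i).le
  have hge := ((mem_minkowskiSum_maximizers hlam').1 (h (sum_smul_mem_minkowskiSum hlam' hmem))).2 _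
    (sum_smul_mem_minkowskiSum hlam' fun j => Finset.mem_univ (g' j))
  simp only [inner_sum, real_inner_smul_right] at hge
  have hle : ∀ j ∈ Finset.univ, lam j * inner ℝ v (t j (Function.update g i a j)) ≤
      lam j * inner ℝ v (t j (g' j)) := fun j _ =>
    mul_le_mul_of_nonneg_left (mem_argmax.1 (hg' j) _) (hlam' j)
  have heq := (Finset.sum_eq_sum_iff_of_le hle).1 ((Finset.sum_le_sum hle).antisymm hge) i
    (Finset.mem_univ _)
  rw [Function.update_self, mul_right_inj' (hlam i).ne'] at heq
  exact mem_argmax_of_eq (hg' i) heq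

end MaximalFace

/-! ### Dihedral angles -/

section Wedge

open InnerProductGeometry

variable {V : Type*} [NormedAddCommGroup V] [InnerProductSpace ℝ V] {u v x z w : V}

theorem angle_smul_add_smul_le {a b a' b' : ℝ} (ha : 0 ≤ a) (hb : 0 ≤ b) (ha' : 0 ≤ a')
    (hb' : 0 ≤ b') (h0 : a • x + b • z ≠ 0) (h0' : a' • x + b' • z ≠ 0) :
    angle (a • x + b • z) (a' • x + b' • z) ≤ angle x z := by
  wlog h : a' * b ≤ a * b' generalizing a b a' b'
  · rw [angle_comm]
    exact this ha' hb' ha hb h0' h0 (by linarith)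
  have mem_cone : ∀ {y y' : V} {r s : ℝ}, 0 ≤ r → 0 ≤ s →
      r • y + s • y' ∈ Submodule.span NNReal {y, y'} := fun {y y' r s} hr hs =>
    Submodule.mem_span_pair.2 ⟨⟨r, hr⟩, ⟨s, hs⟩, rfl⟩
  have first_between := angle_eq_angle_add_add_angle_add_of_mem_span h0 (mem_cone ha hb)
  have second_between : angle (a • x + b • z) z =
      angle (a • x + b • z) (a' • x + b' • z) + angle (a' • x + b' • z) z := by
    refine angle_eq_angle_add_add_angle_add_of_mem_span h0' ?_
    rcases ha.eq_or_lt with rfl | hapos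
    · have hb0 : 0 < b := hb.lt_of_ne' fun hb0 => by simp [hb0] at h0
      have ha0 : a' = 0 := by nlinarith
      rw [show a' • x + b' • z = (0 : ℝ) • ((0 : ℝ) • x + b • z) + b' • z by simp [ha0]]
      exact mem_cone le_rfl hb'
    · rw [show a' • x + b' • z =
          (a' / a) • (a • x + b • z) + ((a * b' - a' * b) / a) • z by
        match_scalars <;> field_simp; ring]
      exact mem_cone (by positivity) (div_nonneg (by linarith) ha)
  linarith [angle_nonneg x (a • x + b • z), angle_nonneg (a' • x + b' • z) z]

/-- The Gram determinant of two vectors. -/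
noncomputable def gramDet (u v : V) : ℝ := inner ℝ u u * inner ℝ v v - inner ℝ u v ^ 2

theorem gramDet_comm (u v : V) : gramDet v u = gramDet u v := by
  simp only [gramDet, real_inner_comm u v]
  ring

/-- The side perpendicular to `u` of the planar wedge `{w | ⟪u, w⟫ ≤ 0 ∧ ⟪v, w⟫ ≤ 0}` with outer
normals `u` and `v`, scaled so as to be polynomial in `u` and `v`. -/
noncomputable def wedgeSide (u v : V) : V := (inner ℝ u v : ℝ) • u - (inner ℝ u u : ℝ) • v

theorem inner_left_wedgeSide (u v : V) : inner ℝ u (wedgeSide u v) = 0 := by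
  simp only [wedgeSide, inner_sub_right, real_inner_smul_right]
  ring

theorem inner_right_wedgeSide (u v : V) : inner ℝ v (wedgeSide u v) = -gramDet u v := by
  simp only [wedgeSide, gramDet, inner_sub_right, real_inner_smul_right, real_inner_comm u v]
  ring

theorem inner_wedgeSide_self (u v : V) :
    inner ℝ (wedgeSide u v) (wedgeSide u v) = inner ℝ u u * gramDet u v := by
  nth_rw 1 [wedgeSide]
  rw [inner_sub_left, real_inner_smul_left, real_inner_smul_left, inner_left_wedgeSide,
    inner_right_wedgeSide]
  ring

theorem gramDet_pos (h : LinearIndependent ℝ ![u, v]) : 0 < gramDet u v := by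
  have hu : 0 < inner ℝ u u := real_inner_self_pos.2 (h.ne_zero 0)
  have hside : wedgeSide u v ≠ 0 := fun h0 => hu.ne' <| neg_eq_zero.1
    (LinearIndependent.pair_iff.1 h (inner ℝ u v) (-inner ℝ u u)
      (by rw [neg_smul, ← sub_eq_add_neg]; exact h0)).2
  have hself := real_inner_self_pos.2 hside
  rw [inner_wedgeSide_self] at hself
  exact pos_of_mul_pos_right hself hu.le

theorem norm_wedgeSide (u v : V) : ‖wedgeSide u v‖ = ‖u‖ * √(gramDet u v) := by
  rw [norm_eq_sqrt_real_inner, inner_wedgeSide_self, real_inner_self_eq_norm_sq,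
    Real.sqrt_mul (sq_nonneg _), Real.sqrt_sq (norm_nonneg u)]

theorem angle_wedgeSide (h : LinearIndependent ℝ ![u, v]) :
    angle (wedgeSide u v) (wedgeSide v u) = Real.pi - angle u v := by
  have hpos := gramDet_pos h
  have hinner : inner ℝ (wedgeSide u v) (wedgeSide v u) = -(inner ℝ u v * gramDet u v) := by
    rw [wedgeSide, inner_sub_left, real_inner_smul_left, real_inner_smul_left,
      inner_left_wedgeSide, inner_right_wedgeSide, gramDet_comm]
    ring
  rw [angle, angle, ← Real.arccos_neg, hinner, norm_wedgeSide, norm_wedgeSide, gramDet_comm u v,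
    mul_mul_mul_comm, Real.mul_self_sqrt hpos.le, neg_div, mul_div_mul_right _ _ hpos.ne']

theorem eq_smul_wedgeSide_add (h : LinearIndependent ℝ ![u, v])
    (hw : w ∈ Submodule.span ℝ {u, v}) :
    w = (-inner ℝ v w / gramDet u v) • wedgeSide u v +
      (-inner ℝ u w / gramDet u v) • wedgeSide v u := by
  obtain ⟨a, b, rfl⟩ := Submodule.mem_span_pair.1 hw
  have hne := (gramDet_pos h).ne'
  simp only [wedgeSide, inner_add_right, real_inner_smul_right, real_inner_comm u v]
  match_scalars <;> field_simp <;> simp only [gramDet] <;> ring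

theorem angle_le_of_mem_wedge (h : LinearIndependent ℝ ![u, v])
    (hx : x ∈ Submodule.span ℝ {u, v}) (hz : z ∈ Submodule.span ℝ {u, v}) (hx0 : x ≠ 0)
    (hz0 : z ≠ 0) (hux : inner ℝ u x ≤ 0) (hvx : inner ℝ v x ≤ 0) (huz : inner ℝ u z ≤ 0)
    (hvz : inner ℝ v z ≤ 0) : angle x z ≤ Real.pi - angle u v := by
  have hpos := gramDet_pos h
  have hx' := eq_smul_wedgeSide_add h hx
  have hz' := eq_smul_wedgeSide_add h hz
  rw [← angle_wedgeSide h, hx', hz']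
  refine angle_smul_add_smul_le ?_ ?_ ?_ ?_ (hx' ▸ hx0) (hz' ▸ hz0) <;>
    exact div_nonneg (by linarith) hpos.le

end Wedge

section DihedralAngle

open InnerProductGeometry

theorem exists_midpoint_add_smul_mem {E : Type*} [AddCommGroup E] [Module ℝ E] {P : Set E}
    {a b x : E} (hP : Convex ℝ P) (ha : a ∈ P) (hb : b ∈ P) (hx : x ∈ P) (k : ℝ) :
    ∃ s : ℝ, 0 < s ∧ midpoint ℝ a b + s • (x - midpoint ℝ a b - k • (b - a)) ∈ P := by
  have hpos : 0 < 1 + 2 * |k| := by positivity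
  have habs : 0 ≤ |k| + k := by linarith [neg_abs_le k]
  refine ⟨1 / (1 + 2 * |k|), by positivity, ?_⟩
  have hmem := hP.sum_mem (t := Finset.univ) (z := ![x, a, b])
    (w := ![1 / (1 + 2 * |k|), (|k| + k) / (1 + 2 * |k|), (|k| - k) / (1 + 2 * |k|)])
    (by simp [Fin.forall_fin_succ, div_nonneg, hpos.le, habs, le_abs_self])
    (by simp [Fin.sum_univ_three]; field_simp; ring)
    (by simp [Fin.forall_fin_succ, ha, hb, hx])
  convert hmem using 1
  simp only [Fin.sum_univ_three, Matrix.cons_val_zero, Matrix.cons_val_one, Matrix.cons_val_two,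
    Matrix.head_cons, Matrix.tail_cons, midpoint_eq_smul_add, invOf_eq_inv]
  match_scalars <;> field_simp <;> ring

theorem span_pair_eq_orthogonal {u v d : EuclideanSpace ℝ (Fin 3)} (hd : d ≠ 0)
    (h : LinearIndependent ℝ ![u, v]) (hud : inner ℝ u d = 0) (hvd : inner ℝ v d = 0) :
    Submodule.span ℝ {u, v} = (Submodule.span ℝ {d})ᗮ := by
  have : Fact (Module.finrank ℝ (EuclideanSpace ℝ (Fin 3)) = 2 + 1) := ⟨by simp⟩
  refine Submodule.eq_of_le_of_finrank_eq ?_ ?_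
  · rw [Submodule.span_le]
    rintro w (rfl | rfl) <;> rw [SetLike.mem_coe, Submodule.mem_orthogonal_singleton_iff_inner_left]
    exacts [hud, hvd]
  · rw [Submodule.finrank_orthogonal_span_singleton (n := 2) hd]
    rw [← Matrix.range_cons_cons_empty u v ![], finrank_span_eq_card h, Fintype.card_fin]

/-- Points `a`, `b` of `P` at which the two functionals `⟪u, ·⟫` and `⟪v, ·⟫` are largest, together
with points `x` and `z` at which just the first, respectively just the second, is largest. For a
polytope this says that `u` and `v` are outer normals of the two facets at the edge `a b`. -/
structure IsWedgeAt (P : Set (EuclideanSpace ℝ (Fin 3))) (u v a b x z : EuclideanSpace ℝ (Fin 3)) :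
    Prop where
  mem_left : a ∈ P
  mem_right : b ∈ P
  mem_first : x ∈ P
  mem_second : z ∈ P
  le_first : ∀ y ∈ P, inner ℝ u y ≤ inner ℝ u a
  le_second : ∀ y ∈ P, inner ℝ v y ≤ inner ℝ v a
  inner_first_right : inner ℝ u b = inner ℝ u a
  inner_second_right : inner ℝ v b = inner ℝ v a
  inner_first : inner ℝ u x = inner ℝ u a
  inner_second : inner ℝ v z = inner ℝ v a
  inner_first_lt : inner ℝ u z < inner ℝ u a
  inner_second_lt : inner ℝ v x < inner ℝ v a

namespace IsWedgeAt

variable {P : Set (EuclideanSpace ℝ (Fin 3))} {u v a b x z : EuclideanSpace ℝ (Fin 3)}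

theorem symm (h : IsWedgeAt P u v a b x z) : IsWedgeAt P v u a b z x :=
  ⟨h.mem_left, h.mem_right, h.mem_second, h.mem_first, h.le_second, h.le_first,
    h.inner_second_right, h.inner_first_right, h.inner_second, h.inner_first, h.inner_second_lt,
    h.inner_first_lt⟩

theorem linearIndependent (h : IsWedgeAt P u v a b x z) : LinearIndependent ℝ ![u, v] := by
  refine LinearIndependent.pair_iff.2 fun r s hrs => ?_
  have key : ∀ w, r * inner ℝ u w + s * inner ℝ v w = 0 := fun w => by
    rw [← real_inner_smul_left, ← real_inner_smul_left, ← inner_add_left, hrs, inner_zero_left]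
  have hs : s * (inner ℝ v x - inner ℝ v a) = 0 := by
    have := key x
    rw [h.inner_first] at this
    linarith [key a]
  have hr : r * (inner ℝ u z - inner ℝ u a) = 0 := by
    have := key z
    rw [h.inner_second] at this
    linarith [key a]
  exact ⟨(mul_eq_zero.1 hr).resolve_right (sub_neg.2 h.inner_first_lt).ne,
    (mul_eq_zero.1 hs).resolve_right (sub_neg.2 h.inner_second_lt).ne⟩

theorem inner_first_eq (h : IsWedgeAt P u v a b x z) {p : EuclideanSpace ℝ (Fin 3)}
    (hp : p ∈ segment ℝ a b) : inner ℝ u p = inner ℝ u a := by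
  obtain ⟨r, s, -, -, hrs, rfl⟩ := hp
  rw [inner_add_right, real_inner_smul_right, real_inner_smul_right, h.inner_first_right,
    ← add_mul, hrs, one_mul]

theorem span_eq (h : IsWedgeAt P u v a b x z) (hab : a ≠ b) :
    Submodule.span ℝ {u, v} = (vectorSpan ℝ (segment ℝ a b))ᗮ := by
  rw [vectorSpan_segment, vsub_eq_sub]
  refine span_pair_eq_orthogonal (sub_ne_zero.2 hab.symm) h.linearIndependent ?_ ?_
  · rw [inner_sub_right, h.inner_first_right, sub_self]
  · rw [inner_sub_right, h.inner_second_right, sub_self]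

theorem exists_sub_midpoint_eq_smul_wedgeSide (h : IsWedgeAt P u v a b x z) (hP : Convex ℝ P)
    (hab : a ≠ b) :
    ∃ y ∈ P, ∃ r : ℝ, 0 < r ∧ y - midpoint ℝ a b = r • wedgeSide u v := by
  set m := midpoint ℝ a b with hm
  set d := b - a with hd
  set k := inner ℝ d (x - m) / inner ℝ d d with hk
  have hdd : inner ℝ d d ≠ 0 := inner_self_ne_zero.2 (sub_ne_zero.2 hab.symm)
  have hmem : x - m - k • d ∈ Submodule.span ℝ {u, v} := by
    rw [h.span_eq hab, vectorSpan_segment, vsub_eq_sub,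
      Submodule.mem_orthogonal_singleton_iff_inner_right, inner_sub_right, real_inner_smul_right,
      hk, div_mul_cancel₀ _ hdd, sub_self]
  have hum := h.inner_first_eq (midpoint_mem_segment a b)
  have hvm := h.symm.inner_first_eq (midpoint_mem_segment a b)
  have hu : inner ℝ u (x - m - k • d) = 0 := by
    simp only [hd, inner_sub_right, real_inner_smul_right, h.inner_first, hum, hm,
      h.inner_first_right, sub_self, mul_zero]
  have hv : inner ℝ v (x - m - k • d) = inner ℝ v x - inner ℝ v a := by
    simp only [hd, inner_sub_right, real_inner_smul_right, hvm, hm, h.inner_second_right, sub_self,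
      mul_zero, sub_zero]
  obtain ⟨s, hs, hy⟩ := exists_midpoint_add_smul_mem hP h.mem_left h.mem_right h.mem_first k
  refine ⟨_, hy, s * ((inner ℝ v a - inner ℝ v x) / gramDet u v), ?_, ?_⟩
  · exact mul_pos hs (div_pos (sub_pos.2 h.inner_second_lt) (gramDet_pos h.linearIndependent))
  · rw [add_sub_cancel_left, ← hm, eq_smul_wedgeSide_add h.linearIndependent hmem, hu, hv, neg_sub,
      neg_zero, zero_div, zero_smul, add_zero, smul_smul]

theorem wedgeSide_ne_zero (h : IsWedgeAt P u v a b x z) : wedgeSide u v ≠ 0 := fun h0 => by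
  have := inner_right_wedgeSide u v
  rw [h0, inner_zero_right] at this
  linarith [gramDet_pos h.linearIndependent]

theorem dihedralAngle_segment (h : IsWedgeAt P u v a b x z) (hP : Convex ℝ P) (hab : a ≠ b) :
    dihedralAngle P (segment ℝ a b) = Real.pi - angle u v := by
  rw [dihedralAngle, ← h.span_eq hab]
  refine IsGreatest.csSup_eq ⟨?_, ?_⟩
  · obtain ⟨y, hyP, r, hr, hy⟩ := h.exists_sub_midpoint_eq_smul_wedgeSide hP hab
    obtain ⟨y', hyP', r', hr', hy'⟩ := h.symm.exists_sub_midpoint_eq_smul_wedgeSide hP hab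
    have hside : wedgeSide u v ∈ Submodule.span ℝ {u, v} :=
      sub_mem (Submodule.smul_mem _ _ (Submodule.mem_span_of_mem (by simp)))
        (Submodule.smul_mem _ _ (Submodule.mem_span_of_mem (by simp)))
    have hside' : wedgeSide v u ∈ Submodule.span ℝ {u, v} :=
      sub_mem (Submodule.smul_mem _ _ (Submodule.mem_span_of_mem (by simp)))
        (Submodule.smul_mem _ _ (Submodule.mem_span_of_mem (by simp)))
    refine ⟨midpoint ℝ a b, midpoint_mem_segment a b, y, hyP, y', hyP', ?_, ?_, ?_, ?_, ?_⟩
    · rw [← sub_ne_zero, hy]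
      exact smul_ne_zero hr.ne' h.wedgeSide_ne_zero
    · rw [← sub_ne_zero, hy']
      exact smul_ne_zero hr'.ne' h.symm.wedgeSide_ne_zero
    · exact hy ▸ Submodule.smul_mem _ _ hside
    · exact hy' ▸ Submodule.smul_mem _ _ hside'
    · rw [EuclideanGeometry.angle, vsub_eq_sub, vsub_eq_sub, hy, hy', angle_smul_left_of_pos _ _ hr,
        angle_smul_right_of_pos _ _ hr', angle_wedgeSide h.linearIndependent]
  · rintro θ ⟨p, hp, y, hy, y', hy', hyp, hyp', hmem, hmem', rfl⟩
    have hu : ∀ q ∈ P, inner ℝ u (q - p) ≤ 0 := fun q hq => by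
      rw [inner_sub_right, h.inner_first_eq hp, sub_nonpos]
      exact h.le_first q hq
    have hv : ∀ q ∈ P, inner ℝ v (q - p) ≤ 0 := fun q hq => by
      rw [inner_sub_right, h.symm.inner_first_eq hp, sub_nonpos]
      exact h.le_second q hq
    exact angle_le_of_mem_wedge h.linearIndependent hmem hmem' (sub_ne_zero.2 hyp)
      (sub_ne_zero.2 hyp') (hu y hy) (hv y hy) (hu y' hy') (hv y' hy')

end IsWedgeAt

end DihedralAngle

/-! ### Arcs of normals -/

section OpenCone

open InnerProductGeometry

variable {α V : Type*} [NormedAddCommGroup V] [InnerProductSpace ℝ V] {u v w x y z : V}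

/-- The positive combinations of two vectors. -/
def openCone (x z : V) : Set V := {w | ∃ p q : ℝ, 0 < p ∧ 0 < q ∧ p • x + q • z = w}

theorem mem_openCone_trichotomy (hy : y ∈ openCone x z) (hw : w ∈ openCone x z) :
    w ∈ openCone x y ∨ (∃ r : ℝ, 0 < r ∧ r • y = w) ∨ w ∈ openCone y z := by
  obtain ⟨a, b, ha, hb, rfl⟩ := hy
  obtain ⟨p, q, hp, hq, rfl⟩ := hw
  rcases lt_trichotomy (q * a) (p * b) with h | h | h
  · refine Or.inl ⟨(p * b - q * a) / b, q / b, div_pos (sub_pos.2 h) hb, div_pos hq hb, ?_⟩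
    match_scalars <;> field_simp
    ring
  · refine Or.inr (Or.inl ⟨q / b, div_pos hq hb, ?_⟩)
    match_scalars <;> field_simp
    linarith
  · refine Or.inr (Or.inr ⟨p / a, (q * a - p * b) / a, div_pos hp ha, div_pos (sub_pos.2 h) ha, ?_⟩)
    match_scalars <;> field_simp
    ring

theorem angle_eq_add_of_mem_openCone (hy0 : y ≠ 0) (hy : y ∈ openCone x z) :
    angle x z = angle x y + angle y z := by
  obtain ⟨p, q, hp, hq, rfl⟩ := hy
  exact angle_eq_angle_add_add_angle_add_of_mem_span hy0
    (Submodule.mem_span_pair.2 ⟨⟨p, hp.le⟩, ⟨q, hq.le⟩, rfl⟩)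

theorem mem_openCone_of_inner {d e e' : V}
    (hzero : ∀ w : V, inner ℝ d w = 0 → inner ℝ e w = 0 → inner ℝ e' w = 0 → w = 0)
    (hdu : inner ℝ d u = 0) (heu : inner ℝ e u = 0) (heu' : inner ℝ e' u < 0)
    (hdv : inner ℝ d v = 0) (hev : inner ℝ e v < 0) (hev' : inner ℝ e' v = 0)
    (hdw : inner ℝ d w = 0) (hew : inner ℝ e w < 0) (hew' : inner ℝ e' w < 0) :
    w ∈ openCone u v := by
  refine ⟨_, _, div_pos_of_neg_of_neg hew' heu', div_pos_of_neg_of_neg hew hev,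
    sub_eq_zero.1 (hzero _ ?_ ?_ ?_)⟩ <;>
    simp only [inner_sub_right, inner_add_right, real_inner_smul_right, hdu, heu, hdv, hev', hdw,
      div_mul_cancel₀ _ hev.ne, div_mul_cancel₀ _ heu'.ne] <;> ring

/-- The consecutive pairs of the list `x :: ys ++ [z]`. -/
def arcs (x : α) (ys : List α) (z : α) : List (α × α) := (x :: ys).zip (ys ++ [z])

theorem arcs_cons (x y : α) (ys : List α) (z : α) : arcs x (y :: ys) z = (x, y) :: arcs y ys z :=
  rfl

theorem exists_arc_of_mem_openCone {g : α → V} {a c : α} {bs : List α}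
    (h : (a :: bs).IsChain fun a b => g b ∈ openCone (g a) (g c)) (hw : w ∈ openCone (g a) (g c)) :
    (∃ p ∈ arcs a bs c, w ∈ openCone (g p.1) (g p.2)) ∨
      ∃ b ∈ bs, ∃ r : ℝ, 0 < r ∧ r • g b = w := by
  induction bs generalizing a with
  | nil => exact Or.inl ⟨(a, c), List.mem_singleton_self _, hw⟩
  | cons b bs ih =>
    rw [List.isChain_cons_cons] at h
    rw [arcs_cons]
    rcases mem_openCone_trichotomy h.1 hw with hw | hw | hw
    · exact Or.inl ⟨(a, b), List.mem_cons_self, hw⟩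
    · exact Or.inr ⟨b, List.mem_cons_self, hw⟩
    · rcases ih h.2 hw with ⟨p, hp, hw⟩ | ⟨b', hb', hw⟩
      · exact Or.inl ⟨p, List.mem_cons_of_mem _ hp, hw⟩
      · exact Or.inr ⟨b', List.mem_cons_of_mem _ hb', hw⟩

theorem map_angle_eq_sum_arcs {f : ℝ → ℝ} (hf : ∀ r s, f (r + s) = f r + f s) {g : α → V}
    {a c : α} {bs : List α} (h : (a :: bs).IsChain fun a b => g b ∈ openCone (g a) (g c))
    (h0 : ∀ b ∈ bs, g b ≠ 0) :
    f (angle (g a) (g c)) = ((arcs a bs c).map fun p => f (angle (g p.1) (g p.2))).sum := by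
  induction bs generalizing a with
  | nil => simp [arcs]
  | cons b bs ih =>
    rw [List.isChain_cons_cons] at h
    rw [arcs_cons, List.map_cons, List.sum_cons,
      ← ih h.2 fun b hb => h0 b (List.mem_cons_of_mem _ hb), ← hf,
      angle_eq_add_of_mem_openCone (h0 b List.mem_cons_self) h.1]

end OpenCone

section GramDet

variable {V : Type*} [NormedAddCommGroup V] [InnerProductSpace ℝ V] {x y : V}

theorem gramDet_eq_zero_of_finrank_eq_one {W : Submodule ℝ V} (hW : Module.finrank ℝ W = 1)
    (hx : x ∈ W) (hy : y ∈ W) : gramDet x y = 0 := by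
  obtain ⟨v, -, hv⟩ := finrank_eq_one_iff'.1 hW
  obtain ⟨r, hr⟩ := hv ⟨x, hx⟩
  obtain ⟨s, hs⟩ := hv ⟨y, hy⟩
  have hx : x = r • (v : V) := congrArg Subtype.val hr.symm
  have hy : y = s • (v : V) := congrArg Subtype.val hs.symm
  simp only [gramDet, hx, hy, real_inner_smul_left, real_inner_smul_right]
  ring

theorem eq_smul_of_gramDet_eq_zero (hx : x ≠ 0) (h : gramDet x y = 0) :
    y = ((inner ℝ x y : ℝ) / inner ℝ x x) • x := by
  have hside : wedgeSide x y = 0 := by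
    rw [← inner_self_eq_zero (𝕜 := ℝ), inner_wedgeSide_self, h, mul_zero]
  have hxx : (inner ℝ x x : ℝ) ≠ 0 := inner_self_ne_zero.2 hx
  rw [wedgeSide, sub_eq_zero] at hside
  rw [div_eq_inv_mul, mul_smul, hside, inv_smul_smul₀ hxx]

end GramDet

section IntegerVectors

open Matrix

variable {d : ℕ}

/-- The inclusion of `ℤ^d` into Euclidean space. -/
noncomputable def intPoint : (Fin d → ℤ) →+ EuclideanSpace ℝ (Fin d) where
  toFun z := WithLp.toLp 2 fun j => (z j : ℝ)
  map_zero' := by ext; simp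
  map_add' _ _ := by ext; simp

@[simp]
theorem intPoint_apply (z : Fin d → ℤ) (j : Fin d) : intPoint z j = z j := rfl

theorem intPoint_injective : Function.Injective (intPoint (d := d)) := fun _ _ h =>
  funext fun j => Int.cast_injective (α := ℝ) (congrArg (fun x => x.ofLp j) h)

theorem inner_intPoint_left (z : Fin d → ℤ) (x : EuclideanSpace ℝ (Fin d)) :
    inner ℝ (intPoint z) x = ∑ j, (z j : ℝ) * x j := by
  simp [PiLp.inner_apply, mul_comm]

theorem inner_intPoint (z w : Fin d → ℤ) :
    inner ℝ (intPoint z) (intPoint w) = ((z ⬝ᵥ w : ℤ) : ℝ) := by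
  simp [inner_intPoint_left, dotProduct]

theorem eq_zero_of_inner_intPoint_eq_zero {n : Fin d → Fin d → ℤ} (h : det (of n) ≠ 0)
    {x : EuclideanSpace ℝ (Fin d)} (hx : ∀ i, inner ℝ (intPoint (n i)) x = 0) : x = 0 := by
  have hdet : det ((of n).map (Int.cast : ℤ → ℝ)) ≠ 0 := by
    have := (Int.castRingHom ℝ).map_det (of n)
    rw [RingHom.mapMatrix_apply, Int.coe_castRingHom] at this
    rw [← this]
    exact Int.cast_ne_zero.2 h
  have := eq_zero_of_mulVec_eq_zero hdet (v := x.ofLp) <| funext fun i =>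
    (inner_intPoint_left (n i) x).symm.trans (hx i)
  exact WithLp.ofLp_injective 2 this

/-- The coefficient of `x` in the expansion of `y` in terms of `x` and `z`, up to the factor
`gramCoeff x z x` common to both coefficients, by Cramer's rule. -/
def gramCoeff (x z y : Fin d → ℤ) : ℤ := y ⬝ᵥ x * z ⬝ᵥ z - y ⬝ᵥ z * x ⬝ᵥ z

theorem gramDet_intPoint (x y : Fin d → ℤ) :
    gramDet (intPoint x) (intPoint y) = gramCoeff x y x := by
  simp only [gramDet, gramCoeff, inner_intPoint]
  push_cast
  ring

/-- A decidable certificate for `intPoint y ∈ openCone (intPoint x) (intPoint z)`. -/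
structure IsBetween (x y z : Fin d → ℤ) : Prop where
  gramCoeff_pos : 0 < gramCoeff x z x
  gramCoeff_left_pos : 0 < gramCoeff x z y
  gramCoeff_right_pos : 0 < gramCoeff z x y
  smul_eq : gramCoeff x z x • y = gramCoeff x z y • x + gramCoeff z x y • z

instance (x y z : Fin d → ℤ) : Decidable (IsBetween x y z) :=
  decidable_of_iff
    (0 < gramCoeff x z x ∧ 0 < gramCoeff x z y ∧ 0 < gramCoeff z x y ∧
      gramCoeff x z x • y = gramCoeff x z y • x + gramCoeff z x y • z)
    ⟨fun ⟨h₁, h₂, h₃, h₄⟩ => ⟨h₁, h₂, h₃, h₄⟩, fun ⟨h₁, h₂, h₃, h₄⟩ => ⟨h₁, h₂, h₃, h₄⟩⟩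

theorem IsBetween.mem_openCone {x y z : Fin d → ℤ} (h : IsBetween x y z) :
    intPoint y ∈ openCone (intPoint x) (intPoint z) := by
  have hpos : (0 : ℝ) < gramCoeff x z x := Int.cast_pos.2 h.gramCoeff_pos
  refine ⟨_, _, div_pos (Int.cast_pos.2 h.gramCoeff_left_pos) hpos,
    div_pos (Int.cast_pos.2 h.gramCoeff_right_pos) hpos, ?_⟩
  rw [div_eq_inv_mul, div_eq_inv_mul, mul_smul, mul_smul, ← smul_add, inv_smul_eq_iff₀ hpos.ne',
    Int.cast_smul_eq_zsmul, Int.cast_smul_eq_zsmul, Int.cast_smul_eq_zsmul, ← map_zsmul,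
    ← map_zsmul, ← map_add, ← h.smul_eq, map_zsmul]

theorem norm_intPoint (z : Fin d → ℤ) : ‖intPoint z‖ = √((z ⬝ᵥ z : ℤ) : ℝ) := by
  rw [norm_eq_sqrt_real_inner, inner_intPoint]

theorem pi_sub_angle_intPoint {u v : Fin d → ℤ} (h : u ⬝ᵥ v ≤ 0) :
    Real.pi - InnerProductGeometry.angle (intPoint u) (intPoint v) =
      Real.arccos √((u ⬝ᵥ v : ℤ) ^ 2 / ((u ⬝ᵥ u : ℤ) * (v ⬝ᵥ v : ℤ))) := by
  have hroot : √(((u ⬝ᵥ v : ℤ) : ℝ) ^ 2) = -(u ⬝ᵥ v : ℤ) := by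
    rw [Real.sqrt_sq_eq_abs, abs_of_nonpos (Int.cast_nonpos.2 h)]
  have hself : 0 ≤ u ⬝ᵥ u := Finset.sum_nonneg fun i _ => mul_self_nonneg (u i)
  rw [InnerProductGeometry.angle, ← Real.arccos_neg, inner_intPoint, norm_intPoint, norm_intPoint,
    Real.sqrt_div (sq_nonneg _), hroot,
    Real.sqrt_mul (Int.cast_nonneg hself), neg_div]

end IntegerVectors

section EdgeArc

variable {ι α : Type*} [Fintype α] [DecidableEq α]
  {t : ι → α → EuclideanSpace ℝ (Fin 3)} {lam : ι → ℝ} {u v d : EuclideanSpace ℝ (Fin 3)}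
  {p q : ι → α} {ρ : ι → ℝ}

/-- `u` and `v` are outer normals of two neighbouring facets of the Minkowski sum of the polytopes
`lam i • conv (t i)`, which meet in an edge parallel to `d`. The `i`-th summand contributes to this
edge the segment from `t i (p i)` to `t i (q i)`. -/
structure IsEdgeArc (t : ι → α → EuclideanSpace ℝ (Fin 3)) (u v d : EuclideanSpace ℝ (Fin 3))
    (p q : ι → α) (ρ : ι → ℝ) : Prop where
  direction_ne_zero : d ≠ 0
  inter_eq : ∀ i, maximizers t u i ∩ maximizers t v i = {p i, q i}
  vertex_eq : ∀ i, t i (q i) = t i (p i) + ρ i • d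
  nonneg : ∀ i, 0 ≤ ρ i
  exists_pos : ∃ i, 0 < ρ i
  exists_first_notMem_second : ∃ i, ∃ a ∈ maximizers t u i, a ∉ maximizers t v i
  exists_second_notMem_first : ∃ i, ∃ a ∈ maximizers t v i, a ∉ maximizers t u i

namespace IsEdgeArc

theorem inter_nonempty (h : IsEdgeArc t u v d p q ρ) (i : ι) :
    (maximizers t u i ∩ maximizers t v i).Nonempty := by
  rw [h.inter_eq i]
  exact Finset.insert_nonempty _ _

variable [Fintype ι]

theorem minkowskiSum_eq_segment (h : IsEdgeArc t u v d p q ρ) (hlam : ∀ i, 0 < lam i) :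
    minkowskiSum t lam (fun i => maximizers t u i ∩ maximizers t v i) =
      segment ℝ (∑ i, lam i • t i (p i)) (∑ i, lam i • t i (q i)) :=
  _root_.minkowskiSum_eq_segment hlam h.nonneg (fun i a => by simp [h.inter_eq i]) h.vertex_eq

theorem right_sub_left (h : IsEdgeArc t u v d p q ρ) :
    ∑ i, lam i • t i (q i) - ∑ i, lam i • t i (p i) = (∑ i, lam i * ρ i) • d := by
  simp only [← Finset.sum_sub_distrib, ← smul_sub, h.vertex_eq, add_sub_cancel_left, smul_smul,
    Finset.sum_smul]

theorem sum_pos (h : IsEdgeArc t u v d p q ρ) (hlam : ∀ i, 0 < lam i) :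
    0 < ∑ i, lam i * ρ i := by
  obtain ⟨i, hi⟩ := h.exists_pos
  exact Finset.sum_pos' (fun j _ => mul_nonneg (hlam j).le (h.nonneg j))
    ⟨i, Finset.mem_univ i, mul_pos (hlam i) hi⟩

theorem left_ne_right (h : IsEdgeArc t u v d p q ρ) (hlam : ∀ i, 0 < lam i) :
    ∑ i, lam i • t i (p i) ≠ ∑ i, lam i • t i (q i) := by
  rw [ne_comm, ← sub_ne_zero, h.right_sub_left]
  exact smul_ne_zero (h.sum_pos hlam).ne' h.direction_ne_zero

theorem diam_minkowskiSum (h : IsEdgeArc t u v d p q ρ) (hlam : ∀ i, 0 < lam i) :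
    Metric.diam (minkowskiSum t lam fun i => maximizers t u i ∩ maximizers t v i) =
      ∑ i, lam i * ‖t i (q i) - t i (p i)‖ := by
  rw [h.minkowskiSum_eq_segment hlam, ← convexHull_pair, convexHull_diam, Metric.diam_pair,
    dist_eq_norm', h.right_sub_left, norm_smul, Real.norm_of_nonneg (h.sum_pos hlam).le,
    Finset.sum_mul]
  refine Finset.sum_congr rfl fun i _ => ?_
  rw [h.vertex_eq, add_sub_cancel_left, norm_smul, Real.norm_of_nonneg (h.nonneg i), mul_assoc]

variable [Nonempty α]

theorem mem_polytopeEdges (h : IsEdgeArc t u v d p q ρ) (hlam : ∀ i, 0 < lam i) :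
    minkowskiSum t lam (fun i => maximizers t u i ∩ maximizers t v i) ∈
      polytopeEdges (minkowskiSum t lam fun _ => Finset.univ) := by
  constructor
  · rw [← maximizers_add h.inter_nonempty]
    exact isExposed_minkowskiSum_maximizers (fun i => (hlam i).le) (u + v)
  · rw [h.minkowskiSum_eq_segment hlam, vectorSpan_segment]
    exact finrank_span_singleton (vsub_ne_zero.2 (h.left_ne_right hlam).symm)

theorem exists_isWedgeAt (h : IsEdgeArc t u v d p q ρ) (hlam : ∀ i, 0 < lam i) :
    ∃ x z, IsWedgeAt (minkowskiSum t lam fun _ => Finset.univ) u v (∑ i, lam i • t i (p i))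
      (∑ i, lam i • t i (q i)) x z := by
  have hlam' : ∀ i, 0 ≤ lam i := fun i => (hlam i).le
  have hmem : ∀ g : ι → α, (∀ i, g i ∈ maximizers t u i ∩ maximizers t v i) →
      ∑ i, lam i • t i (g i) ∈ minkowskiSum t lam (maximizers t u) ∧
        ∑ i, lam i • t i (g i) ∈ minkowskiSum t lam (maximizers t v) := fun g hg =>
    ⟨sum_smul_mem_minkowskiSum hlam' fun i => (Finset.mem_inter.1 (hg i)).1,
      sum_smul_mem_minkowskiSum hlam' fun i => (Finset.mem_inter.1 (hg i)).2⟩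
  obtain ⟨hpu, hpv⟩ := hmem p fun i => by simp [h.inter_eq i]
  obtain ⟨hqu, hqv⟩ := hmem q fun i => by simp [h.inter_eq i]
  obtain ⟨i, a, hau, hav⟩ := h.exists_first_notMem_second
  obtain ⟨x, hxu, hxv⟩ := Set.not_subset.1
    (mt (maximizers_subset_of_minkowskiSum_subset hlam · i) fun hsub => hav (hsub hau))
  obtain ⟨j, b, hbv, hbu⟩ := h.exists_second_notMem_first
  obtain ⟨z, hzv, hzu⟩ := Set.not_subset.1
    (mt (maximizers_subset_of_minkowskiSum_subset hlam · j) fun hsub => hbu (hsub hbv))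
  rw [mem_minkowskiSum_maximizers hlam'] at hpu hpv hqu hqv hxu hxv hzu hzv
  refine ⟨x, z, hpu.1, hqu.1, hxu.1, hzv.1, hpu.2, hpv.2, ?_, ?_, ?_, ?_, ?_, ?_⟩
  · exact le_antisymm (hpu.2 _ hqu.1) (hqu.2 _ hpu.1)
  · exact le_antisymm (hpv.2 _ hqu.1) (hqv.2 _ hpu.1)
  · exact le_antisymm (hpu.2 _ hxu.1) (hxu.2 _ hpu.1)
  · exact le_antisymm (hpv.2 _ hzv.1) (hzv.2 _ hpu.1)
  · exact not_le.1 fun hle => hzu ⟨hzv.1, fun y hy => (hpu.2 y hy).trans hle⟩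
  · exact not_le.1 fun hle => hxv ⟨hxu.1, fun y hy => (hpv.2 y hy).trans hle⟩

theorem dihedralAngle_minkowskiSum (h : IsEdgeArc t u v d p q ρ) (hlam : ∀ i, 0 < lam i) :
    dihedralAngle (minkowskiSum t lam fun _ => Finset.univ)
      (minkowskiSum t lam fun i => maximizers t u i ∩ maximizers t v i) =
        Real.pi - InnerProductGeometry.angle u v := by
  obtain ⟨x, z, hwedge⟩ := h.exists_isWedgeAt hlam
  rw [h.minkowskiSum_eq_segment hlam]
  exact hwedge.dihedralAngle_segment convex_minkowskiSum (h.left_ne_right hlam)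

end IsEdgeArc

end EdgeArc

section MaximizersInner

variable {ι α E : Type*} [Fintype α] [NormedAddCommGroup E] [InnerProductSpace ℝ E]
  {t : ι → α → E} {u : E} {i : ι} {a b : α}

theorem inner_sub_eq_zero_of_mem_maximizers (ha : a ∈ maximizers t u i)
    (hb : b ∈ maximizers t u i) : inner ℝ (t i b - t i a) u = 0 := by
  rw [real_inner_comm, inner_sub_right, sub_eq_zero]
  exact le_antisymm (mem_argmax.1 ha b) (mem_argmax.1 hb a)

theorem inner_sub_neg_of_notMem_maximizers (ha : a ∈ maximizers t u i)
    (hb : b ∉ maximizers t u i) : inner ℝ (t i b - t i a) u < 0 := by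
  rw [real_inner_comm, inner_sub_right, sub_neg]
  exact (mem_argmax.1 ha b).lt_of_ne fun h => hb (mem_argmax_of_eq ha h)

end MaximizersInner

/-! ### The edges of `P` -/

section PolytopeData

open Matrix

/-- The vertices of `T₁`, `T₂` and `T₃`. -/
def tetrahedronVertex : Fin 3 → Fin 4 → Fin 3 → ℤ :=
  ![![![0, 0, 0], ![1, 1, 0], ![1, 0, 1], ![0, 1, 1]],
    ![![0, 0, 0], ![2, 2, -1], ![2, -1, 2], ![1, -2, -2]],
    ![![0, 0, 0], ![2, 2, -1], ![3, 0, -3], ![5, -1, -1]]]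

/-- The vertices of `T₁`, `T₂` and `T₃` as points of Euclidean space. -/
noncomputable def tetrahedronPoint (i : Fin 3) (a : Fin 4) : EuclideanSpace ℝ (Fin 3) :=
  intPoint (tetrahedronVertex i a)

/-- The coefficients of `T₁`, `T₂` and `T₃` in `P`. -/
def dilation : Fin 3 → ℕ := ![5, 12, 19]

theorem dilation_pos (i : Fin 3) : (0 : ℝ) < dilation i := by
  fin_cases i <;> simp [dilation]

theorem convexHull_range_tetrahedronPoint (i : Fin 3) :
    convexHull ℝ (Set.range (tetrahedronPoint i)) =
      ![tetrahedronT₁, tetrahedronT₂, tetrahedronT₃] i := by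
  have hrange : Set.range (tetrahedronPoint i) = {tetrahedronPoint i 0, tetrahedronPoint i 1,
      tetrahedronPoint i 2, tetrahedronPoint i 3} := by
    ext x
    simp [Fin.exists_fin_succ, eq_comm]
  have hpoint : ∀ z : Fin 3 → ℤ, intPoint z = !₂[(z 0 : ℝ), (z 1 : ℝ), (z 2 : ℝ)] := fun z => by
    ext j
    fin_cases j <;> rfl
  rw [hrange]
  fin_cases i <;>
    simp [tetrahedronPoint, hpoint, tetrahedronVertex, tetrahedronT₁, tetrahedronT₂, tetrahedronT₃]

theorem polytopeP_eq_minkowskiSum :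
    polytopeP = minkowskiSum tetrahedronPoint (fun i => (dilation i : ℝ)) fun _ => Finset.univ := by
  rw [minkowskiSum_eq_sum dilation_pos]
  simp [convexHull_range_tetrahedronPoint, Fin.sum_univ_three, polytopeP, dilation]

/-- The indices of the vertices of the tetrahedra at which `n` is largest: the decidable form of
`maximizers`. -/
def intMaximizers (n : Fin 3 → ℤ) (i : Fin 3) : Finset (Fin 4) :=
  argmax fun a => n ⬝ᵥ tetrahedronVertex i a

theorem maximizers_intPoint (n : Fin 3 → ℤ) :
    maximizers tetrahedronPoint (intPoint n) = intMaximizers n := by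
  funext i
  simp only [maximizers, tetrahedronPoint, inner_intPoint]
  exact argmax_comp_of_strictMono Int.cast_strictMono fun a => n ⬝ᵥ tetrahedronVertex i a

/-- The indices of the vertices of the face on which both outer normals are largest. -/
def commonMaximizers (uv : (Fin 3 → ℤ) × (Fin 3 → ℤ)) (i : Fin 3) : Finset (Fin 4) :=
  intMaximizers uv.1 i ∩ intMaximizers uv.2 i

theorem commonMaximizers_eq (uv : (Fin 3 → ℤ) × (Fin 3 → ℤ)) :
    commonMaximizers uv = fun i => maximizers tetrahedronPoint (intPoint uv.1) i ∩
      maximizers tetrahedronPoint (intPoint uv.2) i := by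
  simp only [maximizers_intPoint]
  rfl

theorem gramCoeff_tetrahedronVertex_ne_zero : ∀ i a b c, [a, b, c].Nodup →
    gramCoeff (tetrahedronVertex i b - tetrahedronVertex i a)
      (tetrahedronVertex i c - tetrahedronVertex i a)
      (tetrahedronVertex i b - tetrahedronVertex i a) ≠ 0 := by
  decide +kernel

theorem det_tetrahedronVertex_ne_zero : ∀ i a b c d, [a, b, c, d].Nodup →
    det (of ![tetrahedronVertex i b - tetrahedronVertex i a,
      tetrahedronVertex i c - tetrahedronVertex i a,
      tetrahedronVertex i d - tetrahedronVertex i a]) ≠ 0 := by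
  decide +kernel

theorem tetrahedronVertex_injective : ∀ i, Function.Injective (tetrahedronVertex i) := by
  decide +kernel

/-- The ends of the edges of a tetrahedron, numbered in such a way that `k.rev` is the edge
opposite to `k`. -/
def edgeEnds : Fin 6 → Fin 4 × Fin 4 := ![(0, 1), (0, 2), (0, 3), (1, 2), (1, 3), (2, 3)]

/-- The edges of a tetrahedron as sets of vertex indices. -/
def edgePair (k : Fin 6) : Finset (Fin 4) := {(edgeEnds k).1, (edgeEnds k).2}

theorem card_edgePair : ∀ k, (edgePair k).card = 2 := by
  decide +kernel

theorem edgePair_injective : Function.Injective edgePair := by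
  decide +kernel

theorem exists_edgePair_eq : ∀ M : Finset (Fin 4), M.card = 2 → ∃ k, M = edgePair k := by
  decide +kernel

theorem edgeEnds_nodup : ∀ k, [(edgeEnds k).1, (edgeEnds k).2, (edgeEnds k.rev).1,
    (edgeEnds k.rev).2].Nodup := by
  decide +kernel

/-- The direction of the `k`-th edge of the `i`-th tetrahedron. -/
def edgeDirection (i : Fin 3) (k : Fin 6) : Fin 3 → ℤ :=
  tetrahedronVertex i (edgeEnds k).2 - tetrahedronVertex i (edgeEnds k).1

theorem edgeDirection_ne_zero (i : Fin 3) (k : Fin 6) : edgeDirection i k ≠ 0 :=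
  sub_ne_zero.2 <| (tetrahedronVertex_injective i).ne <| by revert k; decide +kernel

/-- `first` and `last` are outer normals of the two facets of a tetrahedron that meet in one of its
edges, and `mid` lists the outer facet normals of `P` between them, in the order of the arc. -/
structure NormalChain where
  first : Fin 3 → ℤ
  mid : List (Fin 3 → ℤ)
  last : Fin 3 → ℤ

/-- The chain of normals at the `k`-th edge of the `i`-th tetrahedron. -/
def normalChain : Fin 3 → Fin 6 → NormalChain :=
  ![![⟨![1, -1, -1], [![2, -2, -3], ![-1, 1, -3], ![-2, 2, -3]], ![-1, 1, -1]⟩,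
      ⟨![1, -1, -1], [![-1, -6, 1], ![-1, -3, 1]], ![-1, -1, 1]⟩,
      ⟨![-1, 1, -1], [![-3, 2, -2], ![-3, -2, 2]], ![-1, -1, 1]⟩,
      ⟨![1, -1, -1], [![5, -1, -1]], ![1, 1, 1]⟩,
      ⟨![-1, 1, -1], [], ![1, 1, 1]⟩,
      ⟨![-1, -1, 1], [![1, 1, 4]], ![1, 1, 1]⟩],
    ![⟨![-1, 2, 2], [![-3, 2, -2]], ![-2, 1, -2]⟩,
      ⟨![-1, 2, 2], [![-3, -2, 2]], ![-2, -2, 1]⟩,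
      ⟨![-2, 1, -2], [], ![-2, -2, 1]⟩,
      ⟨![-1, 2, 2], [![1, 1, 1]], ![5, -1, -1]⟩,
      ⟨![-2, 1, -2], [![-1, 1, -3], ![1, 0, -1]], ![5, -1, -1]⟩,
      ⟨![-2, -2, 1], [![-1, -3, 1], ![-1, -7, 2]], ![5, -1, -1]⟩],
    ![⟨![-2, 1, -2], [![-3, 2, -2], ![-1, 2, 2]], ![1, 1, 4]⟩,
      ⟨![-2, 1, -2], [], ![-1, -4, -1]⟩,
      ⟨![1, 1, 4], [![-1, -7, 2], ![-1, -6, 1]], ![-1, -4, -1]⟩,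
      ⟨![-2, 1, -2], [![-2, 2, -3]], ![2, 2, -1]⟩,
      ⟨![1, 1, 4], [![1, 1, 1]], ![2, 2, -1]⟩,
      ⟨![-1, -4, -1], [![2, -2, -3], ![1, 0, -1]], ![2, 2, -1]⟩]]

/-- The pairs of neighbouring normals between the two facets of the `i`-th tetrahedron that meet in
its `k`-th edge. They correspond to the edges of `P` to which this edge contributes. -/
def edgeArcs (i : Fin 3) (k : Fin 6) : List ((Fin 3 → ℤ) × (Fin 3 → ℤ)) :=
  arcs (normalChain i k).first (normalChain i k).mid (normalChain i k).last

theorem isChain_isBetween_normalChain : ∀ i k,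
    ((normalChain i k).first :: (normalChain i k).mid).IsChain fun x y =>
      IsBetween x y (normalChain i k).last := by
  decide +kernel

theorem intMaximizers_first : ∀ i k, intMaximizers (normalChain i k).first i =
    {(edgeEnds k).1, (edgeEnds k).2, (edgeEnds k.rev).1} := by
  decide +kernel

theorem intMaximizers_last : ∀ i k, intMaximizers (normalChain i k).last i =
    {(edgeEnds k).1, (edgeEnds k).2, (edgeEnds k.rev).2} := by
  decide +kernel

theorem ne_zero_of_mem_mid : ∀ i k, ∀ y ∈ (normalChain i k).mid, y ≠ 0 := by
  decide +kernel

theorem exists_gramCoeff_ne_zero_of_mem_mid : ∀ i k, ∀ y ∈ (normalChain i k).mid,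
    ∃ j, ∃ p ∈ intMaximizers y j, ∃ q ∈ intMaximizers y j,
      gramCoeff (edgeDirection i k) (tetrahedronVertex j q - tetrahedronVertex j p)
        (edgeDirection i k) ≠ 0 := by
  decide +kernel

theorem commonMaximizers_eq_edgePair : ∀ i k, ∀ uv ∈ edgeArcs i k,
    commonMaximizers uv i = edgePair k := by
  decide +kernel

theorem exists_commonMaximizers_eq_pair : ∀ i k, ∀ uv ∈ edgeArcs i k, ∀ j, ∃ p q,
    commonMaximizers uv j = {p, q} ∧
      gramCoeff (edgeDirection i k) (tetrahedronVertex j q - tetrahedronVertex j p)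
        (edgeDirection i k) = 0 ∧
      0 ≤ edgeDirection i k ⬝ᵥ (tetrahedronVertex j q - tetrahedronVertex j p) := by
  decide +kernel

theorem exists_mem_intMaximizers_notMem : ∀ i k, ∀ uv ∈ edgeArcs i k,
    (∃ j, ∃ a ∈ intMaximizers uv.1 j, a ∉ intMaximizers uv.2 j) ∧
      ∃ j, ∃ a ∈ intMaximizers uv.2 j, a ∉ intMaximizers uv.1 j := by
  decide +kernel

/-- The vertex selections of the edges of `P`. -/
def edgeSelections : Finset (Fin 3 → Finset (Fin 4)) :=
  Finset.univ.biUnion fun ik : Fin 3 × Fin 6 =>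
    ((edgeArcs ik.1 ik.2).map commonMaximizers).toFinset

theorem filter_edgeSelections : ∀ i k,
    edgeSelections.filter (fun M => M i = edgePair k) =
      ((edgeArcs i k).map commonMaximizers).toFinset := by
  decide +kernel

theorem nodup_map_commonMaximizers : ∀ i k, ((edgeArcs i k).map commonMaximizers).Nodup := by
  decide +kernel

end PolytopeData

section Edges

open Matrix

variable {i j : Fin 3} {k : Fin 6} {uv : (Fin 3 → ℤ) × (Fin 3 → ℤ)}
  {L : EuclideanSpace ℝ (Fin 3)}

theorem isChain_mem_openCone_normalChain (i : Fin 3) (k : Fin 6) :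
    ((normalChain i k).first :: (normalChain i k).mid).IsChain fun x y =>
      intPoint y ∈ openCone (intPoint x) (intPoint (normalChain i k).last) :=
  (isChain_isBetween_normalChain i k).imp fun _ _ h => h.mem_openCone

theorem tetrahedronPoint_sub (i : Fin 3) (a b : Fin 4) :
    tetrahedronPoint i b - tetrahedronPoint i a =
      intPoint (tetrahedronVertex i b - tetrahedronVertex i a) :=
  (map_sub intPoint _ _).symm

theorem intPoint_edgeDirection_ne_zero (i : Fin 3) (k : Fin 6) :
    intPoint (edgeDirection i k) ≠ 0 :=
  (map_ne_zero_iff _ intPoint_injective).2 (edgeDirection_ne_zero i k)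

theorem mem_openCone_of_maximizers_eq {u v : EuclideanSpace ℝ (Fin 3)} {a b c c' : Fin 4}
    (hnodup : [a, b, c, c'].Nodup) (hu : maximizers tetrahedronPoint u i = {a, b, c})
    (hv : maximizers tetrahedronPoint v i = {a, b, c'})
    (hL : maximizers tetrahedronPoint L i = {a, b}) : L ∈ openCone u v := by
  have hdet := det_tetrahedronVertex_ne_zero i a b c c' hnodup
  simp only [List.nodup_cons, List.mem_cons, List.not_mem_nil, or_false, not_or, List.nodup_nil,
    not_false_eq_true, and_true] at hnodup
  refine mem_openCone_of_inner (d := tetrahedronPoint i b - tetrahedronPoint i a)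
    (e := tetrahedronPoint i c - tetrahedronPoint i a)
    (e' := tetrahedronPoint i c' - tetrahedronPoint i a) (fun w hd he he' => ?_)
    (inner_sub_eq_zero_of_mem_maximizers ?_ ?_) (inner_sub_eq_zero_of_mem_maximizers ?_ ?_)
    (inner_sub_neg_of_notMem_maximizers ?_ ?_) (inner_sub_eq_zero_of_mem_maximizers ?_ ?_)
    (inner_sub_neg_of_notMem_maximizers ?_ ?_) (inner_sub_eq_zero_of_mem_maximizers ?_ ?_)
    (inner_sub_eq_zero_of_mem_maximizers ?_ ?_) (inner_sub_neg_of_notMem_maximizers ?_ ?_)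
    (inner_sub_neg_of_notMem_maximizers ?_ ?_)
  · refine eq_zero_of_inner_intPoint_eq_zero hdet fun m => ?_
    simp only [tetrahedronPoint_sub] at hd he he'
    fin_cases m
    exacts [hd, he, he']
  all_goals grind

theorem mem_openCone_of_maximizers_eq_edgePair (h : maximizers tetrahedronPoint L i = edgePair k) :
    L ∈ openCone (intPoint (normalChain i k).first) (intPoint (normalChain i k).last) :=
  mem_openCone_of_maximizers_eq (edgeEnds_nodup k)
    ((congrFun (maximizers_intPoint _) i).trans (intMaximizers_first i k))
    ((congrFun (maximizers_intPoint _) i).trans (intMaximizers_last i k)) h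

theorem gramCoeff_eq_zero_of_finrank_eq_one
    (h : Module.finrank ℝ (vectorSpan ℝ (minkowskiSum tetrahedronPoint (fun i => (dilation i : ℝ))
      (maximizers tetrahedronPoint L))) = 1) {a b p q : Fin 4}
    (ha : a ∈ maximizers tetrahedronPoint L i) (hb : b ∈ maximizers tetrahedronPoint L i)
    (hp : p ∈ maximizers tetrahedronPoint L j) (hq : q ∈ maximizers tetrahedronPoint L j) :
    gramCoeff (tetrahedronVertex i b - tetrahedronVertex i a)
      (tetrahedronVertex j q - tetrahedronVertex j p)
      (tetrahedronVertex i b - tetrahedronVertex i a) = 0 := by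
  have hne := maximizers_nonempty tetrahedronPoint L
  have := gramDet_eq_zero_of_finrank_eq_one h
    (sub_mem_vectorSpan_minkowskiSum dilation_pos hne ha hb)
    (sub_mem_vectorSpan_minkowskiSum dilation_pos hne hp hq)
  rwa [tetrahedronPoint_sub, tetrahedronPoint_sub, gramDet_intPoint, Int.cast_eq_zero] at this

theorem exists_maximizers_eq_edgePair
    (h : Module.finrank ℝ (vectorSpan ℝ (minkowskiSum tetrahedronPoint (fun i => (dilation i : ℝ))
      (maximizers tetrahedronPoint L))) = 1) :
    ∃ i k, maximizers tetrahedronPoint L i = edgePair k := by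
  obtain ⟨i, hi⟩ : ∃ i, ¬ (maximizers tetrahedronPoint L i : Set (Fin 4)).Subsingleton := by
    by_contra! hsub
    rw [vectorSpan_of_subsingleton _ (minkowskiSum_subsingleton hsub)] at h
    simp at h
  refine ⟨i, exists_edgePair_eq _ (le_antisymm (not_lt.1 fun hlt => ?_) ?_)⟩
  · obtain ⟨a, ha, b, hb, c, hc, hab, hac, hbc⟩ := Finset.two_lt_card.1 hlt
    exact gramCoeff_tetrahedronVertex_ne_zero i a b c (by simp [hab, hac, hbc])
      (gramCoeff_eq_zero_of_finrank_eq_one h ha hb ha hc)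
  · exact Finset.one_lt_card_iff_nontrivial.2 (Set.not_subsingleton_iff.1 hi)

theorem exists_isEdgeArc (huv : uv ∈ edgeArcs i k) : ∃ p q ρ,
    IsEdgeArc tetrahedronPoint (intPoint uv.1) (intPoint uv.2) (intPoint (edgeDirection i k))
      p q ρ := by
  have hd := intPoint_edgeDirection_ne_zero i k
  have hdd := real_inner_self_pos.2 hd
  choose p q hinter hdet hnonneg using exists_commonMaximizers_eq_pair i k uv huv
  let ρ : Fin 3 → ℝ := fun j =>
    inner ℝ (intPoint (edgeDirection i k)) (tetrahedronPoint j (q j) - tetrahedronPoint j (p j)) /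
      inner ℝ (intPoint (edgeDirection i k)) (intPoint (edgeDirection i k))
  have hvertex : ∀ j, tetrahedronPoint j (q j) =
      tetrahedronPoint j (p j) + ρ j • intPoint (edgeDirection i k) := fun j => by
    rw [← sub_eq_iff_eq_add']
    refine eq_smul_of_gramDet_eq_zero hd ?_
    rw [tetrahedronPoint_sub, gramDet_intPoint, hdet, Int.cast_zero]
  have hρ : ∀ j, 0 ≤ ρ j := fun j => by
    refine div_nonneg ?_ hdd.le
    rw [tetrahedronPoint_sub, inner_intPoint]
    exact_mod_cast hnonneg j
  obtain ⟨hfst, hsnd⟩ := exists_mem_intMaximizers_notMem i k uv huv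
  refine ⟨p, q, ρ, hd, fun j => ?_, hvertex, hρ, ⟨i, (hρ i).lt_of_ne' fun hzero => ?_⟩, ?_, ?_⟩
  · rw [maximizers_intPoint, maximizers_intPoint]
    exact hinter j
  · have heq : tetrahedronVertex i (q i) = tetrahedronVertex i (p i) :=
      intPoint_injective ((hvertex i).trans (by rw [hzero, zero_smul, add_zero]; rfl))
    have hpair := (hinter i).symm.trans (commonMaximizers_eq_edgePair i k uv huv)
    rw [tetrahedronVertex_injective i heq, Finset.pair_eq_singleton] at hpair
    simpa [← hpair] using card_edgePair k
  · simpa only [maximizers_intPoint] using hfst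
  · simpa only [maximizers_intPoint] using hsnd

theorem maximizers_eq_commonMaximizers (huv : uv ∈ edgeArcs i k)
    (hL : L ∈ openCone (intPoint uv.1) (intPoint uv.2)) :
    maximizers tetrahedronPoint L = commonMaximizers uv := by
  obtain ⟨p, q, hp, hq, rfl⟩ := hL
  obtain ⟨_, _, _, harc⟩ := exists_isEdgeArc huv
  rw [commonMaximizers_eq, maximizers_add, maximizers_smul _ hp, maximizers_smul _ hq]
  rw [maximizers_smul _ hp, maximizers_smul _ hq]
  exact harc.inter_nonempty

theorem maximizers_add_intPoint (huv : uv ∈ edgeArcs i k) :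
    maximizers tetrahedronPoint (intPoint uv.1 + intPoint uv.2) = commonMaximizers uv :=
  maximizers_eq_commonMaximizers huv ⟨1, 1, one_pos, one_pos, by simp only [one_smul]⟩

theorem mem_edgeSelections {M : Fin 3 → Finset (Fin 4)} :
    M ∈ edgeSelections ↔ ∃ i k, ∃ uv ∈ edgeArcs i k, commonMaximizers uv = M := by
  simp [edgeSelections]

theorem maximizers_mem_edgeSelections
    (h : Module.finrank ℝ (vectorSpan ℝ (minkowskiSum tetrahedronPoint (fun i => (dilation i : ℝ))
      (maximizers tetrahedronPoint L))) = 1) :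
    maximizers tetrahedronPoint L ∈ edgeSelections := by
  obtain ⟨i, k, hik⟩ := exists_maximizers_eq_edgePair h
  rcases exists_arc_of_mem_openCone (isChain_mem_openCone_normalChain i k)
    (mem_openCone_of_maximizers_eq_edgePair hik) with ⟨uv, huv, hL⟩ | ⟨y, hy, r, hr, rfl⟩
  · exact mem_edgeSelections.2 ⟨i, k, uv, huv, (maximizers_eq_commonMaximizers huv hL).symm⟩
  · obtain ⟨j, p, hp, q, hq, hdet⟩ := exists_gramCoeff_ne_zero_of_mem_mid i k y hy
    refine absurd (gramCoeff_eq_zero_of_finrank_eq_one h ?_ ?_ ?_ ?_) hdet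
    · simp [hik, edgePair]
    · simp [hik, edgePair]
    · rwa [maximizers_smul _ hr, maximizers_intPoint]
    · rwa [maximizers_smul _ hr, maximizers_intPoint]

theorem polytopeEdges_polytopeP : polytopeEdges polytopeP =
    minkowskiSum tetrahedronPoint (fun i => (dilation i : ℝ)) '' (edgeSelections : Set _) := by
  rw [polytopeP_eq_minkowskiSum]
  ext e
  constructor
  · rintro ⟨hexp, hfin⟩
    have hne : e.Nonempty := Set.nonempty_iff_ne_empty.2 fun he => by
      rw [he, vectorSpan_empty, finrank_bot] at hfin
      exact zero_ne_one hfin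
    obtain ⟨L, rfl⟩ :=
      exists_eq_minkowskiSum_maximizers_of_isExposed (fun i => (dilation_pos i).le) hexp hne
    exact ⟨_, maximizers_mem_edgeSelections hfin, rfl⟩
  · rintro ⟨M, hM, rfl⟩
    obtain ⟨i, k, uv, huv, rfl⟩ := mem_edgeSelections.1 hM
    obtain ⟨p, q, ρ, harc⟩ := exists_isEdgeArc huv
    rw [commonMaximizers_eq]
    exact harc.mem_polytopeEdges dilation_pos

theorem injOn_minkowskiSum_edgeSelections :
    Set.InjOn (minkowskiSum tetrahedronPoint fun i => (dilation i : ℝ)) edgeSelections := by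
  have hsub : ∀ M ∈ edgeSelections, ∀ M' ∈ edgeSelections,
      minkowskiSum tetrahedronPoint (fun i => (dilation i : ℝ)) M ⊆
        minkowskiSum tetrahedronPoint (fun i => (dilation i : ℝ)) M' → ∀ i, M i ⊆ M' i := by
    intro M hM M' hM'
    obtain ⟨i, k, uv, huv, rfl⟩ := mem_edgeSelections.1 hM
    obtain ⟨i', k', uv', huv', rfl⟩ := mem_edgeSelections.1 hM'
    rw [← maximizers_add_intPoint huv, ← maximizers_add_intPoint huv']
    exact maximizers_subset_of_minkowskiSum_subset dilation_pos
  exact fun M hM M' hM' h => funext fun i =>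
    (hsub M hM M' hM' h.subset i).antisymm (hsub M' hM' M hM h.superset i)

end Edges

/-! ### The Dehn invariant of `P` -/

section Kagan

variable {f : ℝ → ℝ}

theorem IsKagan.natCast_mul (hf : IsKagan f) (n : ℕ) (a : ℝ) : f (n * a) = n * f a := by
  rw [← nsmul_eq_mul, ← nsmul_eq_mul]
  exact map_nsmul (AddMonoidHom.mk' f hf.1) n a

theorem IsKagan.map_pi_sub (hf : IsKagan f) (a : ℝ) : f (Real.pi - a) = -f a := by
  have := hf.1 (Real.pi - a) a
  rw [sub_add_cancel, hf.2] at this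
  exact eq_neg_of_add_eq_zero_left this.symm

theorem IsKagan.eq_zero_of_natCast_mul_eq_pi (hf : IsKagan f) {n : ℕ} {a : ℝ}
    (h : n * a = Real.pi) : f a = 0 := by
  refine (mul_eq_zero.1 (?_ : (n : ℝ) * f a = 0)).resolve_left fun hn => ?_
  · rw [← hf.natCast_mul, h, hf.2]
  · rw [hn, zero_mul] at h
    exact Real.pi_ne_zero h.symm

theorem two_mul_arccos_sqrt {q : ℝ} (h0 : 0 ≤ q) (h1 : q ≤ 1) :
    2 * Real.arccos √q = Real.arccos (2 * q - 1) := by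
  have hle : Real.arccos √q ≤ Real.pi / 2 := Real.arccos_le_pi_div_two.2 (Real.sqrt_nonneg q)
  rw [← Real.arccos_cos (x := 2 * Real.arccos √q)
    (mul_nonneg zero_le_two (Real.arccos_nonneg _)) (by linarith), Real.cos_two_mul,
    Real.cos_arccos (by linarith [Real.sqrt_nonneg q]) (Real.sqrt_le_one.2 h1), Real.sq_sqrt h0]

theorem IsKagan.map_arccos_sqrt (hf : IsKagan f) {q : ℝ} (h0 : 0 ≤ q) (h1 : q ≤ 1) :
    f (Real.arccos √q) = f (Real.arccos (2 * q - 1)) / 2 := by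
  rw [← two_mul_arccos_sqrt h0 h1, ← Nat.cast_two (R := ℝ), hf.natCast_mul]
  field_simp

theorem IsKagan.map_arccos_zero (hf : IsKagan f) : f (Real.arccos 0) = 0 :=
  hf.eq_zero_of_natCast_mul_eq_pi (n := 2) (by
    rw [Real.arccos_zero, Nat.cast_two, mul_div_cancel₀ _ two_ne_zero])

theorem IsKagan.map_arccos_sqrt_half (hf : IsKagan f) : f (Real.arccos √(1 / 2)) = 0 := by
  rw [hf.map_arccos_sqrt (by norm_num) (by norm_num)]
  rw [mul_one_div_cancel two_ne_zero, sub_self, hf.map_arccos_zero, zero_div]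

theorem IsKagan.map_arccos_sqrt_quarter (hf : IsKagan f) : f (Real.arccos √(1 / 4)) = 0 := by
  refine hf.eq_zero_of_natCast_mul_eq_pi (n := 3) ?_
  rw [show √(1 / 4 : ℝ) = Real.cos (Real.pi / 3) by
      rw [Real.cos_pi_div_three, Real.sqrt_eq_iff_mul_self_eq] <;> norm_num,
    Real.arccos_cos (by positivity) (by linarith [Real.pi_pos])]
  push_cast
  ring

theorem IsKagan.map_arccos_sqrt_third (hf : IsKagan f) :
    f (Real.arccos √(1 / 3)) = -(f (Real.arccos (1 / 3)) / 2) := by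
  rw [hf.map_arccos_sqrt (by norm_num) (by norm_num),
    show (2 * (1 / 3) - 1 : ℝ) = -(1 / 3) by norm_num, Real.arccos_neg, hf.map_pi_sub, neg_div]

theorem arccos_one_third_notMem_span : Real.arccos (1 / 3) ∉ Submodule.span ℚ {Real.pi} := by
  rw [Submodule.mem_span_singleton]
  rintro ⟨r, hr⟩
  have := niven ⟨r, by rw [← hr, Rat.smul_def]⟩
    (θ := Real.arccos (1 / 3)) ⟨1 / 3, by rw [Real.cos_arccos] <;> norm_num⟩
  rw [Real.cos_arccos (by norm_num) (by norm_num)] at this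
  norm_num at this

theorem exists_isKagan_arccos_one_third_ne_zero :
    ∃ f : ℝ → ℝ, IsKagan f ∧ f (Real.arccos (1 / 3)) ≠ 0 := by
  obtain ⟨g, hg, hker⟩ := Submodule.exists_le_ker_of_notMem arccos_one_third_notMem_span
  have hpi : g Real.pi = 0 := hker (Submodule.mem_span_singleton_self _)
  exact ⟨fun x => g x, ⟨fun a b => by simp, by simp [hpi]⟩, by simpa using hg⟩

end Kagan

section Dehn

open Matrix

variable {i : Fin 3} {k : Fin 6} {uv : (Fin 3 → ℤ) × (Fin 3 → ℤ)} {f : ℝ → ℝ}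

theorem norm_tetrahedronPoint_sub (i : Fin 3) (a b : Fin 4) :
    ‖tetrahedronPoint i b - tetrahedronPoint i a‖ =
      ∑ k, if {a, b} = edgePair k then ‖intPoint (edgeDirection i k)‖ else 0 := by
  rcases eq_or_ne a b with rfl | hab
  · have hne : ∀ k, ({a, a} : Finset (Fin 4)) ≠ edgePair k := fun k h => by
      simpa [← h] using card_edgePair k
    simp only [sub_self, norm_zero, hne, if_false, Finset.sum_const_zero]
  · obtain ⟨k, hk⟩ := exists_edgePair_eq {a, b} (Finset.card_pair hab)
    rw [Finset.sum_eq_single_of_mem k (Finset.mem_univ k)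
      fun l _ hl => if_neg fun h => hl (edgePair_injective (h.symm.trans hk)), if_pos hk,
      tetrahedronPoint_sub, edgeDirection]
    rw [edgePair, ← Finset.coe_inj, Finset.coe_pair, Finset.coe_pair, Set.pair_eq_pair_iff] at hk
    rcases hk with ⟨rfl, rfl⟩ | ⟨rfl, rfl⟩
    · rfl
    · rw [map_sub, map_sub, norm_sub_rev]

theorem diam_minkowskiSum_commonMaximizers (huv : uv ∈ edgeArcs i k) :
    Metric.diam (minkowskiSum tetrahedronPoint (fun i => (dilation i : ℝ))
      (commonMaximizers uv)) = ∑ j, ∑ l,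
        if commonMaximizers uv j = edgePair l then dilation j * ‖intPoint (edgeDirection j l)‖
        else 0 := by
  obtain ⟨p, q, ρ, harc⟩ := exists_isEdgeArc huv
  rw [commonMaximizers_eq, harc.diam_minkowskiSum dilation_pos]
  refine Finset.sum_congr rfl fun j _ => ?_
  simp only [harc.inter_eq, norm_tetrahedronPoint_sub, Finset.mul_sum, mul_ite, mul_zero]

theorem dihedralAngle_polytopeP_commonMaximizers (huv : uv ∈ edgeArcs i k) :
    dihedralAngle polytopeP (minkowskiSum tetrahedronPoint (fun i => (dilation i : ℝ))
      (commonMaximizers uv)) =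
        Real.pi - InnerProductGeometry.angle (intPoint uv.1) (intPoint uv.2) := by
  obtain ⟨p, q, ρ, harc⟩ := exists_isEdgeArc huv
  rw [commonMaximizers_eq, polytopeP_eq_minkowskiSum, harc.dihedralAngle_minkowskiSum dilation_pos]

/-- The dihedral angle of the `i`-th tetrahedron at its `k`-th edge. -/
noncomputable def edgeAngle (i : Fin 3) (k : Fin 6) : ℝ :=
  Real.pi - InnerProductGeometry.angle (intPoint (normalChain i k).first)
    (intPoint (normalChain i k).last)

theorem sum_map_dihedralAngle (hf : IsKagan f) (i : Fin 3) (k : Fin 6) :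
    ∑ M ∈ edgeSelections with M i = edgePair k, f (dihedralAngle polytopeP
      (minkowskiSum tetrahedronPoint (fun i => (dilation i : ℝ)) M)) = f (edgeAngle i k) := by
  have hneg : ∀ r s, -f (r + s) = -f r + -f s := fun r s => by rw [hf.1, neg_add]
  rw [edgeAngle, hf.map_pi_sub, map_angle_eq_sum_arcs (f := fun r => -f r) hneg
    (isChain_mem_openCone_normalChain i k)
    fun y hy => (map_ne_zero_iff _ intPoint_injective).2 (ne_zero_of_mem_mid i k y hy),
    filter_edgeSelections, List.sum_toFinset _ (nodup_map_commonMaximizers i k), List.map_map]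
  refine congrArg List.sum (List.map_congr_left fun uv huv => ?_)
  rw [Function.comp_apply, dihedralAngle_polytopeP_commonMaximizers huv, hf.map_pi_sub]

-- The Dehn invariant of a Minkowski sum is the sum of the Dehn invariants: the normal arc of an
-- edge of a summand is subdivided into the normal arcs of the edges of the sum parallel to it.
theorem dehnInvariant_polytopeP_eq_sum (hf : IsKagan f) :
    dehnInvariant f polytopeP =
      ∑ i, dilation i * ∑ k, ‖intPoint (edgeDirection i k)‖ * f (edgeAngle i k) := by
  rw [dehnInvariant, polytopeEdges_polytopeP, finsum_mem_image injOn_minkowskiSum_edgeSelections,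
    finsum_mem_coe_finset]
  have hdiam : ∀ M ∈ edgeSelections, Metric.diam (minkowskiSum tetrahedronPoint
      (fun i => (dilation i : ℝ)) M) = ∑ i, ∑ k,
        if M i = edgePair k then dilation i * ‖intPoint (edgeDirection i k)‖ else 0 := by
    intro M hM
    obtain ⟨i, k, uv, huv, rfl⟩ := mem_edgeSelections.1 hM
    exact diam_minkowskiSum_commonMaximizers huv
  rw [Finset.sum_congr rfl fun M hM => by rw [hdiam M hM]]
  simp only [Finset.sum_mul, ite_mul, zero_mul]
  rw [Finset.sum_comm]
  refine Finset.sum_congr rfl fun i _ => ?_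
  rw [Finset.sum_comm, Finset.mul_sum]
  refine Finset.sum_congr rfl fun k _ => ?_
  rw [← Finset.sum_filter, ← Finset.mul_sum, sum_map_dihedralAngle hf, mul_assoc]

theorem first_dotProduct_last_nonpos : ∀ i k,
    (normalChain i k).first ⬝ᵥ (normalChain i k).last ≤ 0 := by
  decide +kernel

theorem edgeAngle_eq_arccos_zero
    (h : (normalChain i k).first ⬝ᵥ (normalChain i k).last = 0) :
    edgeAngle i k = Real.arccos 0 := by
  rw [edgeAngle, pi_sub_angle_intPoint h.le, h]
  simp

theorem edgeAngle_eq_arccos_sqrt (n : ℕ)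
    (h0 : (normalChain i k).first ⬝ᵥ (normalChain i k).last ≠ 0)
    (h : n * ((normalChain i k).first ⬝ᵥ (normalChain i k).last) ^ 2 =
      (normalChain i k).first ⬝ᵥ (normalChain i k).first *
        (normalChain i k).last ⬝ᵥ (normalChain i k).last) :
    edgeAngle i k = Real.arccos √(1 / n) := by
  rw [edgeAngle, pi_sub_angle_intPoint (first_dotProduct_last_nonpos i k), ← Int.cast_mul, ← h]
  push_cast
  rw [one_div, div_mul_cancel_right₀ (pow_ne_zero 2 (Int.cast_ne_zero.2 h0))]

theorem edgeAngle_zero (k : Fin 6) : edgeAngle 0 k = Real.arccos (1 / 3) := by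
  rw [edgeAngle_eq_arccos_sqrt 9 (by revert k; decide +kernel) (by revert k; decide +kernel),
    show (1 / 3 : ℝ) = √(1 / (9 : ℕ)) by rw [eq_comm, Real.sqrt_eq_iff_mul_self_eq] <;> norm_num]

theorem norm_edgeDirection_zero (k : Fin 6) : ‖intPoint (edgeDirection 0 k)‖ = √2 := by
  rw [norm_intPoint, show edgeDirection 0 k ⬝ᵥ edgeDirection 0 k = 2 by revert k; decide +kernel,
    Int.cast_ofNat]

theorem map_edgeAngle_one_of_lt (hf : IsKagan f) (hk : k < 3) : f (edgeAngle 1 k) = 0 := by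
  rw [edgeAngle_eq_arccos_zero (by revert k; decide +kernel), hf.map_arccos_zero]

theorem map_edgeAngle_one_of_le (hf : IsKagan f) (hk : 3 ≤ k) :
    f (edgeAngle 1 k) = -(f (Real.arccos (1 / 3)) / 2) := by
  rw [edgeAngle_eq_arccos_sqrt 3 (by revert k; decide +kernel) (by revert k; decide +kernel),
    Nat.cast_ofNat, hf.map_arccos_sqrt_third]

theorem norm_edgeDirection_one_of_le (hk : 3 ≤ k) :
    ‖intPoint (edgeDirection 1 k)‖ = 3 * √2 := by
  rw [norm_intPoint, show edgeDirection 1 k ⬝ᵥ edgeDirection 1 k = 3 ^ 2 * 2 by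
      revert k; decide +kernel]
  rw [Int.cast_mul, Int.cast_pow, Int.cast_ofNat, Int.cast_ofNat, Real.sqrt_mul (sq_nonneg _),
    Real.sqrt_sq zero_le_three]

theorem map_edgeAngle_two (hf : IsKagan f) (k : Fin 6) : f (edgeAngle 2 k) = 0 := by
  have hdata : ∀ k, (normalChain 2 k).first ⬝ᵥ (normalChain 2 k).last = 0 ∨
      (normalChain 2 k).first ⬝ᵥ (normalChain 2 k).last ≠ 0 ∧ ∃ n ∈ ({2, 4} : Finset ℕ),
        n * ((normalChain 2 k).first ⬝ᵥ (normalChain 2 k).last) ^ 2 =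
          (normalChain 2 k).first ⬝ᵥ (normalChain 2 k).first *
            (normalChain 2 k).last ⬝ᵥ (normalChain 2 k).last := by
    decide +kernel
  rcases hdata k with h | ⟨h0, n, hn, h⟩
  · rw [edgeAngle_eq_arccos_zero h, hf.map_arccos_zero]
  · rw [edgeAngle_eq_arccos_sqrt n h0 h]
    rcases Finset.mem_insert.1 hn with rfl | hn
    · exact hf.map_arccos_sqrt_half
    · rw [Finset.mem_singleton.1 hn]
      exact hf.map_arccos_sqrt_quarter

theorem dehnInvariant_polytopeP (hf : IsKagan f) :
    dehnInvariant f polytopeP = -24 * √2 * f (Real.arccos (1 / 3)) := by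
  have hone : ∑ k, ‖intPoint (edgeDirection 1 k)‖ * f (edgeAngle 1 k) =
      3 * (3 * √2 * -(f (Real.arccos (1 / 3)) / 2)) := by
    have hlow (k : Fin 3) : f (edgeAngle 1 (Fin.castAdd 3 k)) = 0 :=
      map_edgeAngle_one_of_lt hf k.isLt
    have hhigh (k : Fin 3) : 3 ≤ Fin.natAdd 3 k := by revert k; decide
    rw [Fin.sum_univ_add (fun k : Fin (3 + 3) => _)]
    simp only [hlow, mul_zero, Finset.sum_const_zero, zero_add,
      norm_edgeDirection_one_of_le (hhigh _), map_edgeAngle_one_of_le hf (hhigh _)]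
    simp
  rw [dehnInvariant_polytopeP_eq_sum hf, Fin.sum_univ_three, hone]
  simp only [edgeAngle_zero, norm_edgeDirection_zero, map_edgeAngle_two hf, mul_zero,
    Finset.sum_const, Finset.card_univ, Fintype.card_fin, dilation, nsmul_eq_mul]
  simp
  ring

end Dehn

/-! ### Solid angles and dissections -/

section SolidAngle

variable {d : ℕ} {X Y : Set (EuclideanSpace ℝ (Fin d))} {x : EuclideanSpace ℝ (Fin d)}

/-- The proportion of the ball of radius `ε` around `x` that lies in `X`; its limit at `0` is the
solid angle. -/
noncomputable def ballRatio (X : Set (EuclideanSpace ℝ (Fin d))) (x : EuclideanSpace ℝ (Fin d))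
    (ε : ℝ) : ℝ :=
  volume.real (Metric.ball x ε ∩ X) / volume.real (Metric.ball x ε)

theorem volume_ball_inter_ne_top (X : Set (EuclideanSpace ℝ (Fin d)))
    (x : EuclideanSpace ℝ (Fin d)) (ε : ℝ) : volume (Metric.ball x ε ∩ X) ≠ ⊤ :=
  measure_ne_top_of_subset Set.inter_subset_left measure_ball_lt_top.ne

theorem volumeReal_ball_pos (x : EuclideanSpace ℝ (Fin d)) {ε : ℝ} (hε : 0 < ε) :
    0 < volume.real (Metric.ball x ε) :=
  ENNReal.toReal_pos (Metric.measure_ball_pos _ _ hε).ne' measure_ball_lt_top.ne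

theorem ballRatio_le_one (X : Set (EuclideanSpace ℝ (Fin d))) (x : EuclideanSpace ℝ (Fin d))
    (ε : ℝ) : ballRatio X x ε ≤ 1 :=
  div_le_one_of_le₀ (measureReal_mono Set.inter_subset_left measure_ball_lt_top.ne)
    measureReal_nonneg

theorem ballRatio_mono (h : X ⊆ Y) (x : EuclideanSpace ℝ (Fin d)) (ε : ℝ) :
    ballRatio X x ε ≤ ballRatio Y x ε :=
  div_le_div_of_nonneg_right (measureReal_mono (Set.inter_subset_inter_right _ h)
    (volume_ball_inter_ne_top Y x ε)) measureReal_nonneg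

theorem leftInverse_homothety (x : EuclideanSpace ℝ (Fin d)) {r s : ℝ} (h : r * s = 1) :
    Function.LeftInverse (AffineMap.homothety x r) (AffineMap.homothety x s) := fun y => by
  rw [← AffineMap.homothety_mul_apply, h, AffineMap.homothety_one, AffineMap.id_apply]

theorem image_homothety_ball (x : EuclideanSpace ℝ (Fin d)) {r : ℝ} (hr : 0 < r) (ε : ℝ) :
    AffineMap.homothety x r '' Metric.ball x ε = Metric.ball x (r * ε) := by
  rw [Set.image_eq_preimage_of_inverse (leftInverse_homothety x (inv_mul_cancel₀ hr.ne'))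
    (leftInverse_homothety x (mul_inv_cancel₀ hr.ne'))]
  ext y
  rw [Set.mem_preimage, Metric.mem_ball, Metric.mem_ball, dist_homothety_center, norm_inv,
    Real.norm_of_nonneg hr.le, inv_mul_lt_iff₀ hr, dist_comm]

theorem ballRatio_image_homothety (X : Set (EuclideanSpace ℝ (Fin d)))
    (x : EuclideanSpace ℝ (Fin d)) {r : ℝ} (hr : 0 < r) (ε : ℝ) :
    ballRatio (AffineMap.homothety x r '' X) x (r * ε) = ballRatio X x ε := by
  have hvol : ∀ s, volume.real (AffineMap.homothety x r '' s) = |r ^ d| * volume.real s :=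
    fun s => by
      rw [measureReal_def, Measure.addHaar_image_homothety, ENNReal.toReal_mul,
        ENNReal.toReal_ofReal (abs_nonneg _), finrank_euclideanSpace_fin, measureReal_def]
  rw [ballRatio, ballRatio, ← image_homothety_ball x hr,
    ← Set.image_inter (leftInverse_homothety x (inv_mul_cancel₀ hr.ne')).injective, hvol,
    hvol, mul_div_mul_left _ _ (abs_pos.2 (pow_pos hr d).ne').ne']

theorem antitoneOn_ballRatio (hX : Convex ℝ X) (hx : x ∈ X) :
    AntitoneOn (ballRatio X x) (Set.Ioi 0) := by
  intro ε hε δ hδ hle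
  rw [Set.mem_Ioi] at hε hδ
  have hr : ε / δ ∈ Set.Icc 0 1 := ⟨(div_pos hε hδ).le, (div_le_one hδ).2 hle⟩
  have hsub : AffineMap.homothety x (ε / δ) '' X ⊆ X := by
    rintro _ ⟨y, hy, rfl⟩
    rw [AffineMap.homothety_eq_lineMap]
    exact hX.lineMap_mem hx hy hr
  calc ballRatio X x δ
      = ballRatio (AffineMap.homothety x (ε / δ) '' X) x ε := by
        rw [← ballRatio_image_homothety X x (div_pos hε hδ), div_mul_cancel₀ _ hδ.ne']
    _ ≤ ballRatio X x ε := ballRatio_mono hsub x ε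

theorem eventuallyEq_ballRatio_zero (hX : IsClosed X) (hx : x ∉ X) :
    ballRatio X x =ᶠ[𝓝[>] 0] fun _ => 0 := by
  obtain ⟨δ, hδ, hball⟩ := Metric.isOpen_iff.1 hX.isOpen_compl x hx
  filter_upwards [Ioo_mem_nhdsGT hδ] with ε hε
  have hdisj : Disjoint (Metric.ball x ε) X :=
    Set.disjoint_left.2 fun y hy => hball (Metric.ball_subset_ball hε.2.le hy)
  rw [ballRatio, hdisj.inter_eq, measureReal_empty, zero_div]

theorem solidAngle_eq_of_tendsto {a : ℝ} (h : Tendsto (ballRatio X x) (𝓝[>] 0) (𝓝 a)) :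
    solidAngle X x = a :=
  h.limUnder_eq

theorem solidAngle_eq_zero (hX : IsClosed X) (hx : x ∉ X) : solidAngle X x = 0 :=
  solidAngle_eq_of_tendsto (tendsto_const_nhds.congr' (eventuallyEq_ballRatio_zero hX hx).symm)

theorem volumeReal_vadd (X : Set (EuclideanSpace ℝ (Fin d))) (v : EuclideanSpace ℝ (Fin d)) :
    volume.real (v +ᵥ X) = volume.real X :=
  congrArg ENNReal.toReal (measure_vadd volume v X)

theorem volumeReal_neg (X : Set (EuclideanSpace ℝ (Fin d))) : volume.real (-X) = volume.real X :=
  congrArg ENNReal.toReal (Measure.measure_neg volume X)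

theorem ballRatio_vadd (X : Set (EuclideanSpace ℝ (Fin d))) (v x : EuclideanSpace ℝ (Fin d))
    (ε : ℝ) : ballRatio (v +ᵥ X) (v + x) ε = ballRatio X x ε := by
  rw [ballRatio, ballRatio, ← vadd_eq_add, ← Metric.vadd_ball, ← Set.vadd_set_inter,
    volumeReal_vadd, volumeReal_vadd]

theorem solidAngle_vadd (X : Set (EuclideanSpace ℝ (Fin d))) (v x : EuclideanSpace ℝ (Fin d)) :
    solidAngle (v +ᵥ X) (v + x) = solidAngle X x :=
  congrArg (limUnder (𝓝[>] (0 : ℝ))) (funext (ballRatio_vadd X v x))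

theorem ballRatio_neg (X : Set (EuclideanSpace ℝ (Fin d))) (x : EuclideanSpace ℝ (Fin d)) (ε : ℝ) :
    ballRatio (-X) (-x) ε = ballRatio X x ε := by
  rw [ballRatio, ballRatio, ← neg_ball, ← Set.inter_neg, volumeReal_neg, volumeReal_neg]

theorem solidAngle_neg (X : Set (EuclideanSpace ℝ (Fin d))) (x : EuclideanSpace ℝ (Fin d)) :
    solidAngle (-X) (-x) = solidAngle X x :=
  congrArg (limUnder (𝓝[>] (0 : ℝ))) (funext (ballRatio_neg X x))

/-- A compact convex set, possibly empty or of lower dimension. -/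
structure IsConvexBody (X : Set (EuclideanSpace ℝ (Fin d))) : Prop where
  convex : Convex ℝ X
  isCompact : IsCompact X

theorem IsConvexBody.tendsto_ballRatio (hX : IsConvexBody X) (x : EuclideanSpace ℝ (Fin d)) :
    Tendsto (ballRatio X x) (𝓝[>] 0) (𝓝 (solidAngle X x)) := by
  refine tendsto_nhds_limUnder ?_
  by_cases hx : x ∈ X
  · exact ⟨_, (antitoneOn_ballRatio hX.convex hx).tendsto_nhdsGT
      ⟨1, Set.forall_mem_image.2 fun ε _ => ballRatio_le_one X x ε⟩⟩
  · exact ⟨0, tendsto_const_nhds.congr'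
      (eventuallyEq_ballRatio_zero hX.isCompact.isClosed hx).symm⟩

theorem isConvexBody_convexHull (hX : X.Finite) : IsConvexBody (convexHull ℝ X) :=
  ⟨convex_convexHull ℝ X, hX.isCompact_convexHull ℝ⟩

theorem IsConvexBody.add (hX : IsConvexBody X) (hY : IsConvexBody Y) : IsConvexBody (X + Y) :=
  ⟨hX.convex.add hY.convex, hX.isCompact.add hY.isCompact⟩

theorem IsConvexBody.vadd (hX : IsConvexBody X) (v : EuclideanSpace ℝ (Fin d)) :
    IsConvexBody (v +ᵥ X) :=
  ⟨hX.convex.vadd v, hX.isCompact.vadd v⟩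

theorem IsConvexBody.neg (hX : IsConvexBody X) : IsConvexBody (-X) :=
  ⟨hX.convex.neg, hX.isCompact.neg⟩

end SolidAngle

section DiscreteVolume

variable {d : ℕ} {X : Set (EuclideanSpace ℝ (Fin d))}

theorem integerLattice_eq_range (d : ℕ) :
    integerLattice d = Set.range (intPoint : (Fin d → ℤ) → EuclideanSpace ℝ (Fin d)) := by
  ext x
  constructor
  · intro h
    choose z hz using h
    exact ⟨z, by ext j; simp [hz]⟩
  · rintro ⟨z, rfl⟩ j
    exact ⟨z j, rfl⟩

theorem finite_setOf_intPoint_mem (hX : Bornology.IsBounded X) :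
    {z : Fin d → ℤ | intPoint z ∈ X}.Finite := by
  obtain ⟨R, hR⟩ := hX.exists_norm_le
  refine (Set.finite_Icc (fun _ : Fin d => -⌈R⌉) (fun _ => ⌈R⌉)).subset fun z hz => ?_
  have hcoord : ∀ j, |z j| ≤ ⌈R⌉ := fun j => by
    have : |(z j : ℝ)| ≤ ⌈R⌉ :=
      ((PiLp.norm_apply_le (intPoint z) j).trans (hR _ hz)).trans (Int.le_ceil R)
    exact_mod_cast this
  exact ⟨fun j => (abs_le.1 (hcoord j)).1, fun j => (abs_le.1 (hcoord j)).2⟩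

theorem IsConvexBody.finite_support_solidAngle (hX : IsConvexBody X) :
    (Function.support fun z => solidAngle X (intPoint z)).Finite :=
  (finite_setOf_intPoint_mem hX.isCompact.isBounded).subset fun _ hz =>
    not_not.1 fun h => hz (solidAngle_eq_zero hX.isCompact.isClosed h)

theorem IsConvexBody.discreteVolume_eq_finsum (hX : IsConvexBody X) :
    discreteVolume X = ∑ᶠ z, solidAngle X (intPoint z) := by
  rw [discreteVolume, integerLattice_eq_range, ← finsum_mem_range intPoint_injective]
  refine finsum_mem_inter_support_eq' _ _ _ fun x hx => and_iff_right ?_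
  exact not_not.1 fun h => hx (solidAngle_eq_zero hX.isCompact.isClosed h)

theorem IsConvexBody.volumeDefect_vadd (hX : IsConvexBody X) (v : Fin d → ℤ) :
    volumeDefect (intPoint v +ᵥ X) = volumeDefect X := by
  rw [volumeDefect, volumeDefect, (hX.vadd _).discreteVolume_eq_finsum,
    hX.discreteVolume_eq_finsum, volumeReal_vadd, ← finsum_comp_equiv (Equiv.addLeft v)]
  simp only [Equiv.coe_addLeft, map_add, solidAngle_vadd]

theorem IsConvexBody.volumeDefect_neg (hX : IsConvexBody X) :
    volumeDefect (-X) = volumeDefect X := by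
  rw [volumeDefect, volumeDefect, hX.neg.discreteVolume_eq_finsum, hX.discreteVolume_eq_finsum,
    ← finsum_comp_equiv (Equiv.neg (Fin d → ℤ)), volumeReal_neg]
  simp only [Equiv.neg_apply, map_neg, solidAngle_neg]

/-- A finite family of convex bodies with union `P` whose pairwise intersections are null sets. -/
structure IsDissection {κ : Type*} (P : Set (EuclideanSpace ℝ (Fin d)))
    (C : κ → Set (EuclideanSpace ℝ (Fin d))) : Prop where
  isConvexBody : IsConvexBody P
  isConvexBody_cell : ∀ k, IsConvexBody (C k)
  eq_iUnion : P = ⋃ k, C k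
  volume_inter_eq_zero : ∀ k k', k ≠ k' → volume (C k ∩ C k') = 0

namespace IsDissection

variable {κ : Type*} [Fintype κ] {P : Set (EuclideanSpace ℝ (Fin d))}
  {C : κ → Set (EuclideanSpace ℝ (Fin d))}

theorem volumeReal_inter (h : IsDissection P C) {B : Set (EuclideanSpace ℝ (Fin d))}
    (hB : MeasurableSet B) : volume.real (B ∩ P) = ∑ k, volume.real (B ∩ C k) := by
  have hfin : ∀ k, volume (B ∩ C k) ≠ ⊤ := fun k =>
    measure_ne_top_of_subset Set.inter_subset_right (h.isConvexBody_cell k).isCompact.measure_ne_top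
  rw [h.eq_iUnion, Set.inter_iUnion, measureReal_def, measure_iUnion₀, tsum_fintype,
    ENNReal.toReal_sum fun k _ => hfin k]
  · rfl
  · exact fun k k' hk => measure_mono_null
      (Set.inter_subset_inter Set.inter_subset_right Set.inter_subset_right)
      (h.volume_inter_eq_zero k k' hk)
  · exact fun k => (hB.inter (h.isConvexBody_cell k).isCompact.measurableSet).nullMeasurableSet

theorem volumeReal_eq_sum (h : IsDissection P C) : volume.real P = ∑ k, volume.real (C k) := by
  simpa only [Set.univ_inter] using h.volumeReal_inter MeasurableSet.univ

theorem solidAngle_eq_sum (h : IsDissection P C) (x : EuclideanSpace ℝ (Fin d)) :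
    solidAngle P x = ∑ k, solidAngle (C k) x := by
  have hratio : ballRatio P x = fun ε => ∑ k, ballRatio (C k) x ε := funext fun ε => by
    simp only [ballRatio]
    rw [h.volumeReal_inter Metric.isOpen_ball.measurableSet, Finset.sum_div]
  refine solidAngle_eq_of_tendsto ?_
  rw [hratio]
  exact tendsto_finsetSum _ fun k _ => (h.isConvexBody_cell k).tendsto_ballRatio x

theorem volumeDefect_eq_sum (h : IsDissection P C) :
    volumeDefect P = ∑ k, volumeDefect (C k) := by
  simp only [volumeDefect, Finset.sum_sub_distrib, h.volumeReal_eq_sum,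
    (h.isConvexBody_cell _).discreteVolume_eq_finsum]
  rw [h.isConvexBody.discreteVolume_eq_finsum]
  simp only [h.solidAngle_eq_sum]
  rw [finsum_sum_comm _ _ fun k _ => (h.isConvexBody_cell k).finite_support_solidAngle]

end IsDissection

end DiscreteVolume

section Parallelepiped

theorem finsum_eq_index {A : Type*} [AddCommGroup A] (H : AddSubgroup A) [Finite (A ⧸ H)]
    {φ : A → ℝ} (hφ : (Function.support φ).Finite) (h : ∀ a, ∑ᶠ g : H, φ (a + g) = 1) :
    ∑ᶠ a, φ a = H.index := by
  have hbij : Function.Bijective fun x : (A ⧸ H) × H => x.1.out + (x.2 : A) := by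
    constructor
    · rintro ⟨q, g⟩ ⟨q', g'⟩ heq
      obtain rfl : q = q' := by
        simpa [QuotientAddGroup.mk_add_of_mem] using congrArg (QuotientAddGroup.mk (s := H)) heq
      simpa using heq
    · intro a
      have hmem : -(a : A ⧸ H).out + a ∈ H := by
        rw [← QuotientAddGroup.eq, QuotientAddGroup.out_eq']
      exact ⟨(a, ⟨_, hmem⟩), add_neg_cancel_left _ a⟩
  rw [← finsum_comp_equiv (Equiv.ofBijective _ hbij), finsum_curry]
  · have := Fintype.ofFinite (A ⧸ H)
    simp only [Equiv.ofBijective_apply, h]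
    rw [finsum_eq_sum_of_fintype, AddSubgroup.index, Nat.card_eq_fintype_card]
    simp
  · exact hφ.preimage (Equiv.injective _).injOn

variable {d : ℕ} {X : Set (EuclideanSpace ℝ (Fin d))}

theorem isConvexBody_parallelepiped (v : Fin d → EuclideanSpace ℝ (Fin d)) :
    IsConvexBody (parallelepiped v) :=
  ⟨convex_parallelepiped v, isCompact_Icc.image (by fun_prop)⟩

section Tiling

variable (b : Module.Basis (Fin d) ℝ (EuclideanSpace ℝ (Fin d))) (x : EuclideanSpace ℝ (Fin d))

theorem finite_setOf_ball_inter_parallelepiped_nonempty (ε : ℝ) :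
    {g : Submodule.span ℤ (Set.range b) |
      (Metric.ball (x + g) ε ∩ parallelepiped b).Nonempty}.Finite := by
  have hbdd : Bornology.IsBounded (-x +ᵥ Metric.thickening ε (parallelepiped b)) :=
    ((isConvexBody_parallelepiped b).isCompact.isBounded.thickening).vadd _
  refine ((ZSpan.setFinite_inter b hbdd).preimage Subtype.val_injective.injOn).subset ?_
  rintro g ⟨y, hy, hyb⟩
  refine ⟨Set.mem_vadd_set_iff_neg_vadd_mem.2 ?_, g.2⟩
  rw [neg_neg, vadd_eq_add, Metric.mem_thickening_iff]
  exact ⟨y, hyb, Metric.mem_ball'.1 hy⟩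

theorem tsum_volume_ball_inter_parallelepiped (ε : ℝ) :
    ∑' g : Submodule.span ℤ (Set.range b), volume (Metric.ball (x + g) ε ∩ parallelepiped b) =
      volume (Metric.ball x ε) := by
  set L := Submodule.span ℤ (Set.range b)
  have : VAddInvariantMeasure L (EuclideanSpace ℝ (Fin d)) volume :=
    inferInstanceAs (VAddInvariantMeasure L.toAddSubgroup _ volume)
  have : MeasurableConstVAdd L (EuclideanSpace ℝ (Fin d)) :=
    inferInstanceAs (MeasurableConstVAdd L.toAddSubgroup _)
  rw [(ZSpan.isAddFundamentalDomain b volume).measure_eq_tsum (Metric.ball x ε)]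
  refine tsum_congr fun g => ?_
  have hball : g +ᵥ Metric.ball x ε = Metric.ball (x + g) ε := by
    rw [add_comm]
    exact Metric.vadd_ball (g : EuclideanSpace ℝ (Fin d)) x ε
  rw [hball]
  exact (measure_congr (ae_eq_set_inter (ae_eq_refl _)
    (ZSpan.fundamentalDomain_ae_parallelepiped b volume))).symm

theorem finsum_ballRatio_parallelepiped {ε : ℝ} (hε : 0 < ε) :
    ∑ᶠ g : Submodule.span ℤ (Set.range b), ballRatio (parallelepiped b) (x + g) ε = 1 := by
  have hzero : ∀ g : Submodule.span ℤ (Set.range b),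
      ¬(Metric.ball (x + g) ε ∩ parallelepiped b).Nonempty →
        volume (Metric.ball (x + g) ε ∩ parallelepiped b) = 0 := fun g hg => by
    rw [Set.not_nonempty_iff_eq_empty.1 hg, measure_empty]
  have hball : ∀ g : Submodule.span ℤ (Set.range b),
      volume.real (Metric.ball (x + g) ε) = volume.real (Metric.ball x ε) := fun g => by
    rw [← volumeReal_vadd (Metric.ball x ε) g, Metric.vadd_ball, vadd_eq_add, add_comm]
  have hfin := finite_setOf_ball_inter_parallelepiped_nonempty b x ε
  rw [finsum_eq_sum_of_support_subset (s := hfin.toFinset)]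
  · have hsum := tsum_volume_ball_inter_parallelepiped b x ε
    rw [tsum_eq_sum (s := hfin.toFinset) fun g hg => hzero g (by simpa using hg)] at hsum
    simp only [ballRatio, hball, ← Finset.sum_div]
    rw [div_eq_one_iff_eq (volumeReal_ball_pos x hε).ne', measureReal_def, ← hsum,
      ENNReal.toReal_sum fun g _ => volume_ball_inter_ne_top _ _ _]
    rfl
  · rw [hfin.coe_toFinset]
    refine fun g hg => not_not.1 fun h => hg ?_
    change ballRatio _ _ _ = 0
    rw [ballRatio, measureReal_def, hzero g h, ENNReal.toReal_zero, zero_div]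

theorem finsum_solidAngle_parallelepiped :
    ∑ᶠ g : Submodule.span ℤ (Set.range b), solidAngle (parallelepiped b) (x + g) = 1 := by
  have hbody := isConvexBody_parallelepiped b
  have hfin := finite_setOf_ball_inter_parallelepiped_nonempty b x 1
  have hnear : ∀ ε ∈ Set.Ioo (0 : ℝ) 1,
      ∑ g ∈ hfin.toFinset, ballRatio (parallelepiped b) (x + g) ε = 1 := fun ε hε => by
    refine (finsum_eq_sum_of_support_subset _ ?_).symm.trans
      (finsum_ballRatio_parallelepiped b x hε.1)
    rw [hfin.coe_toFinset]
    refine fun g hg => not_not.1 fun h => hg ?_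
    have hempty : Metric.ball (x + (g : EuclideanSpace ℝ (Fin d))) ε ∩ parallelepiped b = ∅ :=
      Set.subset_eq_empty (Set.inter_subset_inter_left _ (Metric.ball_subset_ball hε.2.le))
        (Set.not_nonempty_iff_eq_empty.1 h)
    change ballRatio _ _ _ = 0
    rw [ballRatio, hempty, measureReal_empty, zero_div]
  rw [finsum_eq_sum_of_support_subset (s := hfin.toFinset)]
  · refine tendsto_nhds_unique
      (tendsto_finsetSum _ fun g _ => hbody.tendsto_ballRatio (x + g)) ?_
    refine tendsto_const_nhds.congr' ?_
    filter_upwards [Ioo_mem_nhdsGT one_pos] with ε hε using (hnear ε hε).symm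
  · rw [hfin.coe_toFinset]
    refine fun g hg => ⟨x + g, Metric.mem_ball_self one_pos, not_not.1 fun h => hg ?_⟩
    exact solidAngle_eq_zero hbody.isCompact.isClosed h

theorem covolume_span_range : ZLattice.covolume (Submodule.span ℤ (Set.range b)) =
    volume.real (parallelepiped b) := by
  rw [ZLattice.covolume_eq_measure_fundamentalDomain _ _ (ZSpan.isAddFundamentalDomain b volume)]
  exact measureReal_congr (ZSpan.fundamentalDomain_ae_parallelepiped b volume)

end Tiling

theorem toAddSubgroup_span_basisFun : (Submodule.span ℤ
    (Set.range (EuclideanSpace.basisFun (Fin d) ℝ).toBasis)).toAddSubgroup = intPoint.range := by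
  ext x
  rw [Submodule.mem_toAddSubgroup, Module.Basis.mem_span_iff_repr_mem]
  constructor
  · intro h
    choose z hz using h
    exact ⟨z, by ext j; simpa using hz j⟩
  · rintro ⟨z, rfl⟩ j
    exact ⟨z j, by simp⟩

theorem covolume_span_basisFun : ZLattice.covolume (Submodule.span ℤ
    (Set.range (EuclideanSpace.basisFun (Fin d) ℝ).toBasis)) = 1 := by
  rw [covolume_span_range, measureReal_def, OrthonormalBasis.coe_toBasis,
    OrthonormalBasis.volume_parallelepiped, ENNReal.toReal_one]

theorem index_comap_intPoint_span (b : Module.Basis (Fin d) ℝ (EuclideanSpace ℝ (Fin d)))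
    (hb : ∀ i, b i ∈ intPoint.range) :
    (((Submodule.span ℤ (Set.range b)).toAddSubgroup.comap intPoint).index : ℝ) =
      volume.real (parallelepiped b) := by
  have hle : Submodule.span ℤ (Set.range b) ≤
      Submodule.span ℤ (Set.range (EuclideanSpace.basisFun (Fin d) ℝ).toBasis) := by
    rw [Submodule.span_le, Set.range_subset_iff]
    intro i
    change b i ∈ (Submodule.span ℤ _).toAddSubgroup
    rw [toAddSubgroup_span_basisFun]
    exact hb i
  rw [AddSubgroup.index_comap, ← toAddSubgroup_span_basisFun,
    ← ZLattice.covolume_div_covolume_eq_relIndex' _ _ hle, covolume_span_basisFun, div_one,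
    covolume_span_range]

theorem discreteVolume_parallelepiped (b : Module.Basis (Fin d) ℝ (EuclideanSpace ℝ (Fin d)))
    (hb : ∀ i, b i ∈ intPoint.range) :
    discreteVolume (parallelepiped b) = volume.real (parallelepiped b) := by
  have hbody := isConvexBody_parallelepiped b
  rw [← index_comap_intPoint_span b hb, hbody.discreteVolume_eq_finsum]
  set L := (Submodule.span ℤ (Set.range b)).toAddSubgroup
  have hpos : ((L.comap intPoint).index : ℝ) ≠ 0 := by
    rw [index_comap_intPoint_span b hb, ← covolume_span_range]
    exact ZLattice.covolume_ne_zero _ _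
  have : Finite ((Fin d → ℤ) ⧸ L.comap intPoint) :=
    Nat.finite_of_card_ne_zero (Nat.cast_ne_zero.1 hpos)
  have hL : ∀ g : L, ∃ z : Fin d → ℤ, intPoint z = g := fun g =>
    Submodule.span_le (p := (intPoint.range).toIntSubmodule).2 (Set.range_subset_iff.2 hb) g.2
  let e : L.comap intPoint ≃ L := Equiv.ofBijective (fun z => ⟨intPoint z.1, z.2⟩)
    ⟨fun z w h => Subtype.ext (intPoint_injective (congrArg Subtype.val h)), fun g => by
      obtain ⟨z, hz⟩ := hL g
      exact ⟨⟨z, by rw [AddSubgroup.mem_comap, hz]; exact g.2⟩, Subtype.ext hz⟩⟩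
  refine finsum_eq_index _ hbody.finite_support_solidAngle fun z => ?_
  rw [← finsum_solidAngle_parallelepiped b (intPoint z)]
  simp only [map_add]
  exact finsum_comp_equiv e (f := fun g : L => solidAngle (parallelepiped b) (intPoint z + g))

theorem volumeDefect_eq_zero_of_volume_eq_zero (hX : volume X = 0) : volumeDefect X = 0 := by
  have hball : ∀ x, ballRatio X x = fun _ => 0 := fun x => funext fun ε => by
    rw [ballRatio, measureReal_def, measure_mono_null Set.inter_subset_right hX,
      ENNReal.toReal_zero, zero_div]
  have hangle : ∀ x, solidAngle X x = 0 := fun x =>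
    solidAngle_eq_of_tendsto (hball x ▸ tendsto_const_nhds)
  simp only [volumeDefect, discreteVolume, hangle, finsum_zero, measureReal_def, hX,
    ENNReal.toReal_zero, sub_zero]

theorem volume_parallelepiped_eq_zero {v : Fin d → EuclideanSpace ℝ (Fin d)}
    (hv : ¬LinearIndependent ℝ v) : volume (parallelepiped v) = 0 := by
  refine measure_mono_null ?_ (Measure.addHaar_submodule volume (Submodule.span ℝ (Set.range v))
    fun h => hv (linearIndependent_of_top_le_span_of_card_eq_finrank h.ge (by simp)))
  rintro _ ⟨t, -, rfl⟩
  exact Submodule.sum_mem _ fun i _ => Submodule.smul_mem _ _ (Submodule.subset_span ⟨i, rfl⟩)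

theorem volumeDefect_parallelepiped (z : Fin d → Fin d → ℤ) :
    volumeDefect (parallelepiped fun i => intPoint (z i)) = 0 := by
  by_cases h : LinearIndependent ℝ fun i => intPoint (z i)
  · have hcoe := Module.Basis.coe_mk h (h.span_eq_top_of_card_eq_finrank' (by simp)).ge
    rw [volumeDefect, ← hcoe, discreteVolume_parallelepiped _ fun i => ?_, sub_self]
    rw [hcoe]
    exact ⟨z i, rfl⟩
  · exact volumeDefect_eq_zero_of_volume_eq_zero (volume_parallelepiped_eq_zero h)

end Parallelepiped

section Prism

variable {E : Type*} [AddCommGroup E] [Module ℝ E] {u v w x : E}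

theorem mem_convexHull_zero_pair_iff : x ∈ convexHull ℝ {0, u, v} ↔
    ∃ s r : ℝ, 0 ≤ s ∧ 0 ≤ r ∧ s + r ≤ 1 ∧ s • u + r • v = x := by
  constructor
  · rw [convexHull_insert (Set.insert_nonempty _ _), convexHull_pair]
    simp only [mem_convexJoin, Set.mem_singleton_iff, exists_eq_left]
    rintro ⟨_, ⟨a, b, ha, hb, hab, rfl⟩, c, e, hc, he, hce, rfl⟩
    refine ⟨e * a, e * b, mul_nonneg he ha, mul_nonneg he hb, ?_, ?_⟩
    · rw [← mul_add, hab]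
      linarith
    · rw [smul_zero, zero_add, smul_add, mul_smul, mul_smul]
  · rintro ⟨s, r, hs, hr, hsr, rfl⟩
    have h := (convex_convexHull ℝ ({0, u, v} : Set E)).sum_mem (t := Finset.univ)
      (w := ![1 - s - r, s, r]) (z := ![0, u, v])
    simp only [Finset.mem_univ, forall_const, Fin.forall_fin_succ, Fin.sum_univ_three] at h
    simpa using h ⟨by simpa using by linarith, by simpa, by simpa, by simp⟩
      (by simp only [Matrix.cons_val]; ring)
      ⟨subset_convexHull ℝ _ (by simp), subset_convexHull ℝ _ (by simp),
        subset_convexHull ℝ _ (by simp), by simp⟩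

theorem mem_segment_zero_iff : x ∈ segment ℝ 0 u ↔ ∃ s ∈ Set.Icc (0 : ℝ) 1, s • u = x := by
  simp [segment_eq_image]

theorem segment_zero_eq_vadd_neg : segment ℝ 0 u = u +ᵥ -segment ℝ 0 u := by
  ext x
  simp only [mem_segment_zero_iff, Set.mem_vadd_set_iff_neg_vadd_mem, Set.mem_neg, vadd_eq_add]
  constructor
  · rintro ⟨s, hs, rfl⟩
    exact ⟨1 - s, Set.Icc.mem_iff_one_sub_mem.1 hs, by module⟩
  · rintro ⟨s, hs, hx⟩
    exact ⟨1 - s, Set.Icc.mem_iff_one_sub_mem.1 hs, by rw [sub_smul, hx]; module⟩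

theorem segment_zero_add_segment_zero : segment ℝ 0 u + segment ℝ 0 v =
    convexHull ℝ {0, u, v} ∪ ((u + v) +ᵥ -convexHull ℝ {0, u, v}) := by
  ext x
  simp only [Set.mem_add, mem_segment_zero_iff, Set.mem_union, Set.mem_vadd_set_iff_neg_vadd_mem,
    Set.mem_neg, mem_convexHull_zero_pair_iff, vadd_eq_add]
  constructor
  · rintro ⟨_, ⟨s, ⟨hs0, hs1⟩, rfl⟩, _, ⟨r, ⟨hr0, hr1⟩, rfl⟩, rfl⟩
    rcases le_total (s + r) 1 with h | h
    · exact .inl ⟨s, r, hs0, hr0, h, rfl⟩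
    · exact .inr ⟨1 - s, 1 - r, by linarith, by linarith, by linarith, by module⟩
  · rintro (⟨s, r, hs, hr, h, rfl⟩ | ⟨s, r, hs, hr, h, hx⟩)
    · exact ⟨_, ⟨s, ⟨hs, by linarith⟩, rfl⟩, _, ⟨r, ⟨hr, by linarith⟩, rfl⟩, rfl⟩
    · refine ⟨_, ⟨1 - s, ⟨by linarith, by linarith⟩, rfl⟩, _, ⟨1 - r, ⟨by linarith, by linarith⟩,
        rfl⟩, ?_⟩
      rw [show x = u + v - (s • u + r • v) by rw [hx]; module]
      module

/-- The triangular prism with basis the triangle `0, u, v` and lateral edge `w`. -/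
def prism (u v w : E) : Set E := convexHull ℝ {0, u, v} + segment ℝ 0 w

theorem parallelepiped_eq_prism_union :
    parallelepiped ![u, v, w] = prism u v w ∪ ((u + v + w) +ᵥ -prism u v w) := by
  have hreflect : ((u + v) +ᵥ -convexHull ℝ {0, u, v}) + segment ℝ 0 w =
      (u + v + w) +ᵥ -prism u v w := by
    conv_lhs => rw [segment_zero_eq_vadd_neg (u := w)]
    rw [vadd_add_vadd_comm, prism, neg_add]
  rw [parallelepiped_eq_sum_segment, Fin.sum_univ_three]
  change segment ℝ 0 u + segment ℝ 0 v + segment ℝ 0 w = _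
  rw [segment_zero_add_segment_zero, Set.union_add, hreflect, prism]

theorem map_le_one_of_mem_prism (φ : E →ₗ[ℝ] ℝ) (hu : φ u = 1) (hv : φ v = 1) (hw : φ w = 0)
    (hx : x ∈ prism u v w) : φ x ≤ 1 := by
  obtain ⟨y, hy, z, hz, rfl⟩ := hx
  obtain ⟨s, r, -, -, hsr, rfl⟩ := mem_convexHull_zero_pair_iff.1 hy
  obtain ⟨t, -, rfl⟩ := mem_segment_zero_iff.1 hz
  simpa [hu, hv, hw] using hsr

end Prism

section PrismDefect

theorem volume_setOf_map_eq {d : ℕ} {φ : EuclideanSpace ℝ (Fin d) →ₗ[ℝ] ℝ} (hφ : φ ≠ 0) (c : ℝ) :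
    volume {x | φ x = c} = 0 := by
  obtain ⟨x₀, hx₀⟩ := LinearMap.surjective hφ c
  refine measure_mono_null (t := (AffineSubspace.mk' x₀ (LinearMap.ker φ) : Set _)) ?_
    (Measure.addHaar_affineSubspace _ _ fun h => hφ (LinearMap.ker_eq_top.1 ?_))
  · intro x hx
    simpa [AffineSubspace.mem_mk', hx₀, sub_eq_zero] using hx
  · rw [← AffineSubspace.direction_mk' x₀ (LinearMap.ker φ), h, AffineSubspace.direction_top]

variable (u v w : EuclideanSpace ℝ (Fin 3))

theorem isConvexBody_prism : IsConvexBody (prism u v w) :=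
  (isConvexBody_convexHull (Set.toFinite _)).add <|
    convexHull_pair (𝕜 := ℝ) (0 : EuclideanSpace ℝ (Fin 3)) w ▸
      isConvexBody_convexHull (Set.toFinite _)

theorem volume_prism_inter_eq_zero :
    volume (prism u v w ∩ ((u + v + w) +ᵥ -prism u v w)) = 0 := by
  by_cases h : LinearIndependent ℝ ![u, v, w]
  · let b := Module.Basis.mk h (h.span_eq_top_of_card_eq_finrank' (by simp)).ge
    have hb : ∀ i, b i = ![u, v, w] i := fun i => Module.Basis.mk_apply _ _ i
    let φ := b.coord 0 + b.coord 1
    have hu : φ u = 1 := by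
      rw [show u = b 0 from (hb 0).symm]; simp [φ]
    have hv : φ v = 1 := by
      rw [show v = b 1 from (hb 1).symm]; simp [φ]
    have hw : φ w = 0 := by
      rw [show w = b 2 from (hb 2).symm]; simp [φ]
    have hφ : φ ≠ 0 := fun h0 => by simp [h0] at hu
    refine measure_mono_null ?_ (volume_setOf_map_eq hφ 1)
    rintro _ ⟨hx, y, hy, rfl⟩
    have hle := map_le_one_of_mem_prism φ hu hv hw hx
    have hge := map_le_one_of_mem_prism φ hu hv hw hy
    simp only [vadd_eq_add, map_add, map_neg, hu, hv, hw] at hle hge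
    change φ _ = 1
    simp only [vadd_eq_add, map_add, hu, hv, hw]
    linarith
  · refine measure_mono_null ?_ (volume_parallelepiped_eq_zero h)
    rw [parallelepiped_eq_prism_union]
    exact Set.inter_subset_left.trans Set.subset_union_left

theorem isDissection_parallelepiped :
    IsDissection (parallelepiped ![u, v, w])
      ![prism u v w, (u + v + w) +ᵥ -prism u v w] where
  isConvexBody := isConvexBody_parallelepiped _
  isConvexBody_cell := Fin.forall_fin_two.2
    ⟨isConvexBody_prism u v w, (isConvexBody_prism u v w).neg.vadd _⟩
  eq_iUnion := by
    rw [parallelepiped_eq_prism_union]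
    ext x
    simp [Fin.exists_fin_two]
  volume_inter_eq_zero := by
    have h := volume_prism_inter_eq_zero u v w
    simp [Fin.forall_fin_two, h, Set.inter_comm _ (prism u v w)]

theorem volumeReal_prism :
    volume.real (prism u v w) = volume.real (parallelepiped ![u, v, w]) / 2 := by
  have h := (isDissection_parallelepiped u v w).volumeReal_eq_sum
  simp only [Fin.sum_univ_two, Matrix.cons_val_zero, Matrix.cons_val_one, volumeReal_vadd,
    volumeReal_neg] at h
  linarith

theorem volumeDefect_prism (u v w : Fin 3 → ℤ) :
    volumeDefect (prism (intPoint u) (intPoint v) (intPoint w)) = 0 := by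
  have hbody := isConvexBody_prism (intPoint u) (intPoint v) (intPoint w)
  have hbox : volumeDefect (parallelepiped ![intPoint u, intPoint v, intPoint w]) = 0 := by
    convert volumeDefect_parallelepiped ![u, v, w] using 3
    ext i : 1
    fin_cases i <;> rfl
  rw [(isDissection_parallelepiped _ _ _).volumeDefect_eq_sum, Fin.sum_univ_two] at hbox
  simp only [Matrix.cons_val_zero, Matrix.cons_val_one, ← map_add, hbody.neg.volumeDefect_vadd,
    hbody.volumeDefect_neg] at hbox
  linarith

end PrismDefect

/-! ### Mixed subdivisions -/

section RegularSubdivision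

variable {d : ℕ} {ι α κ : Type*} [Fintype α] {t : ι → α → EuclideanSpace ℝ (Fin d)} {lam : ι → ℝ}
  {w : ι → α → ℝ} {c : ι → α → ℝ}

theorem isCompact_isWeight {M : ι → Finset α} : IsCompact {c : ι → α → ℝ | IsWeight lam M c} := by
  have hset : {c : ι → α → ℝ | IsWeight lam M c} = (⋂ i, ⋂ a, {c | 0 ≤ c i a}) ∩
      (⋂ i, ⋂ a, ⋂ _ : a ∉ M i, {c | c i a = 0}) ∩ ⋂ i, {c | ∑ a, c i a = lam i} := by
    ext c
    simp only [Set.mem_inter_iff, Set.mem_iInter, Set.mem_ofPred_eq]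
    exact ⟨fun h => ⟨⟨h.nonneg, h.eq_zero⟩, h.sum_eq⟩, fun h => ⟨h.1.1, h.1.2, h.2⟩⟩
  have hclosed : IsClosed {c : ι → α → ℝ | IsWeight lam M c} := by
    rw [hset]
    refine ((isClosed_iInter fun i => isClosed_iInter fun a => isClosed_le ?_ ?_).inter
      (isClosed_iInter fun i => isClosed_iInter fun a => isClosed_iInter fun _ =>
        isClosed_eq ?_ ?_)).inter (isClosed_iInter fun i => isClosed_eq ?_ ?_) <;> fun_prop
  refine (isCompact_Icc (a := 0) (b := fun i _ => lam i)).of_isClosed_subset hclosed fun c hc =>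
    ⟨hc.nonneg, fun i a => ?_⟩
  change c i a ≤ lam i
  rw [← hc.sum_eq i]
  exact Finset.single_le_sum (fun a _ => hc.nonneg i a) (Finset.mem_univ a)

variable [Fintype ι]

theorem continuous_weightedPoint : Continuous (weightedPoint t) := by
  unfold weightedPoint
  fun_prop

theorem isConvexBody_minkowskiSum {M : ι → Finset α} : IsConvexBody (minkowskiSum t lam M) :=
  ⟨convex_minkowskiSum, isCompact_isWeight.image continuous_weightedPoint⟩

/-- The weights `c` are a cheapest way to write their weighted point, when the unit of `t i a`
costs `w i a`. -/
structure IsMinimalWeight (t : ι → α → EuclideanSpace ℝ (Fin d)) (w : ι → α → ℝ) (lam : ι → ℝ)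
    (c : ι → α → ℝ) : Prop where
  isWeight : IsWeight lam (fun _ => Finset.univ) c
  le : ∀ c', IsWeight lam (fun _ => Finset.univ) c' → weightedPoint t c' = weightedPoint t c →
    weightedPoint w c ≤ weightedPoint w c'

theorem exists_isMinimalWeight (w : ι → α → ℝ) (hc : IsWeight lam (fun _ => Finset.univ) c) :
    ∃ c', IsMinimalWeight t w lam c' ∧ weightedPoint t c' = weightedPoint t c := by
  have hcompact : IsCompact {c' | IsWeight lam (fun _ => Finset.univ) c' ∧
      weightedPoint t c' = weightedPoint t c} :=
    isCompact_isWeight.inter_right (isClosed_eq continuous_weightedPoint continuous_const)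
  obtain ⟨c', ⟨hc', heq⟩, hmin⟩ := hcompact.exists_isMinOn ⟨c, hc, rfl⟩
    (f := weightedPoint w) (by unfold weightedPoint; fun_prop)
  exact ⟨c', ⟨hc', fun c'' hc'' h => hmin ⟨hc'', h.trans heq⟩⟩, heq⟩

-- Otherwise a small multiple of the relation `u` could be added to `c`, which is cheaper.
theorem IsMinimalWeight.exists_eq_zero (hc : IsMinimalWeight t w lam c) {u : ι → α → ℝ}
    (hu : ∀ i, ∑ a, u i a = 0) (hut : weightedPoint t u = 0) (huw : weightedPoint w u < 0) :
    ∃ i a, u i a < 0 ∧ c i a = 0 := by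
  by_contra! hcon
  have hnonneg : ∀ᶠ ε : ℝ in 𝓝[>] 0, ∀ i a, 0 ≤ c i a + ε * u i a := by
    refine eventually_all.2 fun i => eventually_all.2 fun a => ?_
    rcases lt_or_ge (u i a) 0 with hneg | hnonneg
    · have hpos : 0 < c i a := (hc.isWeight.nonneg i a).lt_of_ne' (hcon i a hneg)
      have hcont : Continuous fun ε : ℝ => c i a + ε * u i a := by fun_prop
      have := (hcont.tendsto 0).eventually (lt_mem_nhds (by simpa using hpos))
      exact (this.filter_mono nhdsWithin_le_nhds).mono fun ε hε => hε.le
    · filter_upwards [self_mem_nhdsWithin] with ε hε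
      exact add_nonneg (hc.isWeight.nonneg i a) (mul_nonneg hε.le hnonneg)
  obtain ⟨ε, hε, hε0⟩ := (hnonneg.and self_mem_nhdsWithin).exists
  have hadd : ∀ {E : Type _} [AddCommGroup E] [Module ℝ E] (s : ι → α → E),
      weightedPoint s (fun i a => c i a + ε * u i a) =
        weightedPoint s c + ε • weightedPoint s u := fun s => by
    simp only [weightedPoint, add_smul, Finset.sum_add_distrib, Finset.smul_sum, mul_smul]
  have h := hc.le (fun i a => c i a + ε * u i a) ⟨hε, by simp, fun i => by
    rw [Finset.sum_add_distrib, ← Finset.mul_sum, hu, hc.isWeight.sum_eq, mul_zero, add_zero]⟩ (by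
    rw [hadd, hut, smul_zero, add_zero])
  rw [hadd, le_add_iff_nonneg_right, smul_eq_mul] at h
  exact h.not_gt (mul_neg_of_pos_of_neg hε0 huw)

/-- The cells `M k` form the regular mixed subdivision induced by the lifting `w`: over the `k`-th
cell the lower hull of the lifted points is the graph of `l k` up to the constants `h k`. -/
structure IsRegularSubdivision (t : ι → α → EuclideanSpace ℝ (Fin d)) (w : ι → α → ℝ)
    (lam : ι → ℝ) (M : κ → ι → Finset α) (l : κ → EuclideanSpace ℝ (Fin d) →ₗ[ℝ] ℝ)
    (h : κ → ι → ℝ) : Prop where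
  le : ∀ k i a, l k (t i a) + h k i ≤ w i a
  eq : ∀ k i, ∀ a ∈ M k i, l k (t i a) + h k i = w i a
  injective : Function.Injective l
  covers : ∀ c, IsMinimalWeight t w lam c → ∃ k, ∀ i a, c i a ≠ 0 → a ∈ M k i

namespace IsRegularSubdivision

variable {M : κ → ι → Finset α} {l : κ → EuclideanSpace ℝ (Fin d) →ₗ[ℝ] ℝ} {h : κ → ι → ℝ}

theorem map_add_le_weightedPoint (hM : IsRegularSubdivision t w lam M l h) (k : κ)
    (hc : IsWeight lam (fun _ => Finset.univ) c) :
    l k (weightedPoint t c) + ∑ i, lam i * h k i ≤ weightedPoint w c := by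
  rw [map_weightedPoint, weightedPoint, weightedPoint, ← Finset.sum_add_distrib]
  refine Finset.sum_le_sum fun i _ => ?_
  rw [← hc.sum_eq, Finset.sum_mul, ← Finset.sum_add_distrib]
  exact Finset.sum_le_sum fun a _ => by
    simpa [mul_add] using mul_le_mul_of_nonneg_left (hM.le k i a) (hc.nonneg i a)

theorem map_add_eq_weightedPoint (hM : IsRegularSubdivision t w lam M l h) {k : κ}
    (hc : IsWeight lam (M k) c) :
    l k (weightedPoint t c) + ∑ i, lam i * h k i = weightedPoint w c := by
  rw [map_weightedPoint, ← hc.weightedPoint_congr (hM.eq k)]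
  simp only [weightedPoint, smul_eq_mul, mul_add, Finset.sum_add_distrib, ← Finset.sum_mul,
    hc.sum_eq]

theorem minkowskiSum_eq_iUnion (hM : IsRegularSubdivision t w lam M l h) :
    minkowskiSum t lam (fun _ => Finset.univ) = ⋃ k, minkowskiSum t lam (M k) := by
  refine Set.Subset.antisymm ?_
    (Set.iUnion_subset fun k => minkowskiSum_mono fun i => Finset.subset_univ _)
  rintro _ ⟨c, hc, rfl⟩
  obtain ⟨c', hmin, heq⟩ := exists_isMinimalWeight w hc
  obtain ⟨k, hk⟩ := hM.covers c' hmin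
  exact Set.mem_iUnion.2 ⟨k, c', ⟨hmin.isWeight.nonneg, fun i a ha => of_not_not fun h0 =>
    ha (hk i a h0), hmin.isWeight.sum_eq⟩, heq⟩

theorem map_add_le_of_mem (hM : IsRegularSubdivision t w lam M l h) {k : κ} (k' : κ)
    {x : EuclideanSpace ℝ (Fin d)} (hx : x ∈ minkowskiSum t lam (M k)) :
    l k' x + ∑ i, lam i * h k' i ≤ l k x + ∑ i, lam i * h k i := by
  obtain ⟨c, hc, rfl⟩ := hx
  rw [hM.map_add_eq_weightedPoint hc]
  exact hM.map_add_le_weightedPoint k' ⟨hc.nonneg, by simp, hc.sum_eq⟩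

theorem isDissection (hM : IsRegularSubdivision t w lam M l h) :
    IsDissection (minkowskiSum t lam fun _ => Finset.univ) fun k => minkowskiSum t lam (M k) where
  isConvexBody := isConvexBody_minkowskiSum
  isConvexBody_cell _ := isConvexBody_minkowskiSum
  eq_iUnion := hM.minkowskiSum_eq_iUnion
  volume_inter_eq_zero k k' hk := by
    refine measure_mono_null ?_ (volume_setOf_map_eq
      (sub_ne_zero.2 fun h0 => hk (hM.injective h0) : l k - l k' ≠ 0)
      (∑ i, lam i * h k' i - ∑ i, lam i * h k i))
    rintro x ⟨hx, hx'⟩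
    have hle := hM.map_add_le_of_mem k' hx
    have hge := hM.map_add_le_of_mem k hx'
    rw [Set.mem_ofPred_eq, LinearMap.sub_apply]
    linarith

end IsRegularSubdivision

end RegularSubdivision

section LatticePieces

variable {d : ℕ} {X Y : Set (EuclideanSpace ℝ (Fin d))}

/-- A set consisting of a single lattice point. -/
def IsLatticePoint (X : Set (EuclideanSpace ℝ (Fin d))) : Prop :=
  ∃ p : Fin d → ℤ, X = {intPoint p}

/-- A segment, possibly degenerate, between two lattice points. -/
def IsLatticeSegment (X : Set (EuclideanSpace ℝ (Fin d))) : Prop :=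
  ∃ p u : Fin d → ℤ, X = intPoint p +ᵥ segment ℝ 0 (intPoint u)

/-- A triangle, possibly degenerate, with lattice points as vertices. -/
def IsLatticeTriangle (X : Set (EuclideanSpace ℝ (Fin d))) : Prop :=
  ∃ p u v : Fin d → ℤ, X = intPoint p +ᵥ convexHull ℝ {0, intPoint u, intPoint v}

theorem IsLatticePoint.volumeDefect_add (hX : IsLatticePoint X) (hY : IsConvexBody Y) :
    volumeDefect (X + Y) = volumeDefect Y := by
  obtain ⟨p, rfl⟩ := hX
  rw [← vadd_eq_add, Set.singleton_vadd, hY.volumeDefect_vadd]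

theorem IsLatticePoint.volumeReal_add (hX : IsLatticePoint X) :
    volume.real (X + Y) = volume.real Y := by
  obtain ⟨p, rfl⟩ := hX
  rw [← vadd_eq_add, Set.singleton_vadd, volumeReal_vadd]

theorem IsLatticeSegment.add_point (hX : IsLatticeSegment X) (hY : IsLatticePoint Y) :
    IsLatticeSegment (X + Y) := by
  obtain ⟨p, u, rfl⟩ := hX
  obtain ⟨q, rfl⟩ := hY
  refine ⟨q + p, u, ?_⟩
  rw [add_comm, map_add, add_vadd, ← vadd_eq_add, Set.singleton_vadd]

theorem volumeDefect_sum_eq_zero {X : Fin d → Set (EuclideanSpace ℝ (Fin d))}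
    (hX : ∀ i, IsLatticeSegment (X i)) : volumeDefect (∑ i, X i) = 0 := by
  choose p u hpu using hX
  have hsum : ∑ i, X i = intPoint (∑ i, p i) +ᵥ parallelepiped fun i => intPoint (u i) := by
    simp only [hpu, ← Set.singleton_vadd, vadd_eq_add, Finset.sum_add_distrib,
      parallelepiped_eq_sum_segment, map_sum, Set.finsetSum_singleton]
  rw [hsum, (isConvexBody_parallelepiped _).volumeDefect_vadd, volumeDefect_parallelepiped]

theorem IsLatticeTriangle.volumeDefect_add {X Y : Set (EuclideanSpace ℝ (Fin 3))}
    (hX : IsLatticeTriangle X) (hY : IsLatticeSegment Y) : volumeDefect (X + Y) = 0 := by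
  obtain ⟨p, u, v, rfl⟩ := hX
  obtain ⟨q, w, rfl⟩ := hY
  rw [vadd_add_vadd_comm, ← map_add]
  exact ((isConvexBody_prism _ _ _).volumeDefect_vadd _).trans (volumeDefect_prism u v w)

variable {α : Type*} (v : α → Fin d → ℤ) (n : ℕ) {S : Finset α}

/-- The convex hull of the dilates `n • v a` of the lattice points `v a`, `a ∈ S`. -/
def dilatedHull (S : Finset α) : Set (EuclideanSpace ℝ (Fin d)) :=
  convexHull ℝ ((fun a => intPoint (n • v a)) '' S)

theorem smul_convexHull_intPoint (S : Finset α) :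
    (n : ℝ) • convexHull ℝ ((fun a => intPoint (v a)) '' S) = dilatedHull v n S := by
  rw [← convexHull_smul, ← Set.image_smul, Set.image_image]
  simp only [dilatedHull, map_nsmul, Nat.cast_smul_eq_nsmul]

theorem minkowskiSum_eq_sum_dilatedHull {ι : Type*} [Fintype ι] [Fintype α]
    (v : ι → α → Fin d → ℤ) {n : ι → ℕ} (hn : ∀ i, 0 < n i) (M : ι → Finset α) :
    minkowskiSum (fun i a => intPoint (v i a)) (fun i => (n i : ℝ)) M =
      ∑ i, dilatedHull (v i) (n i) (M i) := by
  rw [minkowskiSum_eq_sum fun i => Nat.cast_pos.2 (hn i)]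
  exact Finset.sum_congr rfl fun i _ => smul_convexHull_intPoint (v i) (n i) (M i)

theorem isConvexBody_dilatedHull (S : Finset α) : IsConvexBody (dilatedHull v n S) :=
  isConvexBody_convexHull (S.finite_toSet.image _)

theorem dilatedHull_singleton (a : α) : dilatedHull v n {a} = {intPoint (n • v a)} := by
  simp [dilatedHull]

theorem dilatedHull_pair [DecidableEq α] (a b : α) : dilatedHull v n {a, b} =
    intPoint (n • v a) +ᵥ segment ℝ 0 (intPoint (n • (v b - v a))) := by
  rw [← convexHull_pair, ← convexHull_vadd]
  simp [dilatedHull, Set.image_pair, Set.vadd_set_insert, Set.vadd_set_singleton, smul_sub]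

theorem dilatedHull_triple [DecidableEq α] (a b c : α) : dilatedHull v n {a, b, c} =
    intPoint (n • v a) +ᵥ
      convexHull ℝ {0, intPoint (n • (v b - v a)), intPoint (n • (v c - v a))} := by
  rw [← convexHull_vadd]
  simp [dilatedHull, Set.image_insert_eq, Set.vadd_set_insert, Set.vadd_set_singleton, smul_sub]

theorem isLatticePoint_dilatedHull (hS : S.card = 1) : IsLatticePoint (dilatedHull v n S) := by
  obtain ⟨a, rfl⟩ := Finset.card_eq_one.1 hS
  exact ⟨_, dilatedHull_singleton v n a⟩

theorem isLatticeSegment_dilatedHull (hS : S.card = 2) :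
    IsLatticeSegment (dilatedHull v n S) := by
  classical
  obtain ⟨a, b, -, rfl⟩ := Finset.card_eq_two.1 hS
  exact ⟨_, _, dilatedHull_pair v n a b⟩

theorem isLatticeTriangle_dilatedHull (hS : S.card = 3) :
    IsLatticeTriangle (dilatedHull v n S) := by
  classical
  obtain ⟨a, b, c, -, -, -, rfl⟩ := Finset.card_eq_three.1 hS
  exact ⟨_, _, _, dilatedHull_triple v n a b c⟩

end LatticePieces

section Simplex

theorem IsWeight.exists_ne_zero {ι α : Type*} [Fintype α] {lam : ι → ℝ} {M : ι → Finset α}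
    {c : ι → α → ℝ} (hc : IsWeight lam M c) {i : ι} (hi : lam i ≠ 0) : ∃ a, c i a ≠ 0 := by
  by_contra! h
  exact hi (by rw [← hc.sum_eq i, Finset.sum_eq_zero fun a _ => h a])

theorem exists_linearMap_add_eq {ι k V : Type*} [Field k] [AddCommGroup V] [Module k V]
    (b : AffineBasis ι k V) (g : ι → k) : ∃ (l : V →ₗ[k] k) (c : k), ∀ i, l (b i) + c = g i := by
  obtain ⟨i₀⟩ := b.nonempty
  let l := (b.basisOf i₀).constr k fun j => g j - g i₀
  refine ⟨l, g i₀ - l (b i₀), fun i => ?_⟩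
  suffices l (b i - b i₀) = g i - g i₀ by
    rw [map_sub] at this
    linear_combination this
  obtain rfl | hi := eq_or_ne i i₀
  · simp
  · rw [← vsub_eq_sub, ← b.basisOf_apply i₀ ⟨i, hi⟩]
    exact Module.Basis.constr_basis _ _ _ _

variable {d m : ℕ} {t : Fin (m + 1) → EuclideanSpace ℝ (Fin d)} {lam : Fin 2 → ℝ}

/-- The lifting that is constant on the first copy of an ordered simplex and increasing on the
second one. -/
def orderLift (m : ℕ) : Fin 2 → Fin (m + 1) → ℝ := ![0, fun a => ((a : ℕ) : ℝ)]

-- The exchange of `a` and `b` in the two copies does not change the weighted point.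
theorem IsMinimalWeight.le_of_ne_zero {c : Fin 2 → Fin (m + 1) → ℝ}
    (hc : IsMinimalWeight (fun _ => t) (orderLift m) lam c) {a b : Fin (m + 1)} (ha : c 0 a ≠ 0)
    (hb : c 1 b ≠ 0) : b ≤ a := by
  by_contra! hab
  obtain ⟨i, x, hneg, h0⟩ := hc.exists_eq_zero
    (u := ![Pi.single b 1 - Pi.single a 1, Pi.single a 1 - Pi.single b 1])
    (by simp [Fin.forall_fin_two])
    (by
      simp only [weightedPoint, Fin.sum_univ_two, Matrix.cons_val_zero, Matrix.cons_val_one,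
        Pi.sub_apply, sub_smul, Finset.sum_sub_distrib]
      abel)
    (by
      simp [weightedPoint, orderLift, sub_mul, Pi.single_apply, hab])
  revert i
  simp only [Fin.forall_fin_two, Matrix.cons_val_zero, Matrix.cons_val_one, Pi.sub_apply,
    Pi.single_apply]
  constructor
  · rintro hneg h0
    have hx : x ≠ a := fun h => ha (h ▸ h0)
    rw [if_neg hx] at hneg
    split_ifs at hneg <;> norm_num at hneg
  · rintro hneg h0
    have hx : x ≠ b := fun h => hb (h ▸ h0)
    rw [if_neg hx] at hneg
    split_ifs at hneg <;> norm_num at hneg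

theorem exists_isRegularSubdivision (b : AffineBasis (Fin (m + 1)) ℝ (EuclideanSpace ℝ (Fin d)))
    (hlam : lam 0 ≠ 0) : ∃ l h, IsRegularSubdivision (fun _ => b) (orderLift m) lam
      (fun k : Fin (m + 1) => ![Finset.Ici k, Finset.Iic k]) l h := by
  choose l c hlc using fun k : Fin (m + 1) =>
    exists_linearMap_add_eq b fun a => (((min a k : Fin (m + 1)) : ℕ) : ℝ)
  refine ⟨l, fun k => ![c k - (k : ℕ), c k], fun k => Fin.forall_fin_two.2 ⟨fun a => ?_,
    fun a => ?_⟩, fun k => Fin.forall_fin_two.2 ⟨fun a ha => ?_, fun a ha => ?_⟩, fun k k' hk => ?_,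
    ?_⟩
  · simp [orderLift, ← add_sub_assoc, hlc]
  · simp [orderLift, hlc]
  · rw [Matrix.cons_val_zero, Finset.mem_Ici] at ha
    simp [orderLift, ← add_sub_assoc, hlc, min_eq_right ha]
  · rw [Matrix.cons_val_one, Matrix.cons_val_zero, Finset.mem_Iic] at ha
    simp [orderLift, hlc, min_eq_left ha]
  · have hfirst : ∀ k, l k (b 0) + c k = 0 := fun k => by simp [hlc k 0]
    have hlast : ∀ k, l k (b (Fin.last m)) + c k = (k : ℕ) := fun k => by
      rw [hlc, min_eq_right (Fin.le_last k)]
    refine Fin.ext (Nat.cast_injective (R := ℝ) ?_)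
    linear_combination hfirst k - hfirst k' - hlast k + hlast k' +
      LinearMap.congr_fun hk (b (Fin.last m)) - LinearMap.congr_fun hk (b 0)
  · intro w hw
    obtain ⟨k, hk, hmin⟩ := Set.exists_min_image {a | w 0 a ≠ 0} id (Set.toFinite _)
      (hw.isWeight.exists_ne_zero hlam)
    exact ⟨k, Fin.forall_fin_two.2 ⟨fun a ha => Finset.mem_Ici.2 (hmin a ha), fun a ha =>
      Finset.mem_Iic.2 (hw.le_of_ne_zero hk ha)⟩⟩

end Simplex
section DilatedTetrahedron

theorem volumeReal_parallelepiped_intPoint {d : ℕ} (z : Fin d → Fin d → ℤ) :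
    volume.real (parallelepiped fun i => intPoint (z i)) = |((Matrix.of z).det : ℝ)| := by
  let b := (EuclideanSpace.basisFun (Fin d) ℝ).toBasis
  have hmatrix : b.toMatrix (fun i => intPoint (z i)) =
      ((Matrix.of z).map (Int.cast : ℤ → ℝ)).transpose := by
    ext i j
    simp [b, Module.Basis.toMatrix_apply]
  rw [measureReal_def, ← OrthonormalBasis.addHaar_eq_volume (EuclideanSpace.basisFun (Fin d) ℝ),
    Measure.addHaar_parallelepiped, ENNReal.toReal_ofReal (abs_nonneg _), Module.Basis.det_apply,
    hmatrix, Matrix.det_transpose, Int.cast_det]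

theorem volumeReal_triangle_add_segment (p q u v w : Fin 3 → ℤ) :
    volume.real ((intPoint p +ᵥ convexHull ℝ {0, intPoint u, intPoint v}) +
      (intPoint q +ᵥ segment ℝ 0 (intPoint w))) = |((Matrix.of ![u, v, w]).det : ℝ)| / 2 := by
  rw [vadd_add_vadd_comm, volumeReal_vadd]
  refine (volumeReal_prism _ _ _).trans ?_
  rw [← volumeReal_parallelepiped_intPoint]
  congr 3
  ext i : 1
  fin_cases i <;> rfl

variable {v : Fin 4 → Fin 3 → ℤ}

theorem isDissection_dilatedHull_add (hv : AffineIndependent ℝ fun a => intPoint (v a)) {m n : ℕ}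
    (hm : 0 < m) (hn : 0 < n) :
    IsDissection (dilatedHull v m Finset.univ + dilatedHull v n Finset.univ) fun k : Fin 4 =>
      dilatedHull v m (Finset.Ici k) + dilatedHull v n (Finset.Iic k) := by
  let b : AffineBasis (Fin 4) ℝ (EuclideanSpace ℝ (Fin 3)) :=
    ⟨_, hv, hv.affineSpan_eq_top_iff_card_eq_finrank_add_one.2 (by simp)⟩
  have hsum : ∀ M : Fin 2 → Finset (Fin 4),
      minkowskiSum (fun _ => b) (fun i => ((![m, n] : Fin 2 → ℕ) i : ℝ)) M =
        dilatedHull v m (M 0) + dilatedHull v n (M 1) := fun M => by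
    refine (minkowskiSum_eq_sum_dilatedHull (fun _ => v) (Fin.forall_fin_two.2 ⟨hm, hn⟩) M).trans ?_
    simp [Fin.sum_univ_two]
  obtain ⟨l, h, hsub⟩ := exists_isRegularSubdivision b
    (lam := fun i => ((![m, n] : Fin 2 → ℕ) i : ℝ)) (Nat.cast_ne_zero.2 hm.ne')
  simpa [hsum] using hsub.isDissection

theorem volumeDefect_dilatedHull_add (hv : AffineIndependent ℝ fun a => intPoint (v a)) {m n : ℕ}
    (hm : 0 < m) (hn : 0 < n) :
    volumeDefect (dilatedHull v m Finset.univ + dilatedHull v n Finset.univ) =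
      volumeDefect (dilatedHull v m Finset.univ) + volumeDefect (dilatedHull v n Finset.univ) := by
  rw [(isDissection_dilatedHull_add hv hm hn).volumeDefect_eq_sum, Fin.sum_univ_four]
  have hfirst : volumeDefect (dilatedHull v m (Finset.Ici 0) + dilatedHull v n (Finset.Iic 0)) =
      volumeDefect (dilatedHull v m Finset.univ) := by
    rw [add_comm, (isLatticePoint_dilatedHull v n rfl).volumeDefect_add
      (isConvexBody_dilatedHull v m _)]
    rfl
  have hsecond : volumeDefect (dilatedHull v m (Finset.Ici 1) + dilatedHull v n (Finset.Iic 1)) =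
      0 := (isLatticeTriangle_dilatedHull v m rfl).volumeDefect_add
        (isLatticeSegment_dilatedHull v n rfl)
  have hthird : volumeDefect (dilatedHull v m (Finset.Ici 2) + dilatedHull v n (Finset.Iic 2)) =
      0 := by
    rw [add_comm]
    exact (isLatticeTriangle_dilatedHull v n rfl).volumeDefect_add
      (isLatticeSegment_dilatedHull v m rfl)
  have hfourth : volumeDefect (dilatedHull v m (Finset.Ici 3) + dilatedHull v n (Finset.Iic 3)) =
      volumeDefect (dilatedHull v n Finset.univ) := by
    rw [(isLatticePoint_dilatedHull v m rfl).volumeDefect_add (isConvexBody_dilatedHull v n _)]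
    rfl
  rw [hfirst, hsecond, hthird, hfourth, add_zero, add_zero]

theorem dilatedHull_succ {α : Type*} {d : ℕ} (v : α → Fin d → ℤ) (n : ℕ) (S : Finset α) :
    dilatedHull v (n + 1) S = dilatedHull v n S + dilatedHull v 1 S := by
  simp only [← smul_convexHull_intPoint]
  rw [← (convex_convexHull ℝ _).add_smul n.cast_nonneg (Nat.cast_nonneg 1), Nat.cast_add]

theorem volumeDefect_dilatedHull (hv : AffineIndependent ℝ fun a => intPoint (v a)) {n : ℕ}
    (hn : 0 < n) : volumeDefect (dilatedHull v n Finset.univ) =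
      n * volumeDefect (dilatedHull v 1 Finset.univ) := by
  induction n, hn using Nat.le_induction with
  | base => simp
  | succ n hn ih =>
    rw [dilatedHull_succ, volumeDefect_dilatedHull_add hv hn one_pos, ih]
    push_cast
    ring

theorem volumeReal_dilatedHull_one (hv : AffineIndependent ℝ fun a => intPoint (v a)) :
    volume.real (dilatedHull v 1 Finset.univ) =
      |((Matrix.of ![v 1 - v 0, v 2 - v 0, v 3 - v 0]).det : ℝ)| / 6 := by
  have hdouble : volume.real (dilatedHull v 2 Finset.univ) =
      8 * volume.real (dilatedHull v 1 Finset.univ) := by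
    simp only [← smul_convexHull_intPoint, measureReal_def, Measure.addHaar_smul]
    norm_num
  have hfirst : volume.real (dilatedHull v 1 (Finset.Ici 0) + dilatedHull v 1 (Finset.Iic 0)) =
      volume.real (dilatedHull v 1 Finset.univ) := by
    rw [add_comm, (isLatticePoint_dilatedHull v 1 rfl).volumeReal_add]
    rfl
  have hsecond : volume.real (dilatedHull v 1 (Finset.Ici 1) + dilatedHull v 1 (Finset.Iic 1)) =
      |((Matrix.of ![v 1 - v 0, v 2 - v 0, v 3 - v 0]).det : ℝ)| / 2 := by
    rw [show (Finset.Ici 1 : Finset (Fin 4)) = {1, 2, 3} from rfl,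
      show (Finset.Iic 1 : Finset (Fin 4)) = {0, 1} from rfl, dilatedHull_triple, dilatedHull_pair,
      volumeReal_triangle_add_segment]
    congr 3
    simp [Matrix.det_fin_three]
    ring
  have hthird : volume.real (dilatedHull v 1 (Finset.Ici 2) + dilatedHull v 1 (Finset.Iic 2)) =
      |((Matrix.of ![v 1 - v 0, v 2 - v 0, v 3 - v 0]).det : ℝ)| / 2 := by
    rw [add_comm, show (Finset.Ici 2 : Finset (Fin 4)) = {2, 3} from rfl,
      show (Finset.Iic 2 : Finset (Fin 4)) = {0, 1, 2} from rfl, dilatedHull_triple,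
      dilatedHull_pair, volumeReal_triangle_add_segment]
    congr 3
    simp [Matrix.det_fin_three]
    ring
  have hfourth : volume.real (dilatedHull v 1 (Finset.Ici 3) + dilatedHull v 1 (Finset.Iic 3)) =
      volume.real (dilatedHull v 1 Finset.univ) := by
    rw [(isLatticePoint_dilatedHull v 1 rfl).volumeReal_add]
    rfl
  have h := (isDissection_dilatedHull_add hv one_pos one_pos).volumeReal_eq_sum
  rw [← dilatedHull_succ, hdouble, Fin.sum_univ_four, hfirst, hsecond, hthird, hfourth] at h
  linarith

end DilatedTetrahedron

section MixedSubdivision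

open Matrix

/-- A cell of the mixed subdivision of `P`, the sum of the faces `faces i` of the three tetrahedra,
together with the affine function supporting the lifted vertices there, multiplied by `den`. -/
structure MixedCell where
  faces : Fin 3 → Finset (Fin 4)
  den : ℤ
  normal : Fin 3 → ℤ
  height : Fin 3 → ℤ

/-- The heights to which the vertices of the three tetrahedra are lifted. -/
def liftWeight : Fin 3 → Fin 4 → ℤ := ![![8, 17, 14, 17], ![14, 0, 12, 10], ![5, 8, 15, 0]]

/-- The cells of the mixed subdivision of `P` induced by `liftWeight`. -/
def mixedCell : Fin 18 → MixedCell :=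
  ![⟨![{0, 1, 2, 3}, {1}, {1}], 1, ![3, 6, 3], ![8, -15, -7]⟩,
    ⟨![{0}, {0, 1, 2, 3}, {0}], 1, ![-4, -2, 2], ![8, 14, 5]⟩,
    ⟨![{0}, {1}, {0, 1, 2, 3}], 9, ![-17, 7, -47], ![72, -27, 45]⟩,
    ⟨![{0}, {1, 3}, {0, 2, 3}], 9, ![-20, -5, -50], ![72, 0, 45]⟩,
    ⟨![{2}, {1, 2}, {0, 1, 3}], 9, ![13, 37, 73], ![40, -27, 45]⟩,
    ⟨![{0}, {1, 2, 3}, {0, 3}], 9, ![-11, -23, 13], ![72, 81, 45]⟩,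
    ⟨![{0, 1}, {1}, {1, 2, 3}], 12, ![38, 70, -93], ![96, -309, -213]⟩,
    ⟨![{0, 2}, {1}, {0, 1, 3}], 15, ![11, 51, 79], ![120, -45, 75]⟩,
    ⟨![{0, 2}, {1, 2, 3}, {3}], 1, ![6, -4, 0], ![8, -4, -34]⟩,
    ⟨![{0, 3}, {0, 1, 2}, {0}], 4, ![-25, 10, 26], ![32, 56, 20]⟩,
    ⟨![{0, 1, 2}, {1}, {1, 3}], 6, ![19, 35, 17], ![48, -91, -43]⟩,
    ⟨![{0, 2, 3}, {1}, {0, 1}], 5, ![3, 18, 27], ![40, -15, 25]⟩,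
    ⟨![{0, 1, 2}, {1, 3}, {3}], 1, ![13, -4, -7], ![8, -25, -76]⟩,
    ⟨![{0, 2, 3}, {1, 2}, {0}], 2, ![-1, 5, 13], ![16, 5, 10]⟩,
    ⟨![{0, 1}, {1, 3}, {2, 3}], 9, ![86, -5, -156], ![72, -318, -591]⟩,
    ⟨![{0, 2}, {1, 2}, {0, 3}], 7, ![3, 11, 39], ![56, 11, 35]⟩,
    ⟨![{0, 2}, {2, 3}, {0, 3}], 1, ![-7, -43, 13], ![8, -43, 5]⟩,
    ⟨![{2, 3}, {1, 2}, {0, 1}], 3, ![4, 13, 25], ![13, -9, 15]⟩]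

/-- Affine relations between the vertices of the tetrahedra that decrease the lifting heights. -/
def liftRelation : Fin 15 → Fin 3 → Fin 4 → ℤ :=
  ![![![9, -12, 0, 3], ![-6, 5, 1, 0], ![0, 0, 0, 0]],
    ![![9, 0, -12, 3], ![-6, 1, 5, 0], ![0, 0, 0, 0]],
    ![![0, -3, 3, 0], ![0, 1, -1, 0], ![0, 0, 0, 0]],
    ![![9, 0, 0, -9], ![2, 1, 1, -4], ![0, 0, 0, 0]],
    ![![3, -5, 1, 1], ![0, 0, 0, 0], ![-2, 2, 0, 0]],
    ![![27, 0, -27, 0], ![0, -1, 8, -7], ![-4, 0, 0, 4]],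
    ![![0, 0, 0, 0], ![-1, 1, 0, 0], ![1, -1, 0, 0]],
    ![![-9, 0, 9, 0], ![0, 5, -5, 0], ![6, -7, 0, 1]],
    ![![0, 0, 0, 0], ![0, 1, 0, -1], ![1, -2, 1, 0]],
    ![![9, 3, -12, 0], ![0, 0, 0, 0], ![0, 1, -6, 5]],
    ![![9, 3, 0, -12], ![0, 0, 0, 0], ![0, 5, -6, 1]],
    ![![0, 0, 0, 0], ![-2, 1, 0, 1], ![1, 0, -1, 0]],
    ![![0, 0, 0, 0], ![0, 1, -2, 1], ![1, 0, -3, 2]],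
    ![![0, 0, 3, -3], ![0, 0, 0, 0], ![0, 1, 0, -1]],
    ![![0, 0, 0, 0], ![-3, 1, 1, 1], ![1, 0, 0, -1]]]

theorem mixedCell_den_pos : ∀ k, 0 < (mixedCell k).den := by
  decide +kernel

theorem mixedCell_le : ∀ k i a, (mixedCell k).normal ⬝ᵥ tetrahedronVertex i a +
    (mixedCell k).height i ≤ (mixedCell k).den * liftWeight i a := by
  decide +kernel

theorem mixedCell_eq : ∀ k i, ∀ a ∈ (mixedCell k).faces i,
    (mixedCell k).normal ⬝ᵥ tetrahedronVertex i a + (mixedCell k).height i =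
      (mixedCell k).den * liftWeight i a := by
  decide +kernel

theorem eq_of_den_smul_normal_eq : ∀ k k',
    (mixedCell k').den • (mixedCell k).normal = (mixedCell k).den • (mixedCell k').normal →
      k = k' := by
  decide +kernel

theorem sum_liftRelation : ∀ r i, ∑ a, liftRelation r i a = 0 := by
  decide +kernel

theorem sum_liftRelation_smul : ∀ r, ∑ i, ∑ a, liftRelation r i a • tetrahedronVertex i a = 0 := by
  decide +kernel

theorem sum_liftRelation_mul_liftWeight : ∀ r,
    ∑ i, ∑ a, liftRelation r i a * liftWeight i a < 0 := by
  decide +kernel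

theorem exists_subset_faces_vec : ∀ S₀ S₁ S₂ : Finset (Fin 4),
    S₀.Nonempty → S₁.Nonempty → S₂.Nonempty →
      (∃ r, ∀ i a, liftRelation r i a < 0 → a ∈ ![S₀, S₁, S₂] i) ∨
        ∃ k, ∀ i, ![S₀, S₁, S₂] i ⊆ (mixedCell k).faces i := by
  decide +kernel

theorem exists_subset_faces (S : Fin 3 → Finset (Fin 4)) (hS : ∀ i, (S i).Nonempty)
    (hr : ∀ r, ∃ i a, liftRelation r i a < 0 ∧ a ∉ S i) :
    ∃ k, ∀ i, S i ⊆ (mixedCell k).faces i := by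
  have hvec : ![S 0, S 1, S 2] = S := by
    funext i
    fin_cases i <;> rfl
  have hcover := exists_subset_faces_vec (S 0) (S 1) (S 2) (hS 0) (hS 1) (hS 2)
  rw [hvec] at hcover
  refine hcover.resolve_left fun ⟨r, h⟩ => ?_
  obtain ⟨i, a, hneg, ha⟩ := hr r
  exact ha (h i a hneg)

/-- The linear part of the affine function supporting the `k`-th cell. -/
noncomputable def cellFunctional (k : Fin 18) : EuclideanSpace ℝ (Fin 3) →ₗ[ℝ] ℝ :=
  ((mixedCell k).den : ℝ)⁻¹ • innerₛₗ ℝ (intPoint (mixedCell k).normal)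

theorem cellFunctional_add (k : Fin 18) (i : Fin 3) (a : Fin 4) :
    cellFunctional k (tetrahedronPoint i a) + ((mixedCell k).height i : ℝ) / (mixedCell k).den =
      (((mixedCell k).normal ⬝ᵥ tetrahedronVertex i a + (mixedCell k).height i : ℤ) : ℝ) /
        (mixedCell k).den := by
  rw [cellFunctional, LinearMap.smul_apply, innerₛₗ_apply_apply, tetrahedronPoint, inner_intPoint,
    smul_eq_mul]
  push_cast
  ring

theorem cellFunctional_injective : Function.Injective cellFunctional := by
  intro k k' h
  have hk := Int.cast_ne_zero (α := ℝ).2 (mixedCell_den_pos k).ne'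
  have hk' := Int.cast_ne_zero (α := ℝ).2 (mixedCell_den_pos k').ne'
  refine eq_of_den_smul_normal_eq k k' (intPoint_injective (ext_inner_right ℝ fun x => ?_))
  have hx := LinearMap.congr_fun h x
  simp only [cellFunctional, LinearMap.smul_apply, innerₛₗ_apply_apply, smul_eq_mul] at hx
  rw [map_zsmul, map_zsmul, ← Int.cast_smul_eq_zsmul ℝ, ← Int.cast_smul_eq_zsmul ℝ,
    real_inner_smul_left, real_inner_smul_left]
  field_simp at hx
  linear_combination hx

theorem weightedPoint_liftRelation (r : Fin 15) :
    weightedPoint tetrahedronPoint (fun i a => (liftRelation r i a : ℝ)) = 0 := by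
  simp only [weightedPoint, tetrahedronPoint, Int.cast_smul_eq_zsmul, ← map_zsmul, ← map_sum,
    sum_liftRelation_smul, map_zero]

theorem isRegularSubdivision_mixedCell : IsRegularSubdivision tetrahedronPoint
    (fun i a => (liftWeight i a : ℝ)) (fun i => (dilation i : ℝ)) (fun k => (mixedCell k).faces)
    cellFunctional fun k i => ((mixedCell k).height i : ℝ) / (mixedCell k).den where
  le k i a := by
    rw [cellFunctional_add, div_le_iff₀ (Int.cast_pos.2 (mixedCell_den_pos k)), mul_comm]
    exact_mod_cast mixedCell_le k i a
  eq k i a ha := by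
    rw [cellFunctional_add, div_eq_iff (Int.cast_ne_zero.2 (mixedCell_den_pos k).ne'), mul_comm]
    exact_mod_cast mixedCell_eq k i a ha
  injective := cellFunctional_injective
  covers c hc := by
    obtain ⟨k, hk⟩ := exists_subset_faces (fun i => {a | c i a ≠ 0})
      (fun i => by simpa [Finset.filter_nonempty_iff] using
        hc.isWeight.exists_ne_zero (dilation_pos i).ne')
      fun r => by
        simpa using hc.exists_eq_zero (u := fun i a => (liftRelation r i a : ℝ))
          (fun i => by exact_mod_cast sum_liftRelation r i) (weightedPoint_liftRelation r)
          (by simpa [weightedPoint] using mod_cast sum_liftRelation_mul_liftWeight r)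
    exact ⟨k, fun i a ha => hk i (by simpa using ha)⟩

end MixedSubdivision

section FacesSum

variable {d : ℕ} {ι α : Type*}

theorem isLatticePoint_sum {X : ι → Set (EuclideanSpace ℝ (Fin d))} {s : Finset ι}
    (hX : ∀ i ∈ s, IsLatticePoint (X i)) : IsLatticePoint (∑ i ∈ s, X i) := by
  refine Finset.sum_induction X IsLatticePoint ?_ ⟨0, by rw [map_zero]; rfl⟩ hX
  rintro _ _ ⟨p, rfl⟩ ⟨q, rfl⟩
  exact ⟨p + q, by simp⟩

variable [Fintype ι] (v : ι → α → Fin d → ℤ) (n : ι → ℕ)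

theorem volumeDefect_sum_dilatedHull_of_unmixed {S : ι → Finset α} (i : ι)
    (hS : ∀ j ≠ i, (S j).card = 1) : volumeDefect (∑ j, dilatedHull (v j) (n j) (S j)) =
      volumeDefect (dilatedHull (v i) (n i) (S i)) := by
  classical
  rw [← Finset.sum_erase_add _ _ (Finset.mem_univ i)]
  exact (isLatticePoint_sum fun j hj => isLatticePoint_dilatedHull _ _
    (hS j (Finset.ne_of_mem_erase hj))).volumeDefect_add (isConvexBody_dilatedHull _ _ _)

theorem volumeDefect_sum_dilatedHull_of_mixed (v : Fin 3 → α → Fin 3 → ℤ) (n : Fin 3 → ℕ)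
    {S : Fin 3 → Finset α} (hS : (∀ i, (S i).card = 2) ∨
      ∃ σ : Equiv.Perm (Fin 3), ∀ i, (S (σ i)).card = ![3, 2, 1] i) :
    volumeDefect (∑ j, dilatedHull (v j) (n j) (S j)) = 0 := by
  obtain hS | ⟨σ, hσ⟩ := hS
  · exact volumeDefect_sum_eq_zero fun i => isLatticeSegment_dilatedHull _ _ (hS i)
  · rw [← Equiv.sum_comp σ, Fin.sum_univ_three, add_assoc]
    exact (isLatticeTriangle_dilatedHull _ _ (hσ 0)).volumeDefect_add
      ((isLatticeSegment_dilatedHull _ _ (hσ 1)).add_point (isLatticePoint_dilatedHull _ _ (hσ 2)))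

end FacesSum

section TetrahedronFacets

open Matrix

/-- The inner normals of the facets of the tetrahedra; facet `j` is opposite to vertex `j`. -/
def facetNormal : Fin 3 → Fin 4 → Fin 3 → ℤ :=
  ![![![-1, -1, -1], ![1, 1, -1], ![1, -1, 1], ![-1, 1, 1]],
    ![![-5, 1, 1], ![2, 2, -1], ![2, -1, 2], ![1, -2, -2]],
    ![![-2, -2, 1], ![1, 4, 1], ![-1, -1, -4], ![2, -1, 2]]]

/-- The value of the facet normal on the facet. -/
def facetOffset : Fin 3 → Fin 4 → ℤ := ![![-2, 0, 0, 0], ![-9, 0, 0, 0], ![-9, 0, 0, 0]]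

/-- The amount by which the facet normal is larger at the vertex opposite to the facet. -/
def facetHeight : Fin 3 → ℤ := ![2, 9, 9]

theorem facetHeight_pos : ∀ i, 0 < facetHeight i := by decide

theorem facetNormal_dotProduct_tetrahedronVertex : ∀ i j a,
    facetNormal i j ⬝ᵥ tetrahedronVertex i a =
      facetOffset i j + if a = j then facetHeight i else 0 := by
  decide

theorem inner_facetNormal_tetrahedronPoint (i : Fin 3) (j a : Fin 4) :
    inner ℝ (intPoint (facetNormal i j)) (tetrahedronPoint i a) =
      facetOffset i j + if a = j then (facetHeight i : ℝ) else 0 := by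
  rw [tetrahedronPoint, inner_intPoint, facetNormal_dotProduct_tetrahedronVertex]
  push_cast
  rfl

theorem affineIndependent_tetrahedronPoint (i : Fin 3) :
    AffineIndependent ℝ (tetrahedronPoint i) := by
  refine affineIndependent_iff.2 fun s w hw hsum j hj => ?_
  have h := congr_arg (inner ℝ (intPoint (facetNormal i j))) hsum
  simp only [inner_sum, real_inner_smul_right, inner_facetNormal_tetrahedronPoint, mul_add,
    Finset.sum_add_distrib, ← Finset.sum_mul, hw, zero_mul, zero_add, mul_ite, mul_zero,
    Finset.sum_ite_eq', hj, if_true, inner_zero_right] at h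
  exact (mul_eq_zero.1 h).resolve_right (Int.cast_ne_zero.2 (facetHeight_pos i).ne')

end TetrahedronFacets

theorem volumeDefect_polytopeP_eq_sum : volumeDefect polytopeP =
    ∑ i, dilation i * volumeDefect (dilatedHull (tetrahedronVertex i) 1 Finset.univ) := by
  have hcell : ∀ M, minkowskiSum tetrahedronPoint (fun i => (dilation i : ℝ)) M =
      ∑ i, dilatedHull (tetrahedronVertex i) (dilation i) (M i) :=
    minkowskiSum_eq_sum_dilatedHull tetrahedronVertex fun i => Nat.cast_pos.1 (dilation_pos i)
  have hunmixed : ∀ i : Fin 3, (mixedCell (Fin.castAdd 15 i)).faces i = Finset.univ ∧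
      ∀ j ≠ i, ((mixedCell (Fin.castAdd 15 i)).faces j).card = 1 := by
    decide +kernel
  have hmixed : ∀ k : Fin 15, (∀ i, ((mixedCell (Fin.natAdd 3 k)).faces i).card = 2) ∨
      ∃ σ : Equiv.Perm (Fin 3),
        ∀ i, ((mixedCell (Fin.natAdd 3 k)).faces (σ i)).card = ![3, 2, 1] i := by
    decide +kernel
  rw [polytopeP_eq_minkowskiSum, isRegularSubdivision_mixedCell.isDissection.volumeDefect_eq_sum]
  simp only [hcell]
  refine (Fin.sum_univ_add (a := 3) (b := 15) _).trans ?_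
  rw [Finset.sum_eq_zero fun k _ => volumeDefect_sum_dilatedHull_of_mixed _ _ (hmixed k), add_zero]
  refine Finset.sum_congr rfl fun i _ => ?_
  rw [volumeDefect_sum_dilatedHull_of_unmixed _ _ i (hunmixed i).2, (hunmixed i).1,
    volumeDefect_dilatedHull (affineIndependent_tetrahedronPoint i)
      (Nat.cast_pos.1 (dilation_pos i))]

/-! ### Solid angles of the tetrahedra -/

section DualAngle

variable {d : ℕ} {n m p : EuclideanSpace ℝ (Fin d)} {s : Set (EuclideanSpace ℝ (Fin d))}

/-- The solid angle at the origin of the cone cut out by half-spaces with inner normals `s`, that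
is, of the dual cone of `s`. -/
noncomputable def dualAngle (s : Set (EuclideanSpace ℝ (Fin d))) : ℝ :=
  ballRatio (ProperCone.innerDual s : Set (EuclideanSpace ℝ (Fin d))) 0 1

theorem ballRatio_innerDual (s : Set (EuclideanSpace ℝ (Fin d))) {ε : ℝ} (hε : 0 < ε) :
    ballRatio (ProperCone.innerDual s : Set (EuclideanSpace ℝ (Fin d))) 0 ε = dualAngle s := by
  have himage : AffineMap.homothety (0 : EuclideanSpace ℝ (Fin d)) ε '' ProperCone.innerDual s =
      ProperCone.innerDual s := by
    rw [Set.image_eq_preimage_of_inverse (leftInverse_homothety 0 (inv_mul_cancel₀ hε.ne'))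
      (leftInverse_homothety 0 (mul_inv_cancel₀ hε.ne'))]
    ext y
    simp [AffineMap.homothety_apply, real_inner_smul_right, hε]
  rw [dualAngle, ← ballRatio_image_homothety _ _ hε 1, himage, mul_one]

theorem dualAngle_empty : dualAngle (∅ : Set (EuclideanSpace ℝ (Fin d))) = 1 := by
  rw [dualAngle, ProperCone.innerDual_empty, ballRatio, ClosedSubmodule.coe_top, Set.inter_univ,
    div_self (volumeReal_ball_pos _ one_pos).ne']

theorem dualAngle_image (e : EuclideanSpace ℝ (Fin d) ≃ₗᵢ[ℝ] EuclideanSpace ℝ (Fin d))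
    (s : Set (EuclideanSpace ℝ (Fin d))) : dualAngle (e '' s) = dualAngle s := by
  have hpre : Metric.ball 0 1 ∩ (ProperCone.innerDual (e '' s) : Set (EuclideanSpace ℝ (Fin d))) =
      e.symm.toMeasurableEquiv ⁻¹' (Metric.ball 0 1 ∩ ProperCone.innerDual s) := by
    ext y
    simp [← e.inner_map_eq_flip]
  rw [dualAngle, dualAngle, ballRatio, ballRatio, hpre, measureReal_def,
    MeasurePreserving.measure_preimage_equiv (f := e.symm.toMeasurableEquiv)
      e.symm.measurePreserving, ← measureReal_def]

theorem dualAngle_neg (s : Set (EuclideanSpace ℝ (Fin d))) : dualAngle (-s) = dualAngle s := by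
  rw [← Set.image_neg_eq_neg]
  exact dualAngle_image (LinearIsometryEquiv.neg ℝ) s

theorem dualAngle_insert_smul (n : EuclideanSpace ℝ (Fin d)) (s : Set (EuclideanSpace ℝ (Fin d)))
    {r : ℝ} (hr : 0 < r) : dualAngle (insert (r • n) s) = dualAngle (insert n s) := by
  have hcone : ProperCone.innerDual (insert (r • n) s) = ProperCone.innerDual (insert n s) := by
    ext y
    simp [real_inner_smul_left, hr]
  rw [dualAngle, hcone, dualAngle]

theorem dualAngle_insert_add_insert_neg (s : Set (EuclideanSpace ℝ (Fin d))) (hn : n ≠ 0) :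
    dualAngle (insert n s) + dualAngle (insert (-n) s) = dualAngle s := by
  set D : Set (EuclideanSpace ℝ (Fin d)) := Metric.ball 0 1 ∩ ProperCone.innerDual s with hD
  set H : Set (EuclideanSpace ℝ (Fin d)) := {y | 0 ≤ inner ℝ n y} with hH
  have hmeas : MeasurableSet H := (isClosed_le continuous_const (by fun_prop)).measurableSet
  have hne : ∀ᵐ y, inner ℝ n y ≠ 0 := by
    have hplane := volume_setOf_map_eq (φ := innerₛₗ ℝ n)
      (fun h => hn (inner_self_eq_zero.1 (LinearMap.congr_fun h n))) 0
    simpa [ae_iff] using hplane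
  have hpos : Metric.ball 0 1 ∩ (ProperCone.innerDual (insert n s) : Set _) = D ∩ H := by
    ext y
    simp only [hD, hH, Set.mem_inter_iff, SetLike.mem_coe, ProperCone.mem_innerDual,
      Set.forall_mem_insert, Set.mem_ofPred_eq]
    tauto
  have hneg : (Metric.ball 0 1 ∩ (ProperCone.innerDual (insert (-n) s) : Set _) : Set _) =ᵐ[volume]
      (D \ H : Set _) := by
    refine eventuallyEq_set.2 (hne.mono fun y hy => ?_)
    have hiff : 0 ≤ -inner ℝ n y ↔ ¬0 ≤ inner ℝ n y := by
      rw [neg_nonneg, not_le, lt_iff_le_and_ne, and_iff_left hy]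
    simp only [hD, hH, Set.mem_inter_iff, Set.mem_sdiff, SetLike.mem_coe, ProperCone.mem_innerDual,
      Set.forall_mem_insert, Set.mem_ofPred_eq, inner_neg_left, hiff]
    tauto
  rw [dualAngle, dualAngle, dualAngle, ballRatio, ballRatio, ballRatio, ← add_div, hpos,
    measureReal_congr hneg,
    measureReal_inter_add_sdiff hmeas (volume_ball_inter_ne_top _ 0 1)]

theorem dualAngle_singleton (hn : n ≠ 0) : dualAngle {n} = 1 / 2 := by
  have h := dualAngle_insert_add_insert_neg ∅ hn
  rw [insert_empty_eq, insert_empty_eq, ← Set.neg_singleton, dualAngle_neg, dualAngle_empty] at h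
  linarith

theorem dualAngle_pair_neg (hn : n ≠ 0) (hm : m ≠ 0) :
    dualAngle {n, -m} = 1 / 2 - dualAngle {n, m} := by
  rw [← dualAngle_singleton hn, ← dualAngle_insert_add_insert_neg {n} hm, Set.pair_comm m,
    Set.pair_comm (-m)]
  ring

/-- Inclusion-exclusion for the three half-spaces: the opposite cones have the same solid angle. -/
theorem dualAngle_triple (hn : n ≠ 0) (hm : m ≠ 0) (hp : p ≠ 0) : dualAngle {n, m, p} =
    (dualAngle {n, m} + dualAngle {n, p} + dualAngle {m, p} - 1 / 2) / 2 := by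
  have hsplit_n := dualAngle_insert_add_insert_neg {m, p} hn
  have hsplit_m := dualAngle_insert_add_insert_neg {-n, p} hm
  have hsplit_p := dualAngle_insert_add_insert_neg {-n, -m} hp
  have hnp : dualAngle {-n, p} = 1 / 2 - dualAngle {n, p} := by
    rw [Set.pair_comm, dualAngle_pair_neg hp hn, Set.pair_comm]
  have hneg_pair : dualAngle {-n, -m} = dualAngle {n, m} := by
    rw [← dualAngle_neg {n, m}, Set.neg_insert, Set.neg_singleton]
  have hneg_triple : dualAngle {-n, -m, -p} = dualAngle {n, m, p} := by
    rw [← dualAngle_neg {n, m, p}, Set.neg_insert, Set.neg_insert, Set.neg_singleton]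
  rw [Set.insert_comm m] at hsplit_m
  rw [Set.insert_comm p, Set.pair_comm p, Set.insert_comm (-p), Set.pair_comm (-p)] at hsplit_p
  rw [Set.insert_comm (-m)] at hsplit_m
  linarith

theorem dualAngle_pair_add_dualAngle_pair (hn : n ≠ 0) (hm : m ≠ 0) (h : n + m ≠ 0) :
    dualAngle {n, n + m} + dualAngle {m, n + m} = dualAngle {n, m} + 1 / 2 := by
  have hcone : ProperCone.innerDual {n, m, n + m} = ProperCone.innerDual {n, m} := by
    ext y
    simp +contextual [inner_add_left, add_nonneg]
  have htriple := dualAngle_triple hn hm h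
  rw [dualAngle, hcone, ← dualAngle] at htriple
  linarith

theorem exists_linearIsometryEquiv_of_inner_eq {V : Type*} [NormedAddCommGroup V]
    [InnerProductSpace ℝ V] {u₁ u₂ w₁ w₂ : V} (h₁ : ‖u₁‖ = ‖w₁‖) (h₂ : ‖u₂‖ = ‖w₂‖)
    (h : inner ℝ u₁ u₂ = inner ℝ w₁ w₂) : ∃ e : V ≃ₗᵢ[ℝ] V, e u₁ = w₁ ∧ e u₂ = w₂ := by
  set e := (ℝ ∙ (u₁ - w₁))ᗮ.reflection
  have he : e u₁ = w₁ := Submodule.reflection_sub h₁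
  set e' := (ℝ ∙ (e u₂ - w₂))ᗮ.reflection
  refine ⟨e.trans e', ?_, Submodule.reflection_sub (by rw [e.norm_map, h₂])⟩
  rw [LinearIsometryEquiv.trans_apply, he]
  refine Submodule.reflection_mem_subspace_eq_self ?_
  rw [Submodule.mem_orthogonal_singleton_iff_inner_left, inner_sub_right, ← h, ← he,
    e.inner_map_map, sub_self]

theorem dualAngle_pair_congr {u₁ u₂ w₁ w₂ : EuclideanSpace ℝ (Fin d)} (hu₁ : u₁ ≠ 0) (hu₂ : u₂ ≠ 0)
    (hw₁ : w₁ ≠ 0) (hw₂ : w₂ ≠ 0)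
    (h : InnerProductGeometry.angle u₁ u₂ = InnerProductGeometry.angle w₁ w₂) :
    dualAngle {u₁, u₂} = dualAngle {w₁, w₂} := by
  have hr : ∀ {u w : EuclideanSpace ℝ (Fin d)}, u ≠ 0 → w ≠ 0 → 0 < ‖u‖ / ‖w‖ := fun hu hw =>
    div_pos (norm_pos_iff.2 hu) (norm_pos_iff.2 hw)
  have hnorm : ∀ {u w : EuclideanSpace ℝ (Fin d)}, w ≠ 0 → ‖u‖ = ‖(‖u‖ / ‖w‖) • w‖ := fun hw => by
    rw [norm_smul, norm_div, norm_norm, norm_norm, div_mul_cancel₀ _ (norm_ne_zero_iff.2 hw)]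
  obtain ⟨e, he₁, he₂⟩ := exists_linearIsometryEquiv_of_inner_eq (hnorm (u := u₁) hw₁)
    (hnorm (u := u₂) hw₂) (by
      rw [← InnerProductGeometry.cos_angle_mul_norm_mul_norm,
        ← InnerProductGeometry.cos_angle_mul_norm_mul_norm, ← hnorm hw₁, ← hnorm hw₂,
        InnerProductGeometry.angle_smul_left_of_pos _ _ (hr hu₁ hw₁),
        InnerProductGeometry.angle_smul_right_of_pos _ _ (hr hu₂ hw₂), h])
  rw [← dualAngle_image e, Set.image_pair, he₁, he₂, dualAngle_insert_smul _ _ (hr hu₁ hw₁),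
    Set.pair_comm, dualAngle_insert_smul _ _ (hr hu₂ hw₂), Set.pair_comm]

theorem dualAngle_pair_of_inner_eq_zero (hn : n ≠ 0) (hm : m ≠ 0) (h : inner ℝ n m = 0) :
    dualAngle {n, m} = 1 / 4 := by
  have hperp := InnerProductGeometry.inner_eq_zero_iff_angle_eq_pi_div_two n m |>.1 h
  have hneg : dualAngle {n, -m} = dualAngle {n, m} :=
    dualAngle_pair_congr hn (neg_ne_zero.2 hm) hn hm (by
      rw [InnerProductGeometry.angle_neg_right, hperp, sub_half])
  linarith [dualAngle_pair_neg hn hm]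

theorem dualAngle_pair_bisector (hn : n ≠ 0) (hm : m ≠ 0) (hadd : n + m ≠ 0) (h : ‖n‖ = ‖m‖) :
    dualAngle {n, m} + 2 * dualAngle {n, -(n + m)} = 1 / 2 := by
  have hbisect : dualAngle {m, n + m} = dualAngle {n, n + m} :=
    dualAngle_pair_congr hm hadd hn hadd (by
      rw [InnerProductGeometry.angle, InnerProductGeometry.angle, inner_add_right, inner_add_right,
        real_inner_self_eq_norm_sq, real_inner_self_eq_norm_sq, real_inner_comm n m, h, add_comm])
  linarith [dualAngle_pair_add_dualAngle_pair hn hm hadd, dualAngle_pair_neg hn hadd]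

theorem solidAngle_setOf_forall_le_inner {J : Type*} [Finite J] {n : J → EuclideanSpace ℝ (Fin d)}
    {c : J → ℝ} {x : EuclideanSpace ℝ (Fin d)} (hx : ∀ j, c j ≤ inner ℝ (n j) x) :
    solidAngle {y | ∀ j, c j ≤ inner ℝ (n j) y} x =
      dualAngle (n '' {j | inner ℝ (n j) x = c j}) := by
  set C := ProperCone.innerDual (n '' {j | inner ℝ (n j) x = c j})
  have hinactive : ∀ᶠ y in 𝓝 x, ∀ j, inner ℝ (n j) x ≠ c j → c j < inner ℝ (n j) y := by
    refine eventually_all.2 fun j => ?_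
    by_cases hj : inner ℝ (n j) x = c j
    · simp [hj]
    · have hcont : Continuous fun y => (inner ℝ (n j) y : ℝ) := by fun_prop
      exact (hcont.continuousAt.eventually_const_lt ((hx j).lt_of_ne' hj)).mono fun y hy _ => hy
  have hlocal : ∀ᶠ y in 𝓝 x,
      (∀ j, c j ≤ inner ℝ (n j) y) ↔ y ∈ x +ᵥ (C : Set (EuclideanSpace ℝ (Fin d))) := by
    filter_upwards [hinactive] with y hy
    rw [Set.mem_vadd_set_iff_neg_vadd_mem, vadd_eq_add, neg_add_eq_sub, SetLike.mem_coe,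
      ProperCone.mem_innerDual, Set.forall_mem_image]
    refine forall_congr' fun j => ?_
    by_cases hj : inner ℝ (n j) x = c j
    · simp [hj, inner_sub_right]
    · simp [hj, (hy j hj).le]
  obtain ⟨δ, hδ, hball⟩ := Metric.eventually_nhds_iff_ball.1 hlocal
  refine solidAngle_eq_of_tendsto (tendsto_const_nhds.congr' ?_)
  filter_upwards [Ioo_mem_nhdsGT hδ] with ε hε
  have hinter : Metric.ball x ε ∩ {y | ∀ j, c j ≤ inner ℝ (n j) y} =
      Metric.ball x ε ∩ (x +ᵥ (C : Set (EuclideanSpace ℝ (Fin d)))) :=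
    Set.ext fun y => and_congr_right fun hy => hball y (Metric.ball_subset_ball hε.2.le hy)
  rw [ballRatio, hinter, ← ballRatio, ← ballRatio_innerDual _ hε.1, ← ballRatio_vadd _ x, add_zero]

end DualAngle

section WedgeAngle

open Matrix

variable {d : ℕ} {u v u' v' : Fin d → ℤ}

/-- The solid angle of the wedge whose two facets have the integral inner normals `u` and `v`. -/
noncomputable def wedgeAngle (u v : Fin d → ℤ) : ℝ := dualAngle {intPoint u, intPoint v}

theorem intPoint_ne_zero (hu : u ≠ 0) : intPoint u ≠ 0 :=
  (map_ne_zero_iff intPoint intPoint_injective).2 hu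

theorem dualAngle_intPoint_triple {u v w : Fin d → ℤ} (hu : u ≠ 0) (hv : v ≠ 0) (hw : w ≠ 0) :
    dualAngle {intPoint u, intPoint v, intPoint w} =
      (wedgeAngle u v + wedgeAngle u w + wedgeAngle v w - 1 / 2) / 2 :=
  dualAngle_triple (intPoint_ne_zero hu) (intPoint_ne_zero hv) (intPoint_ne_zero hw)

theorem wedgeAngle_congr {k : ℤ} (hk : 0 < k) (hu : u ≠ 0) (hv : v ≠ 0) (hu' : u' ≠ 0)
    (hv' : v' ≠ 0) (h : u' ⬝ᵥ v' = k * (u ⬝ᵥ v))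
    (hnorm : (u' ⬝ᵥ u') * (v' ⬝ᵥ v') = k ^ 2 * ((u ⬝ᵥ u) * (v ⬝ᵥ v))) :
    wedgeAngle u' v' = wedgeAngle u v := by
  have hself : ∀ z : Fin d → ℤ, (0 : ℝ) ≤ (z ⬝ᵥ z : ℤ) := fun z => by
    exact_mod_cast Finset.sum_nonneg fun i _ => mul_self_nonneg (z i)
  have hk' : (0 : ℝ) < k := Int.cast_pos.2 hk
  have hnorm' : ‖intPoint u'‖ * ‖intPoint v'‖ = k * (‖intPoint u‖ * ‖intPoint v‖) := by
    rw [norm_intPoint, norm_intPoint, norm_intPoint, norm_intPoint, ← Real.sqrt_mul (hself u'),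
      ← Real.sqrt_mul (hself u), ← Int.cast_mul, hnorm]
    push_cast
    rw [Real.sqrt_mul (sq_nonneg _), Real.sqrt_sq hk'.le]
  refine dualAngle_pair_congr (intPoint_ne_zero hu') (intPoint_ne_zero hv') (intPoint_ne_zero hu)
    (intPoint_ne_zero hv) ?_
  rw [InnerProductGeometry.angle, InnerProductGeometry.angle, hnorm', inner_intPoint,
    inner_intPoint, h, Int.cast_mul, mul_div_mul_left _ _ hk'.ne']

theorem wedgeAngle_of_dotProduct_eq_zero (hu : u ≠ 0) (hv : v ≠ 0) (h : u ⬝ᵥ v = 0) :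
    wedgeAngle u v = 1 / 4 :=
  dualAngle_pair_of_inner_eq_zero (intPoint_ne_zero hu) (intPoint_ne_zero hv) (by
    rw [inner_intPoint, h, Int.cast_zero])

theorem wedgeAngle_bisector (hu : u ≠ 0) (hv : v ≠ 0) (huv : u + v ≠ 0) (h : u ⬝ᵥ u = v ⬝ᵥ v) :
    wedgeAngle u v + 2 * wedgeAngle u (-(u + v)) = 1 / 2 := by
  rw [wedgeAngle, wedgeAngle, map_neg, map_add]
  exact dualAngle_pair_bisector (intPoint_ne_zero hu) (intPoint_ne_zero hv)
    (map_add intPoint u v ▸ intPoint_ne_zero huv) (by rw [norm_intPoint, norm_intPoint, h])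

theorem wedgeAngle_pi_div_four : wedgeAngle ![1, 0, 0] ![-1, -1, 0] = 1 / 8 := by
  have hbisect := wedgeAngle_bisector (u := ![1, 0, 0]) (v := ![0, 1, 0]) (by decide) (by decide)
    (by decide) (by decide)
  have hsum : -(![1, 0, 0] + ![0, 1, 0]) = (![-1, -1, 0] : Fin 3 → ℤ) := by decide
  rw [wedgeAngle_of_dotProduct_eq_zero (by decide) (by decide) (by decide), hsum] at hbisect
  linarith

theorem wedgeAngle_pi_div_three : wedgeAngle ![1, -1, 0] ![0, 1, -1] = 1 / 6 := by
  have hbisect := wedgeAngle_bisector (u := ![1, -1, 0]) (v := ![0, 1, -1]) (by decide) (by decide)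
    (by decide) (by decide)
  rw [wedgeAngle_congr (u := ![1, -1, 0]) (v := ![0, 1, -1]) (u' := ![1, -1, 0])
    (v' := -(![1, -1, 0] + ![0, 1, -1])) one_pos
    (by decide) (by decide) (by decide) (by decide) (by decide) (by decide)] at hbisect
  linarith

/-- Twice the dihedral angle of the corner of a cube at the facet through its three neighbours,
plus the dihedral angle of a regular tetrahedron, is `π`. -/
theorem wedgeAngle_regular_add_two_mul_wedgeAngle_corner :
    wedgeAngle ![1, 1, -1] ![1, -1, 1] + 2 * wedgeAngle ![1, 1, -1] ![-1, 0, 0] = 1 / 2 := by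
  have hbisect := wedgeAngle_bisector (u := ![1, 1, -1]) (v := ![1, -1, 1]) (by decide)
    (by decide) (by decide) (by decide)
  rwa [wedgeAngle_congr (u := ![1, 1, -1]) (v := ![-1, 0, 0]) (u' := ![1, 1, -1])
    (v' := -(![1, 1, -1] + ![1, -1, 1])) two_pos
    (by decide) (by decide) (by decide) (by decide) (by decide) (by decide)] at hbisect

end WedgeAngle

section TetrahedronDefects

open Matrix

theorem facetNormal_ne_zero : ∀ i j, facetNormal i j ≠ 0 := by
  decide

theorem dilatedHull_tetrahedronVertex_one (i : Fin 3) :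
    dilatedHull (tetrahedronVertex i) 1 Finset.univ =
      convexHull ℝ (Set.range (tetrahedronPoint i)) := by
  rw [dilatedHull, Finset.coe_univ, Set.image_univ]
  simp only [one_smul]
  rfl

theorem convexHull_tetrahedronPoint_eq (i : Fin 3) : convexHull ℝ (Set.range (tetrahedronPoint i)) =
    {x | ∀ j, (facetOffset i j : ℝ) ≤ inner ℝ (intPoint (facetNormal i j)) x} := by
  have hpos : (0 : ℝ) < facetHeight i := Int.cast_pos.2 (facetHeight_pos i)
  let b : AffineBasis (Fin 4) ℝ (EuclideanSpace ℝ (Fin 3)) :=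
    ⟨tetrahedronPoint i, affineIndependent_tetrahedronPoint i,
      (affineIndependent_tetrahedronPoint i).affineSpan_eq_top_iff_card_eq_finrank_add_one.2
        (by simp)⟩
  have hcoord : ∀ x j, inner ℝ (intPoint (facetNormal i j)) x =
      facetOffset i j + b.coord j x * facetHeight i := fun x j => by
    conv_lhs => rw [← b.linear_combination_coord_eq_self x]
    simp only [inner_sum, real_inner_smul_right]
    change ∑ a, b.coord a x * inner ℝ _ (tetrahedronPoint i a) = _
    simp only [inner_facetNormal_tetrahedronPoint, mul_add, Finset.sum_add_distrib,
      ← Finset.sum_mul, b.sum_coord_apply_eq_one, one_mul, mul_ite, mul_zero, Finset.sum_ite_eq',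
      Finset.mem_univ, if_true]
  change convexHull ℝ (Set.range b) = _
  simp only [b.convexHull_eq_nonneg_coord, hcoord, le_add_iff_nonneg_right,
    mul_nonneg_iff_of_pos_right hpos]

/-- The facets of the `i`-th tetrahedron whose planes contain an integer point. -/
def activeFacets (i : Fin 3) (z : Fin 3 → ℤ) : Finset (Fin 4) :=
  {j | facetNormal i j ⬝ᵥ z = facetOffset i j}

/-- The solid angle of the cone cut out by the facets `A` of the `i`-th tetrahedron. -/
noncomputable def facetConeAngle (i : Fin 3) (A : Finset (Fin 4)) : ℝ :=
  dualAngle ((fun j => intPoint (facetNormal i j)) '' A)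

theorem facetConeAngle_empty (i : Fin 3) : facetConeAngle i ∅ = 1 := by
  rw [facetConeAngle, Finset.coe_empty, Set.image_empty, dualAngle_empty]

theorem facetConeAngle_singleton (i : Fin 3) (j : Fin 4) : facetConeAngle i {j} = 1 / 2 := by
  rw [facetConeAngle, Finset.coe_singleton, Set.image_singleton,
    dualAngle_singleton (intPoint_ne_zero (facetNormal_ne_zero i j))]

theorem facetConeAngle_pair (i : Fin 3) (j k : Fin 4) :
    facetConeAngle i {j, k} = wedgeAngle (facetNormal i j) (facetNormal i k) := by
  rw [facetConeAngle, Finset.coe_pair, Set.image_pair, wedgeAngle]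

theorem facetConeAngle_triple (i : Fin 3) (j k l : Fin 4) : facetConeAngle i {j, k, l} =
    (wedgeAngle (facetNormal i j) (facetNormal i k) +
      wedgeAngle (facetNormal i j) (facetNormal i l) +
      wedgeAngle (facetNormal i k) (facetNormal i l) - 1 / 2) / 2 := by
  rw [facetConeAngle, Finset.coe_insert, Finset.coe_pair, Set.image_insert_eq, Set.image_pair,
    dualAngle_intPoint_triple (facetNormal_ne_zero i j) (facetNormal_ne_zero i k)
      (facetNormal_ne_zero i l)]

/-- The integer points of the tetrahedra, listed by means of a common bounding box. -/
noncomputable def latticePoints (i : Fin 3) : Finset (Fin 3 → ℤ) :=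
  {z ∈ Finset.Icc ![0, -2, -3] ![5, 2, 2] | ∀ j, facetOffset i j ≤ facetNormal i j ⬝ᵥ z}

theorem intPoint_mem_tetrahedron_iff {i : Fin 3} {z : Fin 3 → ℤ} :
    intPoint z ∈ convexHull ℝ (Set.range (tetrahedronPoint i)) ↔
      ∀ j, facetOffset i j ≤ facetNormal i j ⬝ᵥ z := by
  simp only [convexHull_tetrahedronPoint_eq, Set.mem_ofPred_eq, inner_intPoint, Int.cast_le]

theorem mem_latticePoints {i : Fin 3} {z : Fin 3 → ℤ} :
    z ∈ latticePoints i ↔ ∀ j, facetOffset i j ≤ facetNormal i j ⬝ᵥ z := by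
  rw [latticePoints, Finset.mem_filter, and_iff_right_of_imp]
  fin_cases i <;>
    simp only [Finset.mem_Icc, Pi.le_def, Fin.forall_fin_succ, IsEmpty.forall_iff, and_true,
      dotProduct, Fin.sum_univ_three, facetNormal, facetOffset, Fin.succ_zero_eq_one,
      Fin.succ_one_eq_two, Fin.reduceSucc, Fin.reduceFinMk, Fin.zero_eta, Fin.mk_one,
      Matrix.cons_val] <;>
    omega

theorem solidAngle_tetrahedron {i : Fin 3} {z : Fin 3 → ℤ}
    (hz : ∀ j, facetOffset i j ≤ facetNormal i j ⬝ᵥ z) :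
    solidAngle (convexHull ℝ (Set.range (tetrahedronPoint i))) (intPoint z) =
      facetConeAngle i (activeFacets i z) := by
  rw [facetConeAngle, convexHull_tetrahedronPoint_eq, solidAngle_setOf_forall_le_inner fun j => by
    rw [inner_intPoint]; exact_mod_cast hz j]
  simp [inner_intPoint, activeFacets]

theorem discreteVolume_tetrahedron (i : Fin 3) :
    discreteVolume (convexHull ℝ (Set.range (tetrahedronPoint i))) =
      (((latticePoints i).val.map (activeFacets i)).map (facetConeAngle i)).sum := by
  have hbody := isConvexBody_convexHull (Set.finite_range (tetrahedronPoint i))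
  rw [hbody.discreteVolume_eq_finsum, finsum_eq_sum_of_support_subset (s := latticePoints i),
    Multiset.map_map]
  · exact Finset.sum_congr rfl fun z hz => solidAngle_tetrahedron (mem_latticePoints.1 hz)
  · intro z hz
    rw [Finset.mem_coe, mem_latticePoints, ← intPoint_mem_tetrahedron_iff]
    by_contra hmem
    exact hz (solidAngle_eq_zero hbody.isCompact.isClosed hmem)

theorem volumeReal_tetrahedron (i : Fin 3) :
    volume.real (convexHull ℝ (Set.range (tetrahedronPoint i))) = ![1 / 3, 9 / 2, 9 / 2] i := by
  have hdet : |(Matrix.of ![tetrahedronVertex i 1 - tetrahedronVertex i 0,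
      tetrahedronVertex i 2 - tetrahedronVertex i 0,
      tetrahedronVertex i 3 - tetrahedronVertex i 0]).det| = ![2, 27, 27] i := by
    rw [Matrix.det_fin_three]
    revert i
    decide
  rw [← dilatedHull_tetrahedronVertex_one,
    volumeReal_dilatedHull_one (affineIndependent_tetrahedronPoint i), ← Int.cast_abs, hdet]
  fin_cases i <;> norm_num

theorem map_activeFacets_latticePoints : (latticePoints 0).val.map (activeFacets 0) =
      {{0, 1, 2}, {0, 1, 3}, {0, 2, 3}, {1, 2, 3}} ∧
    (latticePoints 1).val.map (activeFacets 1) =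
      {∅, ∅, {1}, {2}, {0, 3}, {0, 3}, {0, 1, 2}, {0, 1, 3}, {0, 2, 3}, {1, 2, 3}} ∧
    (latticePoints 2).val.map (activeFacets 2) =
      {∅, ∅, ∅, ∅, {0, 2}, {0, 2}, {1, 3}, {1, 3}, {0, 1, 2}, {0, 1, 3}, {0, 2, 3}, {1, 2, 3}} := by
  decide +kernel

theorem volumeDefect_tetrahedron_zero :
    volumeDefect (convexHull ℝ (Set.range (tetrahedronPoint 0))) =
      6 * wedgeAngle ![1, 1, -1] ![1, -1, 1] - 4 / 3 := by
  have hedge : ∀ j k, j < k → wedgeAngle (facetNormal 0 j) (facetNormal 0 k) =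
      wedgeAngle ![1, 1, -1] ![1, -1, 1] := fun j k hjk =>
    wedgeAngle_congr one_pos (by decide) (by decide) (facetNormal_ne_zero 0 j)
      (facetNormal_ne_zero 0 k) (by revert j k; decide) (by revert j k; decide)
  rw [volumeDefect, discreteVolume_tetrahedron, volumeReal_tetrahedron,
    map_activeFacets_latticePoints.1]
  simp only [Multiset.insert_eq_cons, Multiset.map_cons, Multiset.sum_cons, Multiset.map_singleton,
    Multiset.sum_singleton, facetConeAngle_triple]
  rw [hedge 0 1 (by decide), hedge 0 2 (by decide), hedge 0 3 (by decide), hedge 1 2 (by decide),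
    hedge 1 3 (by decide), hedge 2 3 (by decide)]
  norm_num
  ring

theorem volumeDefect_tetrahedron_one :
    volumeDefect (convexHull ℝ (Set.range (tetrahedronPoint 1))) =
      5 * wedgeAngle ![1, 1, -1] ![-1, 0, 0] - 7 / 4 := by
  have hbase : ∀ k, 0 < k → wedgeAngle (facetNormal 1 0) (facetNormal 1 k) =
      wedgeAngle ![1, 1, -1] ![-1, 0, 0] := fun k hk =>
    wedgeAngle_congr (k := 9) (by decide) (by decide) (by decide) (facetNormal_ne_zero 1 0)
      (facetNormal_ne_zero 1 k) (by revert k; decide) (by revert k; decide)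
  have hright : ∀ j k, 0 < j → j < k → wedgeAngle (facetNormal 1 j) (facetNormal 1 k) = 1 / 4 :=
    fun j k hj hk => wedgeAngle_of_dotProduct_eq_zero (facetNormal_ne_zero 1 j)
      (facetNormal_ne_zero 1 k) (by revert j k; decide)
  rw [volumeDefect, discreteVolume_tetrahedron, volumeReal_tetrahedron,
    map_activeFacets_latticePoints.2.1]
  simp only [Multiset.insert_eq_cons, Multiset.map_cons, Multiset.sum_cons, Multiset.map_singleton,
    Multiset.sum_singleton, facetConeAngle_triple, facetConeAngle_pair, facetConeAngle_singleton,
    facetConeAngle_empty]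
  rw [hbase 1 (by decide), hbase 2 (by decide), hbase 3 (by decide),
    hright 1 2 (by decide) (by decide), hright 1 3 (by decide) (by decide),
    hright 2 3 (by decide) (by decide)]
  norm_num
  ring

theorem volumeDefect_tetrahedron_two :
    volumeDefect (convexHull ℝ (Set.range (tetrahedronPoint 2))) = 2 / 3 := by
  have hcongr : ∀ {j k u v}, u ≠ 0 → v ≠ 0 →
      facetNormal 2 j ⬝ᵥ facetNormal 2 k = 9 * (u ⬝ᵥ v) →
      (facetNormal 2 j ⬝ᵥ facetNormal 2 j) * (facetNormal 2 k ⬝ᵥ facetNormal 2 k) =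
        9 ^ 2 * ((u ⬝ᵥ u) * (v ⬝ᵥ v)) →
      wedgeAngle (facetNormal 2 j) (facetNormal 2 k) = wedgeAngle u v := fun {j k} _ _ hu hv =>
    wedgeAngle_congr (by decide) hu hv (facetNormal_ne_zero 2 j) (facetNormal_ne_zero 2 k)
  have h01 : wedgeAngle (facetNormal 2 0) (facetNormal 2 1) = 1 / 8 :=
    (hcongr (by decide) (by decide) (by decide) (by decide)).trans wedgeAngle_pi_div_four
  have h23 : wedgeAngle (facetNormal 2 2) (facetNormal 2 3) = 1 / 8 :=
    (hcongr (by decide) (by decide) (by decide) (by decide)).trans wedgeAngle_pi_div_four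
  have h12 : wedgeAngle (facetNormal 2 1) (facetNormal 2 2) = 1 / 6 :=
    (hcongr (by decide) (by decide) (by decide) (by decide)).trans wedgeAngle_pi_div_three
  have hright : ∀ {j k}, facetNormal 2 j ⬝ᵥ facetNormal 2 k = 0 →
      wedgeAngle (facetNormal 2 j) (facetNormal 2 k) = 1 / 4 := fun {j k} =>
    wedgeAngle_of_dotProduct_eq_zero (facetNormal_ne_zero 2 j) (facetNormal_ne_zero 2 k)
  rw [volumeDefect, discreteVolume_tetrahedron, volumeReal_tetrahedron,
    map_activeFacets_latticePoints.2.2]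
  simp only [Multiset.insert_eq_cons, Multiset.map_cons, Multiset.sum_cons, Multiset.map_singleton,
    Multiset.sum_singleton, facetConeAngle_triple, facetConeAngle_pair, facetConeAngle_empty,
    Matrix.cons_val]
  rw [h01, h12, h23, hright (j := 0) (k := 2) (by decide), hright (j := 0) (k := 3) (by decide),
    hright (j := 1) (k := 3) (by decide)]
  norm_num

theorem volumeDefect_polytopeP : volumeDefect polytopeP = 0 := by
  rw [volumeDefect_polytopeP_eq_sum, Fin.sum_univ_three]
  simp only [dilatedHull_tetrahedronVertex_one, volumeDefect_tetrahedron_zero,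
    volumeDefect_tetrahedron_one, volumeDefect_tetrahedron_two, dilation, Matrix.cons_val]
  push_cast
  linarith [wedgeAngle_regular_add_two_mul_wedgeAngle_corner]

end TetrahedronDefects

theorem proposition4p1 :
    volumeDefect polytopeP = 0 ∧
    (∀ f : ℝ → ℝ, IsKagan f →
      dehnInvariant f polytopeP = -24 * Real.sqrt 2 * f (Real.arccos (1 / 3))) ∧
    (∃ f : ℝ → ℝ, IsKagan f ∧ dehnInvariant f polytopeP ≠ 0) := by
  refine ⟨volumeDefect_polytopeP, fun f hf => dehnInvariant_polytopeP hf, ?_⟩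
  obtain ⟨f, hf, hne⟩ := exists_isKagan_arccos_one_third_ne_zero
  refine ⟨f, hf, ?_⟩
  rw [dehnInvariant_polytopeP hf]
  exact mul_ne_zero (mul_ne_zero (by norm_num) (by positivity)) hne
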